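/- Let $k$ be an algebraically closed field and let $X$ be a reduced projective curve over $k$ (purely one-dimensional, not necessarily connected or irreducible) all of whose singular points are nodes, that is, $\widehat{\mathcal O}_{X,x}\cong k[[x,y]]/(xy)$ for every singular closed point $x$; for example, a chain or a cycle of projective lines with transversal intersections, or an irreducible rational curve with one node. Let $\tilde{\mathcal O}$ be the direct image on $X$ of the structure sheaf of the normalization of $X$, so that $\tilde{\mathcal O}_x$ is the integral closure of $\mathcal O_{X,x}$ in its total ring of fractions, and let $\mathcal J=\mathrm{Ann}_{\mathcal O}(\tilde{\mathcal O}/\mathcal O)$ be the conductor. Then for every coherent sheaf $\mathcal F$ on $X$: 1. either $\mathcal{T}or_i^{\mathcal O}(\mathcal F,\mathcal O/\mathcal J)=0$ for all $i>1$, or $\mathcal{T}or_i^{\mathcal O}(\mathcal F,\mathcal O/\mathcal J)\neq 0$ for all $i\ge 2$; 2. the homological dimension of $\mathcal F$, that is, the least $n\geq 0$ for which there is an exact sequence $0\to\mathcal E_n\to\dots\to\mathcal E_0\to\mathcal F\to 0$ with locally free sheaves $\mathcal E_j$ of finite rank ($\infty$ if there is no such $n$), is $0$, $1$ or $\infty$.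 -/

import Mathlib

universe u

open CategoryTheory AlgebraicGeometry

noncomputable section


/-! ### Tor of presheaves of modules and of sheaves of modules -/

namespace PresheafOfModules

section Monoidal

variable {C : Type*} [Category* C] {R : Cᵒᵖ ⥤ CommRingCat.{u}}

/-- The (sectionwise) tensor product of presheaves of modules is biadditive. -/
instance : MonoidalPreadditive (PresheafOfModules.{u} (R ⋙ forget₂ CommRingCat RingCat)) where
  whiskerLeft_zero {M _ _} := by
    ext1 X
    exact MonoidalPreadditive.whiskerLeft_zero (C := ModuleCat (R.obj X)) (X := M.obj X)
  zero_whiskerRight {M _ _} := by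
    ext1 X
    exact MonoidalPreadditive.zero_whiskerRight (C := ModuleCat (R.obj X)) (X := M.obj X)
  whiskerLeft_add {M _ _} f g := by
    ext1 X
    exact MonoidalPreadditive.whiskerLeft_add (C := ModuleCat (R.obj X)) (X := M.obj X)
      (f.app X) (g.app X)
  add_whiskerRight {M _ _} f g := by
    ext1 X
    exact MonoidalPreadditive.add_whiskerRight (C := ModuleCat (R.obj X)) (X := M.obj X)
      (f.app X) (g.app X)

end Monoidal

section Projective

variable {C : Type u} [SmallCategory.{u} C] {R : Cᵒᵖ ⥤ RingCat.{u}}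

instance (X : C) : Projective ((free R).obj (yoneda.obj X)) where
  factors {E M} f e _ := by
    have he : Function.Surjective (e.app (Opposite.op X)) :=
      (ModuleCat.epi_iff_surjective _).1 inferInstance
    obtain ⟨y, hy⟩ := he (freeYonedaEquiv f)
    refine ⟨freeYonedaEquiv.symm y, freeYonedaEquiv.injective ?_⟩
    rw [freeYonedaEquiv_comp, Equiv.apply_symm_apply, hy]

instance : EnoughProjectives (PresheafOfModules.{u} R) where
  presentation M := ⟨{ p := M.freeYonedaCoproduct, f := M.fromFreeYonedaCoproduct }⟩

end Projective

end PresheafOfModules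

namespace AlgebraicGeometry.Scheme

variable {X : Scheme.{u}}

instance : MonoidalCategory X.PresheafOfModules :=
  inferInstanceAs (MonoidalCategory
    (_root_.PresheafOfModules.{u} (X.presheaf ⋙ forget₂ CommRingCat RingCat)))

instance : MonoidalPreadditive X.PresheafOfModules :=
  inferInstanceAs (MonoidalPreadditive
    (_root_.PresheafOfModules.{u} (X.presheaf ⋙ forget₂ CommRingCat RingCat)))

/-- The sheaf of modules associated to a presheaf of `𝒪_X`-modules. -/
def Modules.ofPresheaf (P : X.PresheafOfModules) : X.Modules :=
  (_root_.PresheafOfModules.sheafification (𝟙 X.ringCatSheaf.obj)).obj P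

/-- The sheaf `𝒯or_i^{𝒪_X}(F, G)` of two `𝒪_X`-modules: the sheaf associated to the presheaf
`U ↦ Tor_i^{Γ(U, 𝒪_X)}(Γ(U, F), Γ(U, G))`. The latter is the left derived functor of the
sectionwise tensor product of presheaves of modules, computed by projective resolutions in the
category of presheaves of modules (whose sections over each `U` are projective resolutions). -/
def Modules.tor (i : ℕ) (F G : X.Modules) : X.Modules :=
  Modules.ofPresheaf (((Tor X.PresheafOfModules i).obj F.val).obj G.val)

/-! ### The conductor -/

/-- The conductor `{a ∈ A | a Ā ⊆ A} = Ann_A(Ā / A)` of a commutative ring `A`, where `Ā` is the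
integral closure of `A` in its total ring of fractions. -/
def conductorOfIntegralClosure (A : Type*) [CommRing A] : Ideal A :=
  (1 : Submodule A (FractionRing A)).colon (integralClosure A (FractionRing A) : Set _)

variable (X) in
/-- The sections over `U` of the conductor `𝒥 = Ann_{𝒪}(Õ / 𝒪)`, where `Õ` is the direct image of
the structure sheaf of the normalization of `X`, so that its stalk `Õ_x` is the integral closure of
`𝒪_{X,x}` in its total ring of fractions. A section of `𝒪` over `U` annihilates the sheaf `Õ / 𝒪`
on `U` if and only if each of its germs annihilates the stalk `Õ_x / 𝒪_{X,x}`. -/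
def conductorIdeal (U : X.Opens) : Ideal Γ(X, U) :=
  ⨅ (x : X) (hx : x ∈ U), (conductorOfIntegralClosure (X.presheaf.stalk x)).comap
    (X.presheaf.germ U x hx).hom

lemma mem_conductorIdeal {U : X.Opens} {a : Γ(X, U)} :
    a ∈ conductorIdeal X U ↔ ∀ (x : X) (hx : x ∈ U),
      X.presheaf.germ U x hx a ∈ conductorOfIntegralClosure (X.presheaf.stalk x) := by
  simp [conductorIdeal]

variable (X) in
/-- The conductor `𝒥`, as a submodule of `𝒪_X`. -/
def conductorSheaf : (_root_.PresheafOfModules.unit X.ringCatSheaf.obj).Submodule where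
  obj U := conductorIdeal X U.unop
  map {U V} f := fun (a : Γ(X, U.unop)) ha ↦ by
    refine mem_conductorIdeal.2 fun x hx ↦ ?_
    have h := mem_conductorIdeal.1 ha x (f.unop.le hx)
    rwa [← TopCat.Presheaf.germ_res_apply X.presheaf f.unop x hx a] at h

variable (X) in
/-- The sheaf of modules `𝒪_X / 𝒥`. -/
def structureSheafModConductor : X.Modules :=
  Modules.ofPresheaf (Limits.cokernel (conductorSheaf X).ι)

/-! ### Coherent sheaves, vector bundles, homological dimension -/

/-- Coherent sheaves on a Noetherian scheme: quasi-coherent sheaves of finite type. -/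
def Modules.IsCoherent (F : X.Modules) : Prop :=
  SheafOfModules.IsQuasicoherent F ∧ SheafOfModules.IsFiniteType F

/-- Vector bundles: locally free sheaves of finite rank (the rank may vary). -/
def Modules.IsVectorBundle (E : X.Modules) : Prop :=
  SheafOfModules.IsLocallyFree E ∧ SheafOfModules.IsFiniteType E

/-- `F` has a resolution `0 → E_n → ⋯ → E_1 → E_0 → F → 0` by vector bundles. It is spliced from
short exact sequences `0 → K → E_0 → F → 0` with a resolution of `K` of length `n - 1`. -/
def Modules.HasVectorBundleResolution : ℕ → X.Modules → Prop
  | 0, F => F.IsVectorBundle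
  | n + 1, F => ∃ (K E : X.Modules) (f : K ⟶ E) (g : E ⟶ F) (w : f ≫ g = 0),
      (ShortComplex.mk f g w).ShortExact ∧ E.IsVectorBundle ∧
        Modules.HasVectorBundleResolution n K

/-- The homological dimension of `F`: the least length of a resolution of `F` by vector bundles,
and `⊤` if there is no finite one. -/
def Modules.homologicalDimension (F : X.Modules) : ℕ∞ :=
  ⨅ (n : ℕ) (_ : F.HasVectorBundleResolution n), (n : ℕ∞)

end AlgebraicGeometry.Scheme

namespace AlgebraicGeometry

/-! ### Projective curves with nodal singularities -/

attribute [local instance] MvPolynomial.gradedAlgebra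

/-- The structure morphism `ℙⁿ_k = Proj k[x_0, …, x_n] ⟶ Spec k`. -/
def projectiveSpaceToSpec (k : Type u) [Field k] (n : ℕ) :
    Proj (MvPolynomial.homogeneousSubmodule (Fin (n + 1)) k) ⟶ Spec (.of k) :=
  Proj.toSpecZero (MvPolynomial.homogeneousSubmodule (Fin (n + 1)) k) ≫
    Spec.map (CommRingCat.ofHom
      (algebraMap k (MvPolynomial.homogeneousSubmodule (Fin (n + 1)) k 0)))

/-- A projective `k`-scheme: a closed `k`-subscheme of some `ℙⁿ_k`. -/
def IsProjectiveOver {k : Type u} [Field k] {X : Scheme.{u}} (f : X ⟶ Spec (.of k)) : Prop :=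
  ∃ (n : ℕ) (i : X ⟶ Proj (MvPolynomial.homogeneousSubmodule (Fin (n + 1)) k)),
    IsClosedImmersion i ∧ i ≫ projectiveSpaceToSpec k n = f

/-- A node (ordinary double point with two branches): the completed local ring at `x` is
`k[[x, y]] / (x y)`. -/
def IsNode (k : Type u) [Field k] {X : Scheme.{u}} (x : X) : Prop :=
  Nonempty (AdicCompletion (IsLocalRing.maximalIdeal (X.presheaf.stalk x)) (X.presheaf.stalk x) ≃+*
    MvPowerSeries (Fin 2) k ⧸
      Ideal.span {(MvPowerSeries.X 0 * MvPowerSeries.X 1 : MvPowerSeries (Fin 2) k)})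

/-- A reduced projective curve over `k`, not necessarily connected or irreducible, all of whose
singular points are nodes. -/
structure IsNodalProjectiveCurve {k : Type u} [Field k] {X : Scheme.{u}}
    (f : X ⟶ Spec (.of k)) : Prop where
  isProjective : IsProjectiveOver f
  isReduced : IsReduced X
  dim_eq_one : ∀ x : X, IsClosed {x} → ringKrullDim (X.presheaf.stalk x) = 1
  regular_or_node : ∀ x : X, IsClosed {x} →
    IsRegularLocalRing (X.presheaf.stalk x) ∨ IsNode k x

end AlgebraicGeometry

end

/-!
# Tor modulo the conductor and homological dimension on nodal projective curves

The local ring of the curve at a closed point is Noetherian, reduced and of dimension one, hence of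
depth one (`hasDepthOne_of_isReduced`). The algebraic heart of the proof is an instance of the
Auslander–Buchsbaum formula over such a ring: a torsion-free module with a free resolution
`0 → K → L → M → 0` of length one is free (`free_of_exact_of_regular_smul_injective`). Both parts
of the theorem follow from it by dimension shifting.

*Tor.* The stalks of `𝒯or_i(F, 𝒪 / 𝒥)` are the `Tor_i` of the stalks
(`PresheafOfModules.subsingleton_stalk_tor_iff`), since the stalks of projective presheaves of
modules are flat, and their vanishing may be tested at the closed points. At a regular closed point
the local ring is a discrete valuation ring, so that `Tor_i` vanishes for `i ≥ 2` in any case. At a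
node the conductor is the maximal ideal (`Branches.conductor_eq`), and the stalk of `𝒪 / 𝒥` is the
residue field. If `Tor_{n + 2}` of a module with the residue field vanishes, then some syzygy of
the module is free; as the syzygies embed in free modules, they are torsion-free, so descending
induction shows that already the first syzygy is free, and `Tor_i` vanishes for all `i ≥ 2`
(`TorVanishes.succ_of_succ`). Hence the vanishing of a single `𝒯or_i` with `i ≥ 2` implies that of
all of them.

The local ring `A` of a node is studied through its two branches, homomorphisms `A → k⟦X⟧` for which
`A` is dense in the fibre product `k⟦X⟧ ×ₖ k⟦X⟧` and the powers of the maximal ideal are the ideals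
of elements divisible by `X ^ n` on both branches (`Branches`). To identify the stalk of `𝒪 / 𝒥`,
one needs that the ideal sheaf `𝒥` is trivial on a punctured neighbourhood of a node, that is,
that nodes are isolated: the smooth locus is open, it contains the generic points because `k` is
algebraically closed, and it contains no node (`Branches.not_formallySmooth`).

*Homological dimension.* In a finite resolution by vector bundles, the kernel of `E₀ → F` is a
subsheaf of `E₀`, so its stalks are torsion-free; by descending induction along the resolution its
stalks are free, and so it is a vector bundle. Thus the resolution may be truncated to length one.
The passage from free stalks to vector bundles uses frames, that is, families of sections which
form a basis of each stalk: a sheaf is a vector bundle if it has a finite frame near each point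
(`Modules.isVectorBundle_of_exists_isFrame`), and a basis of the stalk of a vector bundle at a point
extends to a frame near this point, where a determinant is invertible
(`IsFrame.exists_isFrame_res`).
-/

universe v v' u'

noncomputable section

/-! ### Stalks of presheaves of modules -/

namespace PresheafOfModules

open TopologicalSpace Opposite MonoidalCategory

variable {X : TopCat.{u}} {R : X.Presheaf CommRingCat.{u}}

/-- The stalk of a presheaf of modules over a presheaf of commutative rings `R`, a module over
the stalk of `R`. -/
abbrev Stalk (M : PresheafOfModules.{u} (R ⋙ forget₂ CommRingCat RingCat)) (x : X) : Type u :=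
  ↑(TopCat.Presheaf.stalk M.presheaf x)

variable (M N P : PresheafOfModules.{u} (R ⋙ forget₂ CommRingCat RingCat)) (x : X)

/-- The germ at `x` of a section of a presheaf of modules, as an additive map. -/
def germAt (U : Opens X) (hx : x ∈ U) : M.obj (op U) →+ M.Stalk x :=
  (TopCat.Presheaf.germ M.presheaf U x hx).hom

variable {M x}

lemma exists_germAt_eq (s : M.Stalk x) :
    ∃ (U : Opens X) (hx : x ∈ U) (m : M.obj (op U)), M.germAt x U hx m = s :=
  TopCat.Presheaf.exists_germ_eq M.presheaf s

/-- Restriction of sections, as an additive map. -/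
def res {U V : Opens X} (i : V ⟶ U) : M.obj (op U) →+ M.obj (op V) :=
  (M.map i.op).hom.toAddMonoidHom

lemma res_res {U V W : Opens X} (i : V ⟶ U) (j : W ⟶ V) (m : M.obj (op U)) :
    res j (res i m) = res (j ≫ i) m :=
  (M.map_comp_apply i.op j.op m).symm

lemma app_res {N : PresheafOfModules.{u} (R ⋙ forget₂ CommRingCat RingCat)} (f : M ⟶ N)
    {U V : Opens X} (i : V ⟶ U) (m : M.obj (op U)) :
    f.app (op V) (res i m) = res i (f.app (op U) m) :=
  naturality_apply f i.op m

lemma res_smul {U V : Opens X} (i : V ⟶ U) (r : R.obj (op U)) (m : M.obj (op U)) :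
    res i (r • m) = (R.map i.op).hom r • res i m :=
  M.map_smul i.op r m

lemma germAt_res {U V : Opens X} (i : V ⟶ U) (hx : x ∈ V) (m : M.obj (op U)) :
    M.germAt x V hx (res i m) = M.germAt x U (i.le hx) m :=
  TopCat.Presheaf.germ_res_apply M.presheaf i x hx m

lemma germAt_smul {U : Opens X} (hx : x ∈ U) (r : R.obj (op U)) (m : M.obj (op U)) :
    M.germAt x U hx (r • m) = (R.germ U x hx).hom r • M.germAt x U hx m :=
  M.germ_smul x U hx r m

lemma exists_map_eq_of_germAt_eq {U V : Opens X} (hU : x ∈ U) (hV : x ∈ V) (m : M.obj (op U))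
    (n : M.obj (op V)) (h : M.germAt x U hU m = M.germAt x V hV n) :
    ∃ (W : Opens X) (_ : x ∈ W) (i : W ⟶ U) (j : W ⟶ V), res i m = res j n :=
  TopCat.Presheaf.germ_eq M.presheaf x hU hV m n h

lemma exists_map_eq_zero_of_germAt_eq_zero {U : Opens X} (hU : x ∈ U) (m : M.obj (op U))
    (h : M.germAt x U hU m = 0) :
    ∃ (W : Opens X) (_ : x ∈ W) (i : W ⟶ U), res i m = 0 := by
  obtain ⟨W, hW, i, j, e⟩ := exists_map_eq_of_germAt_eq hU hU m (0 : M.obj (op U))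
    (by simpa using h)
  exact ⟨W, hW, i, e.trans (map_zero _)⟩

variable (M x)

/-- A family of additive maps from the sections over the neighbourhoods of `x`, compatible with
restrictions, factors through the stalk. -/
def stalkLift {Q : Type u} [AddCommGroup Q] (φ : ∀ U : Opens X, x ∈ U → M.obj (op U) →+ Q)
    (hφ : ∀ (U V : Opens X) (i : V ⟶ U) (hx : x ∈ V) (m : M.obj (op U)),
      φ V hx (res i m) = φ U (i.le hx) m) : M.Stalk x →+ Q :=
  (Limits.colimit.desc ((OpenNhds.inclusion x).op ⋙ M.presheaf)
    { pt := AddCommGrpCat.of Q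
      ι := { app := fun U ↦ AddCommGrpCat.ofHom (φ U.unop.1 U.unop.2)
             naturality := fun U V i ↦ by
               ext m
               exact hφ U.unop.1 V.unop.1 ((OpenNhds.inclusion x).map i.unop) V.unop.2 m } } :
    TopCat.Presheaf.stalk M.presheaf x ⟶ AddCommGrpCat.of Q).hom

@[simp]
lemma stalkLift_germAt {Q : Type u} [AddCommGroup Q]
    (φ : ∀ U : Opens X, x ∈ U → M.obj (op U) →+ Q)
    (hφ : ∀ (U V : Opens X) (i : V ⟶ U) (hx : x ∈ V) (m : M.obj (op U)),
      φ V hx (res i m) = φ U (i.le hx) m) (U : Opens X) (hx : x ∈ U) (m : M.obj (op U)) :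
    M.stalkLift x φ hφ (M.germAt x U hx m) = φ U hx m :=
  ConcreteCategory.congr_hom (Limits.colimit.ι_desc (F := (OpenNhds.inclusion x).op ⋙ M.presheaf)
    { pt := AddCommGrpCat.of Q
      ι := { app := fun U ↦ AddCommGrpCat.ofHom (φ U.unop.1 U.unop.2)
             naturality := fun U V i ↦ by
               ext m
               exact hφ U.unop.1 V.unop.1 ((OpenNhds.inclusion x).map i.unop) V.unop.2 m } }
    (op ⟨U, hx⟩)) m

variable {M N P}

/-- The linear map induced on stalks by a morphism of presheaves of modules. -/
def stalkMap (f : M ⟶ N) : M.Stalk x →ₗ[R.stalk x] N.Stalk x where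
  toFun := ((TopCat.Presheaf.stalkFunctor Ab x).map ((toPresheaf _).map f)).hom
  map_add' := map_add _
  map_smul' r s := by
    obtain ⟨U, hU, m, rfl⟩ := exists_germAt_eq s
    obtain ⟨V, hVU, hV, a, rfl⟩ := TopCat.Presheaf.exists_le_germ_eq R r hU
    have key (W : Opens X) (hW : x ∈ W) (m : M.obj (op W)) :
        ((TopCat.Presheaf.stalkFunctor Ab x).map ((toPresheaf _).map f)).hom (M.germAt x W hW m) =
          N.germAt x W hW (f.app (op W) m) :=
      TopCat.Presheaf.stalkFunctor_map_germ_apply W x hW ((toPresheaf _).map f) m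
    rw [← germAt_res (homOfLE hVU) hV m]
    erw [← germAt_smul, key, key, ← germAt_smul]
    congr 1
    exact (f.app (op V)).hom.map_smul a _

lemma stalkMap_germAt (f : M ⟶ N) (U : Opens X) (hx : x ∈ U) (m : M.obj (op U)) :
    stalkMap x f (M.germAt x U hx m) = N.germAt x U hx (f.app (op U) m) :=
  TopCat.Presheaf.stalkFunctor_map_germ_apply U x hx ((toPresheaf _).map f) m

lemma stalkMap_exact {f : M ⟶ N} {g : N ⟶ P}
    (h : ∀ U : Opens X, Function.Exact (f.app (op U)).hom (g.app (op U)).hom) :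
    Function.Exact (stalkMap x f) (stalkMap x g) := by
  intro s
  constructor
  · intro hs
    obtain ⟨U, hU, n, rfl⟩ := exists_germAt_eq s
    rw [stalkMap_germAt] at hs
    obtain ⟨V, hV, i, e⟩ := exists_map_eq_zero_of_germAt_eq_zero hU _ hs
    rw [← app_res] at e
    obtain ⟨m, hm⟩ := (h V _).1 e
    refine ⟨M.germAt x V hV m, ?_⟩
    rw [stalkMap_germAt]
    erw [hm]
    rw [germAt_res]
  · rintro ⟨s, rfl⟩
    obtain ⟨U, hU, n, rfl⟩ := exists_germAt_eq s
    rw [stalkMap_germAt, stalkMap_germAt]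
    erw [(h U).apply_apply_eq_zero n]
    exact map_zero _

lemma stalkMap_surjective {f : M ⟶ N}
    (h : ∀ U : Opens X, Function.Surjective (f.app (op U)).hom) :
    Function.Surjective (stalkMap x f) := by
  intro s
  obtain ⟨U, hU, n, rfl⟩ := exists_germAt_eq s
  obtain ⟨m, rfl⟩ := h U n
  exact ⟨M.germAt x U hU m, stalkMap_germAt x f U hU m⟩

/-! ### Stalks of tensor products of presheaves of modules -/

open scoped TensorProduct

variable (M N)

/-- The pure tensor of two sections over the same open subset. -/
def tensorMk {U : Opens X} (m : M.obj (op U)) (n : N.obj (op U)) : (M ⊗ N).obj (op U) :=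
  (m ⊗ₜ[R.obj (op U)] n : M.obj (op U) ⊗[R.obj (op U)] N.obj (op U))

lemma tensorObj_induction {U : Opens X} {p : (M ⊗ N).obj (op U) → Prop} (h0 : p 0)
    (hadd : ∀ a b, p a → p b → p (a + b)) (hmk : ∀ m n, p (tensorMk M N m n)) (t) : p t :=
  TensorProduct.induction_on (R := R.obj (op U)) (M := M.obj (op U)) (N := N.obj (op U))
    (motive := p) t h0 hmk hadd

lemma res_tensorMk {U V : Opens X} (i : V ⟶ U) (m : M.obj (op U)) (n : N.obj (op U)) :
    res i (tensorMk M N m n) = tensorMk M N (res i m) (res i n) :=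
  rfl

/-- Tensoring the germs at `x` of sections over a given neighbourhood. -/
def stalkTensorHomAux {U : Opens X} (hx : x ∈ U) :
    (M ⊗ N).obj (op U) →+ M.Stalk x ⊗[R.stalk x] N.Stalk x :=
  TensorProduct.liftAddHom (R := R.obj (op U)) (M := M.obj (op U)) (N := N.obj (op U))
    { toFun := fun m ↦
        { toFun := fun n ↦ M.germAt x U hx m ⊗ₜ N.germAt x U hx n
          map_zero' := by rw [map_zero, TensorProduct.tmul_zero]
          map_add' := fun a b ↦ by rw [map_add, TensorProduct.tmul_add] }
      map_zero' := by ext n; simp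
      map_add' := fun a b ↦ by ext n; simp [TensorProduct.add_tmul] }
    (fun r m n ↦ by
      simp only [AddMonoidHom.coe_mk, ZeroHom.coe_mk]
      erw [germAt_smul, germAt_smul]
      rw [TensorProduct.smul_tmul])

lemma stalkTensorHomAux_tensorMk {U : Opens X} (hx : x ∈ U) (m : M.obj (op U))
    (n : N.obj (op U)) : stalkTensorHomAux M N x hx (tensorMk M N m n) =
      M.germAt x U hx m ⊗ₜ N.germAt x U hx n :=
  rfl

/-- The comparison map from the stalk of a tensor product to the tensor product of the stalks. -/
def stalkTensorHom : (M ⊗ N).Stalk x →+ M.Stalk x ⊗[R.stalk x] N.Stalk x :=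
  stalkLift (M ⊗ N) x (fun U hx ↦ stalkTensorHomAux M N x hx) (fun U V i hx t ↦ by
    let f : (M ⊗ N).obj (op U) →+ M.Stalk x ⊗[R.stalk x] N.Stalk x :=
      (stalkTensorHomAux M N x hx).comp (res i)
    change f t = stalkTensorHomAux M N x (i.le hx) t
    induction t using tensorObj_induction with
    | h0 => rw [map_zero, map_zero]
    | hadd a b ha hb => rw [map_add, map_add, ha, hb]
    | hmk m n =>
      change stalkTensorHomAux M N x hx (res i (tensorMk M N m n)) = _
      rw [res_tensorMk, stalkTensorHomAux_tensorMk, stalkTensorHomAux_tensorMk, germAt_res,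
        germAt_res])

lemma stalkTensorHom_tensorMk {U : Opens X} (hx : x ∈ U) (m : M.obj (op U)) (n : N.obj (op U)) :
    stalkTensorHom M N x ((M ⊗ N).germAt x U hx (tensorMk M N m n)) =
      M.germAt x U hx m ⊗ₜ N.germAt x U hx n := by
  rw [stalkTensorHom, stalkLift_germAt]
  rfl

lemma tensorMk_zero_left {U : Opens X} (n : N.obj (op U)) : tensorMk M N (0 : M.obj (op U)) n = 0 :=
  TensorProduct.zero_tmul _ _

lemma tensorMk_zero_right {U : Opens X} (m : M.obj (op U)) :
    tensorMk M N m (0 : N.obj (op U)) = 0 :=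
  TensorProduct.tmul_zero _ _

lemma tensorMk_add_left {U : Opens X} (m m' : M.obj (op U)) (n : N.obj (op U)) :
    tensorMk M N (m + m') n = tensorMk M N m n + tensorMk M N m' n :=
  TensorProduct.add_tmul _ _ _

lemma tensorMk_add_right {U : Opens X} (m : M.obj (op U)) (n n' : N.obj (op U)) :
    tensorMk M N m (n + n') = tensorMk M N m n + tensorMk M N m n' :=
  TensorProduct.tmul_add _ _ _

lemma tensorMk_smul_left {U : Opens X} (r : R.obj (op U)) (m : M.obj (op U)) (n : N.obj (op U)) :
    tensorMk M N (r • m) n = tensorMk M N m (r • n) :=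
  TensorProduct.smul_tmul _ _ _

/-- Tensoring the germ at `x` of a section over `U` with germs at `x`. -/
def stalkTensorInvAux {U : Opens X} (hU : x ∈ U) (m : M.obj (op U)) :
    N.Stalk x →+ (M ⊗ N).Stalk x :=
  stalkLift N x
    (fun V hV ↦
      { toFun := fun n ↦ (M ⊗ N).germAt x (U ⊓ V) (Opens.mem_inf.2 ⟨hU, hV⟩)
          (tensorMk M N (res (homOfLE inf_le_left) m) (res (homOfLE inf_le_right) n))
        map_zero' := by
          rw [map_zero, tensorMk_zero_right, map_zero]
        map_add' := fun a b ↦ by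
          rw [map_add, tensorMk_add_right, map_add] })
    (fun V W i hx n ↦ by
      simp only [AddMonoidHom.coe_mk, ZeroHom.coe_mk]
      rw [← germAt_res (M := M ⊗ N) (homOfLE (inf_le_inf_left U i.le) : U ⊓ W ⟶ U ⊓ V)
        (Opens.mem_inf.2 ⟨hU, hx⟩), res_tensorMk]
      rw [res_res, res_res, res_res]
      rfl)

lemma stalkTensorInvAux_germAt {U : Opens X} (hU : x ∈ U) (m : M.obj (op U)) (n : N.obj (op U)) :
    stalkTensorInvAux M N x hU m (N.germAt x U hU n) =
      (M ⊗ N).germAt x U hU (tensorMk M N m n) := by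
  rw [stalkTensorInvAux, stalkLift_germAt]
  simp only [AddMonoidHom.coe_mk, ZeroHom.coe_mk]
  rw [← germAt_res (M := M ⊗ N) (homOfLE inf_le_left : U ⊓ U ⟶ U) (Opens.mem_inf.2 ⟨hU, hU⟩),
    res_tensorMk]

/-- The tensor product of two germs, as a germ of the tensor product. -/
def stalkTensorInvLeft : M.Stalk x →+ N.Stalk x →+ (M ⊗ N).Stalk x :=
    (stalkLift M x (fun U hU ↦
      { toFun := fun m ↦ stalkTensorInvAux M N x hU m
        map_zero' := by
          ext s
          obtain ⟨V, hV, n, rfl⟩ := exists_germAt_eq s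
          rw [stalkTensorInvAux, stalkLift_germAt]
          simp only [AddMonoidHom.coe_mk, ZeroHom.coe_mk]
          rw [map_zero, tensorMk_zero_left, map_zero]; rfl
        map_add' := fun a b ↦ by
          ext s
          obtain ⟨V, hV, n, rfl⟩ := exists_germAt_eq s
          rw [AddMonoidHom.add_apply, stalkTensorInvAux, stalkTensorInvAux, stalkTensorInvAux,
            stalkLift_germAt, stalkLift_germAt, stalkLift_germAt]
          simp only [AddMonoidHom.coe_mk, ZeroHom.coe_mk]
          rw [map_add, tensorMk_add_left, map_add] })
      (fun U V i hx m ↦ by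
        ext s
        obtain ⟨W, hW, n, rfl⟩ := exists_germAt_eq s
        have h : x ∈ V ⊓ W := Opens.mem_inf.2 ⟨hx, hW⟩
        simp only [AddMonoidHom.coe_mk, ZeroHom.coe_mk]
        rw [stalkTensorInvAux, stalkTensorInvAux, stalkLift_germAt, stalkLift_germAt]
        simp only [AddMonoidHom.coe_mk, ZeroHom.coe_mk]
        rw [← germAt_res (M := M ⊗ N) (homOfLE (inf_le_inf_right W i.le) : V ⊓ W ⟶ U ⊓ W) h,
          res_tensorMk]
        rw [res_res, res_res, res_res]
        rfl))

lemma stalkTensorInvLeft_germAt {U : Opens X} (hx : x ∈ U) (m : M.obj (op U)) (n : N.obj (op U)) :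
    stalkTensorInvLeft M N x (M.germAt x U hx m) (N.germAt x U hx n) =
      (M ⊗ N).germAt x U hx (tensorMk M N m n) := by
  rw [stalkTensorInvLeft, stalkLift_germAt]
  exact stalkTensorInvAux_germAt M N x hx m n

variable {M} in
lemma smul_germAt_eq {U V W : Opens X} (hV : x ∈ V) (hW : x ∈ W) (i : W ⟶ V) (j : W ⟶ U)
    (a : R.obj (op V)) (m : M.obj (op U)) :
    (R.germ V x hV).hom a • M.germAt x U (j.le hW) m =
      M.germAt x W hW ((R.map i.op).hom a • res j m) := by
  rw [germAt_smul, germAt_res]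
  congr 1
  exact (TopCat.Presheaf.germ_res_apply R i x hW a).symm

lemma stalkTensorInvLeft_smul (r : R.stalk x) (s : M.Stalk x) (t : N.Stalk x) :
    stalkTensorInvLeft M N x (r • s) t = stalkTensorInvLeft M N x s (r • t) := by
  obtain ⟨U, hU, m, rfl⟩ := exists_germAt_eq s
  obtain ⟨V, hVU, hV, a, rfl⟩ := TopCat.Presheaf.exists_le_germ_eq R r hU
  obtain ⟨W, hW, n, rfl⟩ := exists_germAt_eq t
  have h : x ∈ V ⊓ W := Opens.mem_inf.2 ⟨hV, hW⟩
  have i : V ⊓ W ⟶ V := homOfLE inf_le_left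
  have hm := smul_germAt_eq x hV h i (i ≫ homOfLE hVU) a m
  have hn := smul_germAt_eq x hV h i (homOfLE inf_le_right : V ⊓ W ⟶ W) a n
  refine ((congrArg (fun y ↦ stalkTensorInvLeft M N x y (N.germAt x W hW n)) hm).trans ?_).trans
    (congrArg (stalkTensorInvLeft M N x (M.germAt x U hU m)) hn.symm)
  rw [← germAt_res (homOfLE inf_le_right : V ⊓ W ⟶ W) h, stalkTensorInvLeft_germAt,
    ← germAt_res (i ≫ homOfLE hVU) h, stalkTensorInvLeft_germAt, tensorMk_smul_left]

/-- The inverse of the comparison map `stalkTensorHom`. -/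
def stalkTensorInv : M.Stalk x ⊗[R.stalk x] N.Stalk x →+ (M ⊗ N).Stalk x :=
  TensorProduct.liftAddHom (stalkTensorInvLeft M N x) (stalkTensorInvLeft_smul M N x)

lemma stalkTensorInv_tmul {U : Opens X} (hx : x ∈ U) (m : M.obj (op U)) (n : N.obj (op U)) :
    stalkTensorInv M N x (M.germAt x U hx m ⊗ₜ N.germAt x U hx n) =
      (M ⊗ N).germAt x U hx (tensorMk M N m n) :=
  stalkTensorInvLeft_germAt M N x hx m n

/-- The stalk of a tensor product is the tensor product of the stalks. -/
lemma stalkTensor_bijective : Function.Bijective (stalkTensorHom M N x) := by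
  refine Function.bijective_iff_has_inverse.2 ⟨stalkTensorInv M N x, fun s ↦ ?_, fun t ↦ ?_⟩
  · obtain ⟨U, hU, t, rfl⟩ := exists_germAt_eq s
    induction t using tensorObj_induction with
    | h0 => rw [map_zero, map_zero, map_zero]
    | hadd a b ha hb => rw [map_add, map_add, map_add, ha, hb]
    | hmk m n => rw [stalkTensorHom_tensorMk, stalkTensorInv_tmul]
  · induction t using TensorProduct.induction_on with
    | zero => rw [map_zero, map_zero]
    | add a b ha hb => rw [map_add, map_add, ha, hb]
    | tmul s t =>
      obtain ⟨U, hU, m, rfl⟩ := exists_germAt_eq s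
      obtain ⟨V, hV, n, rfl⟩ := exists_germAt_eq t
      have h : x ∈ U ⊓ V := Opens.mem_inf.2 ⟨hU, hV⟩
      rw [← germAt_res (homOfLE inf_le_left) h, ← germAt_res (homOfLE inf_le_right) h,
        stalkTensorInv_tmul, stalkTensorHom_tensorMk]

variable {N} in
lemma stalkTensorHom_naturality (f : N ⟶ P) (s : (M ⊗ N).Stalk x) :
    stalkTensorHom M P x (stalkMap x (M ◁ f) s) =
      (stalkMap x f).lTensor (M.Stalk x) (stalkTensorHom M N x s) := by
  obtain ⟨U, hU, t, rfl⟩ := exists_germAt_eq s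
  induction t using tensorObj_induction with
  | h0 => simp only [map_zero]
  | hadd a b ha hb => simp only [map_add, ha, hb]
  | hmk m n =>
    rw [stalkTensorHom_tensorMk, LinearMap.lTensor_tmul, stalkMap_germAt, stalkMap_germAt]
    exact stalkTensorHom_tensorMk M P x hU m _

variable {N} in
/-- Exactness of a sequence `M ⊗ N ⟶ M ⊗ P ⟶ M ⊗ Q` at the stalk `x`, in terms of the stalks of
the factors. -/
lemma stalkMap_whiskerLeft_exact_iff
    {Q : PresheafOfModules.{u} (R ⋙ forget₂ CommRingCat RingCat)} (f : N ⟶ P) (g : P ⟶ Q) :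
    Function.Exact (stalkMap x (M ◁ f)) (stalkMap x (M ◁ g)) ↔
      Function.Exact ((stalkMap x f).lTensor (M.Stalk x)) ((stalkMap x g).lTensor (M.Stalk x)) := by
  let eN : (M ⊗ N).Stalk x ≃+ _ := AddEquiv.ofBijective _ (stalkTensor_bijective M N x)
  let eP : (M ⊗ P).Stalk x ≃+ _ := AddEquiv.ofBijective _ (stalkTensor_bijective M P x)
  let eQ : (M ⊗ Q).Stalk x ≃+ _ := AddEquiv.ofBijective _ (stalkTensor_bijective M Q x)
  have hf (s) : eP (stalkMap x (M ◁ f) s) = (stalkMap x f).lTensor (M.Stalk x) (eN s) :=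
    stalkTensorHom_naturality M x f s
  have hg (s) : eQ (stalkMap x (M ◁ g) s) = (stalkMap x g).lTensor (M.Stalk x) (eP s) :=
    stalkTensorHom_naturality M x g s
  constructor
  · intro h t
    obtain ⟨s, rfl⟩ := eP.surjective t
    rw [← hg, map_eq_zero_iff eQ eQ.injective, h s]
    constructor
    · rintro ⟨n, rfl⟩
      exact ⟨eN n, (hf n).symm⟩
    · rintro ⟨n, hn⟩
      obtain ⟨n, rfl⟩ := eN.surjective n
      exact ⟨n, eP.injective (by rw [hf, hn])⟩
  · intro h s
    rw [← map_eq_zero_iff eQ eQ.injective, hg, h (eP s)]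
    constructor
    · rintro ⟨n, hn⟩
      obtain ⟨n, rfl⟩ := eN.surjective n
      exact ⟨n, eP.injective (by rw [hf, hn])⟩
    · rintro ⟨n, rfl⟩
      exact ⟨eN n, (hf n).symm⟩

end PresheafOfModules

/-! ### The stalks of Tor of presheaves of modules -/

namespace PresheafOfModules

open TopologicalSpace Opposite MonoidalCategory

section Flat

variable {C : Type u} [SmallCategory.{u} C] {R : Cᵒᵖ ⥤ RingCat.{u}}

/-- The sections of a projective presheaf of modules form projective modules: it is a retract of
a coproduct of the free presheaves on representable ones. -/
lemma projective_obj (M : PresheafOfModules.{u} R) [Projective M] (U : Cᵒᵖ) :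
    Projective (M.obj U) := by
  have h : Retract M M.freeYonedaCoproduct :=
    { i := Projective.factorThru (𝟙 M) M.fromFreeYonedaCoproduct
      r := M.fromFreeYonedaCoproduct
      retract := Projective.factorThru_comp _ _ }
  have hc : Projective (M.freeYonedaCoproduct.obj U) := by
    have (m : M.Elements) : Projective ((evaluation R U).obj m.freeYoneda) :=
      ModuleCat.projective_of_free (R := R.obj U)
        (M := (ModuleCat.free (R.obj U)).obj ((yoneda.obj m.1.unop).obj U))
        (Finsupp.basisSingleOne (R := R.obj U))
    exact Projective.of_iso (Limits.PreservesCoproduct.iso (evaluation R U) _).symm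
      (inferInstance : Projective (∐ fun m : M.Elements ↦ (evaluation R U).obj m.freeYoneda))
  have : Projective ((evaluation R U).obj M.freeYonedaCoproduct) := hc
  exact (h.map (evaluation R U)).projective

end Flat

variable {X : TopCat.{u}} {R : X.Presheaf CommRingCat.{u}}
  {M N P : PresheafOfModules.{u} (R ⋙ forget₂ CommRingCat RingCat)} (x : X)

/-- Finitely many germs are represented by sections over a common neighbourhood. -/
lemma exists_germAt_eq_of_fintype {ι : Type*} [Finite ι] (s : ι → M.Stalk x) :
    ∃ (U : Opens X) (hx : x ∈ U) (m : ι → M.obj (op U)), ∀ i, M.germAt x U hx (m i) = s i := by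
  choose U hU m hm using fun i ↦ exists_germAt_eq (s i)
  let V : Opens X := ⟨⋂ i, U i, isOpen_iInter_of_finite fun i ↦ (U i).isOpen⟩
  have hV : x ∈ V := Set.mem_iInter.2 hU
  have j (i) : V ⟶ U i := homOfLE (Set.iInter_subset _ i)
  exact ⟨V, hV, fun i ↦ res (j i) (m i), fun i ↦ by rw [germAt_res, hm]⟩

lemma exists_germ_eq_of_fintype {ι : Type*} [Finite ι] (s : ι → R.stalk x) :
    ∃ (U : Opens X) (hx : x ∈ U) (m : ι → R.obj (op U)), ∀ i, (R.germ U x hx).hom (m i) = s i := by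
  choose U hU m hm using fun i ↦ R.exists_germ_eq (s i)
  let V : Opens X := ⟨⋂ i, U i, isOpen_iInter_of_finite fun i ↦ (U i).isOpen⟩
  have hV : x ∈ V := Set.mem_iInter.2 hU
  have j (i) : V ⟶ U i := homOfLE (Set.iInter_subset _ i)
  exact ⟨V, hV, fun i ↦ R.map (j i).op (m i), fun i ↦
    (TopCat.Presheaf.germ_res_apply R (j i) x hV (m i)).trans (hm i)⟩

/-- Flatness passes from the sections to the stalks, by the equational criterion. -/
lemma flat_stalk (h : ∀ U : Opens X, Module.Flat (R.obj (op U)) (M.obj (op U))) :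
    Module.Flat (R.stalk x) (M.Stalk x) := by
  refine Module.Flat.of_forall_isTrivialRelation fun {l f s} hfs ↦ ?_
  -- A relation in the stalk comes from a relation between sections near `x`, which is trivial
  -- there.
  obtain ⟨U, hU, m, hm⟩ := exists_germAt_eq_of_fintype x s
  obtain ⟨V, hV, a, ha⟩ := exists_germ_eq_of_fintype x f
  have hW : x ∈ U ⊓ V := Opens.mem_inf.2 ⟨hU, hV⟩
  let b (i) : R.obj (op (U ⊓ V)) := R.map (homOfLE inf_le_right : U ⊓ V ⟶ V).op (a i)
  let n (i) : M.obj (op (U ⊓ V)) := res (homOfLE inf_le_left) (m i)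
  have hb (i) : (R.germ _ x hW).hom (b i) = f i :=
    (TopCat.Presheaf.germ_res_apply R _ x hW (a i)).trans (ha i)
  have hn (i) : M.germAt x _ hW (n i) = s i := by rw [germAt_res, hm]
  have h0 : M.germAt x _ hW (∑ i, b i • n i) = 0 := by
    rw [map_sum, ← hfs]
    exact Finset.sum_congr rfl fun i _ ↦ by rw [germAt_smul, hb, hn]
  obtain ⟨W, hxW, j, e⟩ := exists_map_eq_zero_of_germAt_eq_zero hW _ h0
  have e' : ∑ i, (R.map j.op).hom (b i) • res j (n i) = (0 : M.obj (op W)) := by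
    rw [← e, map_sum]
    exact Finset.sum_congr rfl fun i _ ↦ (res_smul j _ _).symm
  have := h W
  obtain ⟨k, c, y, h1, h2⟩ := Module.Flat.isTrivialRelation_of_sum_smul_eq_zero e'
  refine ⟨k, fun i j ↦ (R.germ W x hxW).hom (c i j), fun j ↦ M.germAt x W hxW (y j), fun i ↦ ?_,
    fun i ↦ ?_⟩
  · rw [← hn, ← germAt_res j hxW]
    refine (congrArg (M.germAt x W hxW) (h1 i)).trans ?_
    rw [map_sum]
    exact Finset.sum_congr rfl fun i _ ↦ germAt_smul _ _ _
  · rw [← map_zero (R.germ W x hxW).hom, ← h2 i, map_sum]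
    refine Finset.sum_congr rfl fun l _ ↦ ?_
    rw [map_mul, ← hb]
    congr 1
    exact (TopCat.Presheaf.germ_res_apply R j x hxW (b l)).symm

lemma flat_stalk_of_projective [Projective M] : Module.Flat (R.stalk x) (M.Stalk x) :=
  flat_stalk x fun U ↦ by
    have : Module.Projective (R.obj (op U)) (M.obj (op U)) :=
      (IsProjective.iff_projective (R := R.obj (op U)) (P := M.obj (op U))).2
        (projective_obj M (op U))
    infer_instance

/-- The stalk functor on presheaves of modules, with values in abelian groups. -/
abbrev stalkFunctorAb : PresheafOfModules.{u} (R ⋙ forget₂ CommRingCat RingCat) ⥤ Ab.{u} :=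
  toPresheaf _ ⋙ TopCat.Presheaf.stalkFunctor Ab.{u} x

instance : (stalkFunctorAb (R := R) x).Additive where
  map_add {M N f g} := by
    ext s
    obtain ⟨U, hU, m, rfl⟩ := exists_germAt_eq (M := M) s
    change stalkMap x (f + g) _ = stalkMap x f _ + stalkMap x g _
    rw [stalkMap_germAt, stalkMap_germAt, stalkMap_germAt]
    exact map_add _ _ _

lemma exact_app_of_exact
    {S : ShortComplex (PresheafOfModules.{u} (R ⋙ forget₂ CommRingCat RingCat))} (hS : S.Exact)
    (U : Opens X) :
    Function.Exact (S.f.app (op U)).hom (S.g.app (op U)).hom :=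
  (ShortComplex.ShortExact.moduleCat_exact_iff_function_exact _).1 (hS.map (evaluation _ (op U)))

lemma exact_map_stalkFunctorAb_iff
    (S : ShortComplex (PresheafOfModules.{u} (R ⋙ forget₂ CommRingCat RingCat))) :
    (S.map (stalkFunctorAb x)).Exact ↔ Function.Exact (stalkMap x S.f) (stalkMap x S.g) := by
  rw [ShortComplex.ab_exact_iff_function_exact]
  rfl

instance : (stalkFunctorAb (R := R) x).PreservesHomology :=
  ((stalkFunctorAb (R := R) x).exact_tfae.out 1 2).1 fun S hS ↦
    (exact_map_stalkFunctorAb_iff x S).2 (stalkMap_exact x (exact_app_of_exact hS))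

lemma subsingleton_stalk_homology_iff
    (S : ShortComplex (PresheafOfModules.{u} (R ⋙ forget₂ CommRingCat RingCat))) :
    Subsingleton (S.homology.Stalk x) ↔ Function.Exact (stalkMap x S.f) (stalkMap x S.g) := by
  rw [← exact_map_stalkFunctorAb_iff, ShortComplex.exact_iff_isZero_homology,
    (S.mapHomologyIso (stalkFunctorAb x)).isZero_iff]
  exact ⟨fun (h : Subsingleton ((stalkFunctorAb x).obj S.homology)) ↦
    AddCommGrpCat.isZero_of_subsingleton _,
    fun h ↦ AddCommGrpCat.subsingleton_of_isZero h⟩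

/-- The stalks of `Tor` are computed by tensoring the stalks of a projective resolution. -/
lemma subsingleton_stalk_tor_iff (F G : PresheafOfModules.{u} (R ⋙ forget₂ CommRingCat RingCat))
    (Q : ProjectiveResolution G) (n : ℕ) :
    Subsingleton ((((Tor _ (n + 1)).obj F).obj G).Stalk x) ↔
      Function.Exact ((stalkMap x (Q.complex.d (n + 2) (n + 1))).lTensor (F.Stalk x))
        ((stalkMap x (Q.complex.d (n + 1) n)).lTensor (F.Stalk x)) := by
  rw [← stalkMap_whiskerLeft_exact_iff]
  let K := (((tensoringLeft _).obj F).mapHomologicalComplex (ComplexShape.down ℕ)).obj Q.complex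
  have e : ((Tor _ (n + 1)).obj F).obj G ≅ (K.sc' (n + 2) (n + 1) n).homology :=
    Q.isoLeftDerivedObj ((tensoringLeft _).obj F) (n + 1) ≪≫
      ShortComplex.homologyMapIso (K.isoSc' (n + 2) (n + 1) n (by simp) (by simp))
  refine Iff.trans ?_ (subsingleton_stalk_homology_iff x (K.sc' (n + 2) (n + 1) n))
  exact ((stalkFunctorAb x).mapIso e).addCommGroupIsoToAddEquiv.toEquiv.subsingleton_congr

variable {x} in
lemma stalkMap_projectiveResolution_exact
    {G : PresheafOfModules.{u} (R ⋙ forget₂ CommRingCat RingCat)} (Q : ProjectiveResolution G)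
    (n : ℕ) : Function.Exact (stalkMap x (Q.complex.d (n + 2) (n + 1)))
      (stalkMap x (Q.complex.d (n + 1) n)) :=
  stalkMap_exact x (exact_app_of_exact (Q.exact_succ n))

variable {x} in
/-- The stalks of a projective resolution form a flat resolution of the stalk. -/
lemma exists_stalkMap_projectiveResolution_augmentation
    {G : PresheafOfModules.{u} (R ⋙ forget₂ CommRingCat RingCat)} (Q : ProjectiveResolution G) :
    ∃ ε : (Q.complex.X 0).Stalk x →ₗ[R.stalk x] G.Stalk x, Function.Surjective ε ∧
      Function.Exact (stalkMap x (Q.complex.d 1 0)) ε := by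
  let p : Q.complex.X 0 ⟶ G := Q.π.f 0
  have hp : Epi p := inferInstanceAs (Epi (Q.π.f 0))
  exact ⟨stalkMap x p, stalkMap_surjective x fun U ↦ surjective_of_epi p (op U),
    stalkMap_exact x (exact_app_of_exact Q.exact₀)⟩

end PresheafOfModules

/-! ### Vanishing of Tor over a commutative ring -/

section TorVanishes

open TensorProduct

/-- The complex `M ⊗ P` is exact in degree `n + 1`. If `P` is a flat resolution of `G`, this says
that `Tor_{n + 1}(M, G) = 0`. -/
def TorVanishes {A : Type*} [CommRing A] (M : Type*) [AddCommGroup M] [Module A M] {P : ℕ → Type*}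
    [∀ n, AddCommGroup (P n)] [∀ n, Module A (P n)] (d : ∀ n, P (n + 1) →ₗ[A] P n) (n : ℕ) : Prop :=
  Function.Exact ((d (n + 1)).lTensor M) ((d n).lTensor M)

variable {A : Type*} [CommRing A] {P : ℕ → Type*} [∀ n, AddCommGroup (P n)] [∀ n, Module A (P n)]
  {d : ∀ n, P (n + 1) →ₗ[A] P n}
  {K L M : Type*} [AddCommGroup K] [AddCommGroup L] [AddCommGroup M]
  [Module A K] [Module A L] [Module A M]

lemma TorVanishes.of_flat [Module.Flat A M] (hd : ∀ n, Function.Exact (d (n + 1)) (d n)) (n : ℕ) :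
    TorVanishes M d n :=
  Module.Flat.lTensor_exact M (hd n)

variable {f : K →ₗ[A] L} {g : L →ₗ[A] M}

lemma lTensor_rTensor_apply {Q Q' : Type*} [AddCommGroup Q] [AddCommGroup Q'] [Module A Q]
    [Module A Q'] (h : Q →ₗ[A] Q') (f : K →ₗ[A] L) (z : K ⊗[A] Q) :
    h.lTensor L (f.rTensor Q z) = f.rTensor Q' (h.lTensor K z) := by
  rw [← LinearMap.comp_apply, ← LinearMap.comp_apply, LinearMap.lTensor_comp_rTensor,
    LinearMap.rTensor_comp_lTensor]

lemma lTensor_lTensor_eq_zero {Q Q' Q'' : Type*} [AddCommGroup Q] [AddCommGroup Q']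
    [AddCommGroup Q''] [Module A Q] [Module A Q'] [Module A Q''] {h : Q →ₗ[A] Q'}
    {h' : Q' →ₗ[A] Q''} (e : Function.Exact h h') (z : K ⊗[A] Q) :
    h'.lTensor K (h.lTensor K z) = 0 := by
  rw [← LinearMap.comp_apply, ← LinearMap.lTensor_comp, e.linearMap_comp_eq_zero]
  simp

/-- Dimension shifting: `Tor_{n + 2}(M, G) = 0` if and only if `Tor_{n + 1}(K, G) = 0` for a
short exact sequence `0 → K → L → M → 0` with `L` flat. -/
lemma torVanishes_succ_iff [∀ n, Module.Flat A (P n)] [Module.Flat A L]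
    (hd : ∀ n, Function.Exact (d (n + 1)) (d n)) (hf : Function.Injective f)
    (hfg : Function.Exact f g) (hg : Function.Surjective g) (n : ℕ) :
    TorVanishes M d (n + 1) ↔ TorVanishes K d n := by
  have i (n) : Function.Injective (f.rTensor (P n)) :=
    Module.Flat.rTensor_preserves_injective_linearMap f hf
  have s (n) : Function.Surjective (g.rTensor (P n)) := LinearMap.rTensor_surjective _ hg
  have e (n) := rTensor_exact (P n) hfg hg
  have z (n) (a) : g.rTensor (P n) (f.rTensor (P n) a) = 0 := (e n).apply_apply_eq_zero a
  have l (n) := TorVanishes.of_flat (M := L) hd n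
  refine ⟨fun h κ ↦ ⟨fun hκ ↦ ?_, ?_⟩, fun h μ ↦ ⟨fun hμ ↦ ?_, ?_⟩⟩
  · obtain ⟨y, hy⟩ := (l n (f.rTensor _ κ)).1 (by rw [lTensor_rTensor_apply, hκ, map_zero])
    obtain ⟨μ, hμ⟩ := (h (g.rTensor _ y)).1 (by rw [lTensor_rTensor_apply, hy, z])
    obtain ⟨y', rfl⟩ := s _ μ
    obtain ⟨κ', hκ'⟩ := (e _ (y - (d _).lTensor L y')).1 (by
      rw [map_sub, ← lTensor_rTensor_apply, hμ, sub_self])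
    refine ⟨κ', i _ ?_⟩
    rw [← lTensor_rTensor_apply, hκ', map_sub, hy, lTensor_lTensor_eq_zero (hd _), sub_zero]
  · rintro ⟨y, rfl⟩
    exact lTensor_lTensor_eq_zero (hd _) _
  · obtain ⟨y, rfl⟩ := s _ μ
    obtain ⟨κ, hκ⟩ := (e _ ((d _).lTensor L y)).1 (by rw [← lTensor_rTensor_apply, hμ])
    obtain ⟨κ', hκ'⟩ := (h κ).1 (i _ (by
      rw [← lTensor_rTensor_apply, hκ, lTensor_lTensor_eq_zero (hd _), map_zero]))
    obtain ⟨y', hy'⟩ := (l _ (y - f.rTensor _ κ')).1 (by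
      rw [map_sub, lTensor_rTensor_apply, hκ', hκ, sub_self])
    refine ⟨g.rTensor _ y', ?_⟩
    rw [lTensor_rTensor_apply, hy', map_sub, z, sub_zero]
  · rintro ⟨y, rfl⟩
    exact lTensor_lTensor_eq_zero (hd _) _

/-- If `Tor_1(M, G) = 0`, then `K ⊗ G → L ⊗ G` is injective for each exact sequence
`0 → K → L → M → 0`. -/
lemma TorVanishes.rTensor_injective [∀ n, Module.Flat A (P n)] {G : Type*} [AddCommGroup G]
    [Module A G] {ε : P 0 →ₗ[A] G} (hd : ∀ n, Function.Exact (d (n + 1)) (d n))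
    (hε : Function.Surjective ε) (hdε : Function.Exact (d 0) ε) (hf : Function.Injective f)
    (hfg : Function.Exact f g) (hg : Function.Surjective g) (h : TorVanishes M d 0) :
    Function.Injective (f.rTensor G) := by
  have i (n) : Function.Injective (f.rTensor (P n)) :=
    Module.Flat.rTensor_preserves_injective_linearMap f hf
  have s (n) : Function.Surjective (g.rTensor (P n)) := LinearMap.rTensor_surjective _ hg
  have e (n) := rTensor_exact (P n) hfg hg
  have z (n) (a) : g.rTensor (P n) (f.rTensor (P n) a) = 0 := (e n).apply_apply_eq_zero a
  refine (injective_iff_map_eq_zero _).2 fun x hx ↦ ?_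
  obtain ⟨κ, rfl⟩ := LinearMap.lTensor_surjective K hε x
  obtain ⟨y, hy⟩ := (lTensor_exact L hdε hε (f.rTensor _ κ)).1 (by rwa [lTensor_rTensor_apply])
  obtain ⟨μ, hμ⟩ := (h (g.rTensor _ y)).1 (by rw [lTensor_rTensor_apply, hy, z])
  obtain ⟨y', rfl⟩ := s _ μ
  obtain ⟨κ', hκ'⟩ := (e _ (y - (d _).lTensor L y')).1 (by
    rw [map_sub, ← lTensor_rTensor_apply, hμ, sub_self])
  have : κ = (d 0).lTensor K κ' := i _ (by
    rw [← lTensor_rTensor_apply, hκ', map_sub, hy, lTensor_lTensor_eq_zero (hd _), sub_zero])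
  rw [this, lTensor_lTensor_eq_zero hdε]

end TorVanishes

section Syzygy

variable {A : Type*} [CommRing A] {M : Type*} [AddCommGroup M] [Module A M]
  {P : ℕ → Type*} [∀ n, AddCommGroup (P n)] [∀ n, Module A (P n)]
  {d : ∀ n, P (n + 1) →ₗ[A] P n} [∀ n, Module.Flat A (P n)]

/-- A module which embeds into a free module of finite rank. -/
def EmbedsInFree (A M : Type*) [CommRing A] [AddCommGroup M] [Module A M] : Prop :=
  ∃ (n : ℕ) (j : M →ₗ[A] (Fin n → A)), Function.Injective j

lemma EmbedsInFree.smul_eq_zero (h : EmbedsInFree A M) {t : A} (ht : t ∈ nonZeroDivisors A) (m : M)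
    (e : t • m = 0) : m = 0 := by
  obtain ⟨n, j, hj⟩ := h
  refine hj ?_
  rw [map_zero]
  funext i
  have : t * j m i = 0 := by simpa using congrFun (congrArg j e) i
  exact (mul_left_mem_nonZeroDivisors_eq_zero_iff ht).1 this

/-- A finitely generated module is presented as a quotient of a free module of finite rank. -/
lemma exists_syzygy [IsNoetherianRing A] (M : Type*) [AddCommGroup M] [Module A M]
    [Module.Finite A M] :
    ∃ (n : ℕ) (K : Submodule A (Fin n → A)) (g : (Fin n → A) →ₗ[A] M),
      Function.Surjective g ∧ Function.Exact K.subtype g := by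
  obtain ⟨n, g, hg⟩ := Module.Finite.exists_fin' A M
  exact ⟨n, LinearMap.ker g, g, hg, LinearMap.exact_subtype_ker_map g⟩

lemma embedsInFree_submodule {n : ℕ} (K : Submodule A (Fin n → A)) : EmbedsInFree A K :=
  ⟨n, K.subtype, K.injective_subtype⟩

/-- If the finitely generated submodules of free modules are free, then `Tor_n = 0` for `n ≥ 2`. -/
lemma torVanishes_succ_of_free [IsNoetherianRing A]
    (hA : ∀ (n : ℕ) (K : Submodule A (Fin n → A)), Module.Free A K)
    (hd : ∀ n, Function.Exact (d (n + 1)) (d n)) [Module.Finite A M] (n : ℕ) :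
    TorVanishes M d (n + 1) := by
  obtain ⟨r, K, g, hg, hK⟩ := exists_syzygy (A := A) M
  have := hA r K
  exact (torVanishes_succ_iff hd K.injective_subtype hK hg n).2 (.of_flat hd n)

end Syzygy

/-! ### Local rings of depth one -/

section LocalAlgebra

open IsLocalRing TensorProduct

/-- A local ring of depth one: some `t` in the maximal ideal is a nonzerodivisor, and the socle of
`A / (t)` contains the class of an element `s ∉ (t)`. -/
structure HasDepthOne (A : Type*) [CommRing A] [IsLocalRing A] : Prop where
  exists_regular_socle : ∃ t s : A, t ∈ nonZeroDivisors A ∧ t ∈ maximalIdeal A ∧ ¬ t ∣ s ∧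
    ∀ a ∈ maximalIdeal A, t ∣ a * s

variable {A : Type v} [CommRing A] [IsLocalRing A]
  {K L M : Type*} [AddCommGroup K] [AddCommGroup L] [AddCommGroup M]
  [Module A K] [Module A L] [Module A M] {f : K →ₗ[A] L} {g : L →ₗ[A] M}

lemma residue_tmul_eq_zero_iff (m : M) :
    (1 : ResidueField A) ⊗ₜ[A] m = 0 ↔ m ∈ maximalIdeal A • (⊤ : Submodule A M) := by
  rw [← LinearMap.ker_tensorProductMk (R := A) (Q := M) (I := maximalIdeal A)]
  rfl

/-- Over a local ring of depth one, a module of projective dimension at most one in which regular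
elements act injectively is free: if `f κ ∈ 𝔪 L`, then `s f κ ∈ t L`, so `s κ ∈ t K` since `t` acts
injectively on `M`, and therefore `κ ∈ 𝔪 K` since `s ∉ (t)`. -/
lemma free_of_exact_of_regular_smul_injective [IsNoetherianRing A] (hA : HasDepthOne A)
    [Module.Finite A K] [Module.Free A K] [Module.Finite A L] [Module.Free A L]
    (hf : Function.Injective f) (hfg : Function.Exact f g) (hg : Function.Surjective g)
    (hM : ∀ t ∈ nonZeroDivisors A, ∀ m : M, t • m = 0 → m = 0) : Module.Free A M := by
  obtain ⟨t, s, ht, htm, hts, hs⟩ := hA.exists_regular_socle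
  refine Module.free_of_lTensor_residueField_injective f g hg hfg ?_
  refine (injective_iff_map_eq_zero _).2 fun x hx ↦ ?_
  obtain ⟨κ, rfl⟩ := TensorProduct.mk_surjective A K (ResidueField A) residue_surjective x
  have h1 : f κ ∈ maximalIdeal A • (⊤ : Submodule A L) := (residue_tmul_eq_zero_iff _).1 hx
  have h2 : ∃ y, s • f κ = t • y := by
    refine Submodule.smul_induction_on (p := fun l ↦ ∃ y, s • l = t • y) h1 ?_ ?_
    · intro a ha l _
      obtain ⟨b, hb⟩ := hs a ha
      exact ⟨b • l, by rw [smul_smul, smul_smul, mul_comm, hb]⟩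
    · rintro l l' ⟨y, hy⟩ ⟨y', hy'⟩
      exact ⟨y + y', by rw [smul_add, smul_add, hy, hy']⟩
  obtain ⟨y, hy⟩ := h2
  obtain ⟨z, rfl⟩ := (hfg y).1 <| hM t ht _ (by
    rw [← map_smul, ← hy, ← map_smul, hfg.apply_apply_eq_zero])
  have h3 : s • κ = t • z := hf (by rw [map_smul, map_smul, hy])
  let b := Module.Free.chooseBasis A K
  change (1 : ResidueField A) ⊗ₜ[A] κ = 0
  rw [residue_tmul_eq_zero_iff, ← b.sum_repr κ]
  refine Submodule.sum_mem _ fun i _ ↦ Submodule.smul_mem_smul ?_ trivial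
  by_contra h
  have hu : IsUnit (b.repr κ i) := by simpa using h
  have h4 : s * b.repr κ i = t * b.repr z i := by
    simpa using congrArg (fun w ↦ b.repr w i) h3
  exact hts ((hu.dvd_mul_right).1 (Dvd.intro _ h4.symm))

variable {P : ℕ → Type*} [∀ n, AddCommGroup (P n)] [∀ n, Module A (P n)]
  {d : ∀ n, P (n + 1) →ₗ[A] P n} [∀ n, Module.Flat A (P n)]
  {G : Type*} [AddCommGroup G] [Module A G] {ε : P 0 →ₗ[A] G}

/-- Over a local ring of depth one, a submodule of a free module is free if one of its `Tor`
groups with the residue field vanishes in positive degree: by dimension shifting, its syzygies are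
free from some degree on, and descending induction applies
`free_of_exact_of_regular_smul_injective`. -/
lemma TorVanishes.free [IsNoetherianRing A] (hA : HasDepthOne A)
    (hd : ∀ n, Function.Exact (d (n + 1)) (d n))
    (hε : Function.Surjective ε) (hdε : Function.Exact (d 0) ε) (e : G ≃ₗ[A] ResidueField A)
    (n : ℕ) {M : Type v} [AddCommGroup M] [Module A M] [Module.Finite A M] (hM : EmbedsInFree A M)
    (h : TorVanishes M d n) : Module.Free A M := by
  induction n generalizing M with
  | zero =>
    obtain ⟨r, K, g, hg, hK⟩ := exists_syzygy (A := A) M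
    have hi := h.rTensor_injective hd hε hdε K.injective_subtype hK hg
    refine Module.free_of_lTensor_residueField_injective K.subtype g hg hK ?_
    rw [LinearMap.lTensor_inj_iff_rTensor_inj]
    refine (injective_iff_map_eq_zero _).2 fun x hx ↦ ?_
    have h0 := hi (a₁ := e.symm.toLinearMap.lTensor K x) (a₂ := 0) (by
      rw [← lTensor_rTensor_apply, hx, map_zero, map_zero])
    exact (e.symm.lTensor K).injective (h0.trans (map_zero _).symm)
  | succ n ih =>
    obtain ⟨r, K, g, hg, hK⟩ := exists_syzygy (A := A) M
    have := ih (embedsInFree_submodule K)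
      ((torVanishes_succ_iff hd K.injective_subtype hK hg n).1 h)
    exact free_of_exact_of_regular_smul_injective hA K.injective_subtype hK hg
      fun t ht m ↦ hM.smul_eq_zero ht m

/-- Over a local ring of depth one, the vanishing of `Tor_n` with the residue field for a single
`n ≥ 2` implies its vanishing for all `n ≥ 2`. -/
lemma TorVanishes.succ_of_succ [IsNoetherianRing A] (hA : HasDepthOne A)
    (hd : ∀ n, Function.Exact (d (n + 1)) (d n))
    (hε : Function.Surjective ε) (hdε : Function.Exact (d 0) ε) (e : G ≃ₗ[A] ResidueField A)
    {n : ℕ} [Module.Finite A M] (h : TorVanishes M d (n + 1)) (m : ℕ) :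
    TorVanishes M d (m + 1) := by
  obtain ⟨r, K, g, hg, hK⟩ := exists_syzygy (A := A) M
  have := TorVanishes.free hA hd hε hdε e n (embedsInFree_submodule K)
    ((torVanishes_succ_iff hd K.injective_subtype hK hg n).1 h)
  exact (torVanishes_succ_iff hd K.injective_subtype hK hg m).2 (.of_flat hd m)

end LocalAlgebra

/-! ### One-dimensional local rings -/

section OneDimensional

open IsLocalRing AlgebraicGeometry.Scheme

variable {A : Type*} [CommRing A]

lemma mem_nonZeroDivisors_of_forall_notMem_minimalPrimes [IsReduced A] {t : A}
    (h : ∀ p ∈ minimalPrimes A, t ∉ p) : t ∈ nonZeroDivisors A := by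
  refine mem_nonZeroDivisors_iff_right.2 fun x hx ↦ ?_
  have h1 : x ∈ sInf (minimalPrimes A) := Submodule.mem_sInf.2 fun p hp ↦
    (hp.1.1.mem_or_mem (hx ▸ p.zero_mem : x * t ∈ p)).resolve_right (h p hp)
  rw [minimalPrimes, Ideal.sInf_minimalPrimes, Ideal.radical_bot_of_isReduced] at h1
  exact h1

lemma not_isField_of_ringKrullDim (hA : ringKrullDim A = 1) : ¬ IsField A := fun h ↦ by
  rw [ringKrullDim_eq_zero_of_isField h] at hA
  exact absurd hA (by decide)

variable [IsLocalRing A]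

lemma mem_minimalPrimes_or_eq_maximalIdeal (hA : ringKrullDim A = 1) {p : Ideal A}
    (hp : p.IsPrime) :
    p ∈ minimalPrimes A ∨ p = maximalIdeal A := by
  have : Ring.KrullDimLE 1 A := Ring.krullDimLE_iff.2 hA.le
  exact (Ring.krullDimLE_one_iff.1 this p hp).imp_right IsLocalRing.eq_maximalIdeal

lemma maximalIdeal_notMem_minimalPrimes (hA : ringKrullDim A = 1) :
    maximalIdeal A ∉ minimalPrimes A := fun h ↦ by
  have : Ring.KrullDimLE 0 A := Ring.KrullDimLE.mk₀ fun I hI ↦ by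
    rw [(le_maximalIdeal hI.ne_top).antisymm (h.2 ⟨hI, bot_le⟩ (le_maximalIdeal hI.ne_top))]
    infer_instance
  have h0 := Ring.krullDimLE_iff.1 this
  rw [hA] at h0
  exact absurd h0 (by decide)

variable [IsNoetherianRing A]

/-- In a one-dimensional Noetherian local ring, each nonzerodivisor divides a power of the maximal
ideal. -/
lemma exists_maximalIdeal_pow_le_span (hA : ringKrullDim A = 1) {t : A}
    (ht : t ∈ nonZeroDivisors A) : ∃ n, maximalIdeal A ^ n ≤ Ideal.span {t} := by
  refine Ideal.exists_pow_le_of_le_radical_of_fg ?_ (Ideal.fg_of_isNoetherianRing _)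
  rw [Ideal.radical_eq_sInf]
  refine le_sInf fun p ⟨hp, hp'⟩ ↦ ?_
  rcases mem_minimalPrimes_or_eq_maximalIdeal hA hp' with h | h
  · exact absurd ht (Set.disjoint_left.1 (Ideal.disjoint_nonZeroDivisors_of_mem_minimalPrimes h)
      (hp (Ideal.mem_span_singleton_self t)))
  · exact h.ge

/-- If the maximal ideal is generated by `t`, then `p = t p` for each minimal prime `p`, so that
`p = 0` by Nakayama's lemma. -/
lemma isDomain_of_maximalIdeal_eq_span (hA : ringKrullDim A = 1) {t : A}
    (ht : maximalIdeal A = Ideal.span {t}) : IsDomain A := by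
  obtain ⟨p, hp⟩ := Ideal.nonempty_minimalPrimes (I := (⊥ : Ideal A)) bot_ne_top
  have htp : t ∉ p := fun h ↦ maximalIdeal_notMem_minimalPrimes hA (by
    rwa [(le_maximalIdeal hp.1.1.ne_top).antisymm
      (ht.le.trans ((Ideal.span_singleton_le_iff_mem _).2 h))] at hp)
  have hb : p = ⊥ := by
    refine Submodule.eq_bot_of_le_smul_of_le_jacobson_bot (maximalIdeal A) p
      (Ideal.fg_of_isNoetherianRing _) (fun x hx ↦ ?_) (maximalIdeal_le_jacobson _)
    obtain ⟨y, rfl⟩ := Ideal.mem_span_singleton.1 (ht ▸ le_maximalIdeal hp.1.1.ne_top hx)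
    exact Ideal.mul_mem_mul (ht ▸ Ideal.mem_span_singleton_self t)
      ((hp.1.1.mem_or_mem hx).resolve_left htp)
  have := hp.1.1
  rw [hb] at this
  exact IsDomain.of_bot_isPrime A

/-- One-dimensional regular local rings are discrete valuation rings. -/
lemma exists_isDiscreteValuationRing (hA : ringKrullDim A = 1) (h : IsRegularLocalRing A) :
    ∃ _ : IsDomain A, IsDiscreteValuationRing A := by
  have h1 := h.spanFinrank_maximalIdeal
  rw [hA, Nat.cast_eq_one] at h1
  have hfg : (maximalIdeal A).FG := Ideal.fg_of_isNoetherianRing _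
  obtain ⟨t, ht⟩ := Set.ncard_eq_one.1 ((Submodule.FG.generators_ncard hfg).trans h1)
  have ht' : maximalIdeal A = Ideal.span {t} := by
    rw [← ht, Ideal.span, Submodule.span_generators]
  have hd := isDomain_of_maximalIdeal_eq_span hA ht'
  have hp : (maximalIdeal A).IsPrincipal := ⟨t, ht'⟩
  exact ⟨hd, ((IsDiscreteValuationRing.TFAE A (not_isField_of_ringKrullDim hA)).out 0 4).2 hp⟩

variable [IsReduced A]

/-- By prime avoidance, the maximal ideal is not contained in the union of the minimal primes. -/
lemma exists_mem_nonZeroDivisors_mem_maximalIdeal (hA : ringKrullDim A = 1) :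
    ∃ t ∈ nonZeroDivisors A, t ∈ maximalIdeal A := by
  by_contra! h
  have h1 : (maximalIdeal A : Set A) ⊆ ⋃ p ∈ minimalPrimes A, (p : Set A) := fun t ht ↦ by
    by_contra h'
    refine h t (mem_nonZeroDivisors_of_forall_notMem_minimalPrimes fun p hp hpt ↦ h' ?_) ht
    exact Set.mem_biUnion hp hpt
  obtain ⟨p, hp, hp'⟩ := (Ideal.subset_union_prime_finite
    (Ideal.finite_minimalPrimes_of_isNoetherianRing A ⊥) ⊥ ⊥ fun p hp _ _ ↦ hp.1.1).1 h1
  refine maximalIdeal_notMem_minimalPrimes hA ?_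
  rwa [← (le_maximalIdeal hp.1.1.ne_top).antisymm hp']

/-- If `n` is the least exponent with `𝔪 ^ n ≤ (t)`, then each element of `𝔪 ^ (n - 1)` outside
`(t)` represents a nonzero element of the socle of `A / (t)`. -/
lemma hasDepthOne_of_isReduced (hA : ringKrullDim A = 1) : HasDepthOne A := by
  obtain ⟨t, ht, htm⟩ := exists_mem_nonZeroDivisors_mem_maximalIdeal hA
  have h := exists_maximalIdeal_pow_le_span hA ht
  classical
  have h0 : Nat.find h ≠ 0 := fun h0 ↦ by
    have h1 := Nat.find_spec h
    rw [h0, pow_zero, Ideal.one_eq_top, top_le_iff, Ideal.span_singleton_eq_top] at h1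
    exact htm h1
  obtain ⟨n, hn⟩ := Nat.exists_eq_succ_of_ne_zero h0
  obtain ⟨s, hs, hs'⟩ := SetLike.not_le_iff_exists.1 (Nat.find_min h (m := n) (by lia))
  refine ⟨t, s, ht, htm, fun h ↦ hs' (Ideal.mem_span_singleton.2 h), fun a ha ↦ ?_⟩
  rw [← Ideal.mem_span_singleton]
  refine Nat.find_spec h ?_
  rw [hn, Nat.succ_eq_add_one, pow_succ']
  exact Ideal.mul_mem_mul ha hs

end OneDimensional

/-! ### The conductor of a commutative ring -/

section Conductor

open AlgebraicGeometry.Scheme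

variable {A : Type*} [CommRing A]

lemma mem_conductorOfIntegralClosure {a : A} :
    a ∈ conductorOfIntegralClosure A ↔ ∀ w : FractionRing A, IsIntegral A w →
      ∃ c, algebraMap A _ c = a • w := by
  simp [conductorOfIntegralClosure, Submodule.mem_colon, Submodule.mem_one, mem_integralClosure_iff]

lemma conductorOfIntegralClosure_eq_top [IsDomain A] [IsIntegrallyClosed A] :
    conductorOfIntegralClosure A = ⊤ := by
  rw [Ideal.eq_top_iff_one, mem_conductorOfIntegralClosure]
  intro w hw
  rw [one_smul]
  exact IsIntegrallyClosed.isIntegral_iff.1 hw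

end Conductor

/-! ### The complete local ring of a node -/

section Node

open IsLocalRing PowerSeries

/-- Restriction of a power series in two variables to a coordinate axis. -/
def axisRestriction (k : Type*) [Field k] (i : Fin 2) : MvPowerSeries (Fin 2) k →+* k⟦X⟧ where
  toFun f := PowerSeries.mk fun n ↦ MvPowerSeries.coeff (Finsupp.single i n) f
  map_zero' := by ext; simp
  map_one' := by
    ext n
    rw [coeff_mk, MvPowerSeries.coeff_one, PowerSeries.coeff_one]
    simp
  map_add' f g := by ext; simp
  map_mul' f g := by
    ext n
    rw [coeff_mk, MvPowerSeries.coeff_mul, PowerSeries.coeff_mul, Finsupp.antidiagonal_single,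
      Finset.sum_map]
    simp

variable {k : Type*} [Field k]

lemma coeff_axisRestriction (i : Fin 2) (f : MvPowerSeries (Fin 2) k) (n : ℕ) :
    PowerSeries.coeff n (axisRestriction k i f) = MvPowerSeries.coeff (Finsupp.single i n) f := by
  simp [axisRestriction]

lemma axisRestriction_X_self (i : Fin 2) : axisRestriction k i (MvPowerSeries.X i) = X := by
  ext n
  rw [coeff_axisRestriction, MvPowerSeries.coeff_X, PowerSeries.coeff_X]
  simp [(Finsupp.single_injective i).eq_iff]

lemma axisRestriction_X_of_ne {i j : Fin 2} (h : i ≠ j) :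
    axisRestriction k i (MvPowerSeries.X j) = 0 := by
  ext n
  rw [coeff_axisRestriction, MvPowerSeries.coeff_X, map_zero, if_neg]
  intro e
  have := congrArg (fun m ↦ m j) e
  simp [h] at this

/-- The power series in two variables with given restrictions to the coordinate axes and no mixed
terms. -/
lemma exists_axisRestriction_eq (f g : k⟦X⟧) (h : constantCoeff f = constantCoeff g) :
    ∃ F : MvPowerSeries (Fin 2) k, axisRestriction k 0 F = f ∧ axisRestriction k 1 F = g := by
  let F : MvPowerSeries (Fin 2) k := fun m ↦ if m 1 = 0 then PowerSeries.coeff (m 0) f else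
    if m 0 = 0 then PowerSeries.coeff (m 1) g else 0
  have hF (m) : MvPowerSeries.coeff m F = if m 1 = 0 then PowerSeries.coeff (m 0) f else
    if m 0 = 0 then PowerSeries.coeff (m 1) g else 0 := rfl
  refine ⟨F, ?_, ?_⟩
  · ext n
    rw [coeff_axisRestriction, hF]
    simp
  · ext n
    rw [coeff_axisRestriction, hF]
    rcases eq_or_ne n 0 with rfl | hn <;> simp_all

/-- The ideal `(x y)` is the kernel of the restriction to both coordinate axes. -/
lemma X_mul_X_dvd_iff (f : MvPowerSeries (Fin 2) k) :
    MvPowerSeries.X 0 * MvPowerSeries.X 1 ∣ f ↔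
      axisRestriction k 0 f = 0 ∧ axisRestriction k 1 f = 0 := by
  refine ⟨?_, fun ⟨h0, h1⟩ ↦ ?_⟩
  · rintro ⟨g, rfl⟩
    simp [axisRestriction_X_of_ne (k := k) (show (0 : Fin 2) ≠ 1 by simp),
      axisRestriction_X_of_ne (k := k) (show (1 : Fin 2) ≠ 0 by simp)]
  · have e (m : Fin 2 →₀ ℕ) {i j : Fin 2} (hij : i ≠ j) (hm : m i = 0) :
        m = Finsupp.single j (m j) := by
      ext l
      rcases eq_or_ne l j with rfl | hl
      · simp
      · have : l = i := by lia
        simp [this, hm, hij]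
    obtain ⟨g, rfl⟩ := (MvPowerSeries.X_dvd_iff (s := 0) (φ := f)).2 fun m hm ↦ by
      rw [e m (show (0 : Fin 2) ≠ 1 by simp) hm, ← coeff_axisRestriction, h1, map_zero]
    refine mul_dvd_mul_left _ (MvPowerSeries.X_dvd_iff.2 fun m hm ↦ ?_)
    rw [map_mul, axisRestriction_X_self] at h0
    rw [e m (show (1 : Fin 2) ≠ 0 by simp) hm, ← coeff_axisRestriction,
      (mul_eq_zero.1 h0).resolve_left X_ne_zero, map_zero]

variable (k) in
/-- The complete local ring `k⟦x, y⟧ / (x y)` of a node. -/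
abbrev NodeRing : Type _ :=
  MvPowerSeries (Fin 2) k ⧸
    Ideal.span {(MvPowerSeries.X 0 * MvPowerSeries.X 1 : MvPowerSeries (Fin 2) k)}

namespace NodeRing

variable (k) in
/-- Restriction to a branch of the node. -/
def branch (i : Fin 2) : NodeRing k →+* k⟦X⟧ :=
  Ideal.Quotient.lift _ (axisRestriction k i) fun f hf ↦ by
    have := (X_mul_X_dvd_iff f).1 (Ideal.mem_span_singleton.1 hf)
    fin_cases i
    exacts [this.1, this.2]

lemma branch_mk (i : Fin 2) (f : MvPowerSeries (Fin 2) k) :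
    branch k i (Ideal.Quotient.mk _ f) = axisRestriction k i f := rfl

lemma ext_branch {b c : NodeRing k} (h0 : branch k 0 b = branch k 0 c)
    (h1 : branch k 1 b = branch k 1 c) : b = c := by
  obtain ⟨f, rfl⟩ := Ideal.Quotient.mk_surjective b
  obtain ⟨g, rfl⟩ := Ideal.Quotient.mk_surjective c
  rw [Ideal.Quotient.eq, Ideal.mem_span_singleton, X_mul_X_dvd_iff, map_sub, map_sub]
  exact ⟨sub_eq_zero.2 h0, sub_eq_zero.2 h1⟩

lemma exists_branch_eq (f g : k⟦X⟧) (h : constantCoeff f = constantCoeff g) :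
    ∃ b : NodeRing k, branch k 0 b = f ∧ branch k 1 b = g := by
  obtain ⟨F, h0, h1⟩ := exists_axisRestriction_eq f g h
  exact ⟨Ideal.Quotient.mk _ F, h0, h1⟩

lemma constantCoeff_branch (b : NodeRing k) :
    constantCoeff (branch k 0 b) = constantCoeff (branch k 1 b) := by
  obtain ⟨f, rfl⟩ := Ideal.Quotient.mk_surjective b
  rw [branch_mk, branch_mk, ← coeff_zero_eq_constantCoeff_apply,
    ← coeff_zero_eq_constantCoeff_apply, coeff_axisRestriction, coeff_axisRestriction,
    Finsupp.single_zero, Finsupp.single_zero]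

lemma isUnit_iff (b : NodeRing k) : IsUnit b ↔ constantCoeff (branch k 0 b) ≠ 0 := by
  refine ⟨fun h ↦ ((h.map (branch k 0)).map constantCoeff).ne_zero, fun h ↦ ?_⟩
  have h' : constantCoeff (branch k 1 b) ≠ 0 := constantCoeff_branch b ▸ h
  obtain ⟨c, h0, h1⟩ := exists_branch_eq (branch k 0 b)⁻¹ (branch k 1 b)⁻¹ (by
    rw [constantCoeff_inv, constantCoeff_inv, constantCoeff_branch])
  refine IsUnit.of_mul_eq_one c (ext_branch ?_ ?_)
  · rw [map_mul, h0, map_one, PowerSeries.mul_inv_cancel _ h]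
  · rw [map_mul, h1, map_one, PowerSeries.mul_inv_cancel _ h']

variable [IsLocalRing (NodeRing k)]

lemma mem_maximalIdeal_iff (b : NodeRing k) :
    b ∈ maximalIdeal (NodeRing k) ↔ X ∣ branch k 0 b ∧ X ∣ branch k 1 b := by
  rw [mem_maximalIdeal, mem_nonunits_iff, isUnit_iff, not_not, X_dvd_iff, X_dvd_iff,
    ← constantCoeff_branch, and_self]

lemma mem_maximalIdeal_pow_iff {n : ℕ} (hn : n ≠ 0) (b : NodeRing k) :
    b ∈ maximalIdeal (NodeRing k) ^ n ↔ X ^ n ∣ branch k 0 b ∧ X ^ n ∣ branch k 1 b := by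
  refine ⟨fun h ↦ ?_, ?_⟩
  · have (i : Fin 2) : X ^ n ∣ branch k i b := by
      rw [← Ideal.mem_span_singleton, ← Ideal.span_singleton_pow]
      have h1 : maximalIdeal (NodeRing k) ≤ (Ideal.span {X}).comap (branch k i) := fun c hc ↦ by
        rw [Ideal.mem_comap, Ideal.mem_span_singleton]
        fin_cases i
        exacts [((mem_maximalIdeal_iff c).1 hc).1, ((mem_maximalIdeal_iff c).1 hc).2]
      exact Ideal.le_comap_pow _ n (Ideal.pow_right_mono h1 n h)
    exact ⟨this 0, this 1⟩
  · rintro ⟨⟨f, hf⟩, ⟨g, hg⟩⟩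
    obtain ⟨F, hF0, -⟩ := exists_branch_eq f (C (constantCoeff f)) (by simp)
    obtain ⟨G, -, hG1⟩ := exists_branch_eq (C (constantCoeff g)) g (by simp)
    let x (i : Fin 2) : NodeRing k := Ideal.Quotient.mk _ (MvPowerSeries.X i)
    have hx (i) : branch k i (x i) = X := axisRestriction_X_self i
    have hx' {i j} (h : i ≠ j) : branch k i (x j) = 0 := axisRestriction_X_of_ne h
    have h01 : branch k 0 (x 1) = 0 := hx' (by simp)
    have h10 : branch k 1 (x 0) = 0 := hx' (by simp)
    have hm (i) : x i ∈ maximalIdeal (NodeRing k) := by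
      rw [mem_maximalIdeal_iff]
      fin_cases i
      · exact ⟨dvd_of_eq (hx 0).symm, h10 ▸ dvd_zero _⟩
      · exact ⟨h01 ▸ dvd_zero _, dvd_of_eq (hx 1).symm⟩
    have : b = x 0 ^ n * F + x 1 ^ n * G := by
      refine ext_branch ?_ ?_
      · rw [map_add, map_mul, map_mul, map_pow, map_pow, hx, h01, hF0, hf, zero_pow hn, zero_mul,
          add_zero]
      · rw [map_add, map_mul, map_mul, map_pow, map_pow, hx, h10, hG1, hg, zero_pow hn, zero_mul,
          zero_add]
    rw [this]
    exact Ideal.add_mem _ (Ideal.mul_mem_right _ _ (Ideal.pow_mem_pow (hm 0) n))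
      (Ideal.mul_mem_right _ _ (Ideal.pow_mem_pow (hm 1) n))

end NodeRing

/-- The two branches of a local ring `A` at a node: homomorphisms `α, β : A → k⟦X⟧` such that `A`
is dense in the fibre product `k⟦X⟧ ×ₖ k⟦X⟧` and carries the induced topology. -/
structure Branches (A k : Type*) [CommRing A] [IsLocalRing A] [Field k] where
  /-- The first branch. -/
  α : A →+* k⟦X⟧
  /-- The second branch. -/
  β : A →+* k⟦X⟧
  exists_approx (f g : k⟦X⟧) (h : constantCoeff f = constantCoeff g) (n : ℕ) :
    ∃ a, X ^ n ∣ α a - f ∧ X ^ n ∣ β a - g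
  mem_pow_iff (n : ℕ) (hn : n ≠ 0) (a : A) : a ∈ maximalIdeal A ^ n ↔ X ^ n ∣ α a ∧ X ^ n ∣ β a

variable {A : Type*} [CommRing A] [IsLocalRing A]

lemma mem_maximalIdeal_pow_adicCompletion_iff [IsNoetherianRing A] (n : ℕ)
    (z : AdicCompletion (maximalIdeal A) A) :
    z ∈ maximalIdeal (AdicCompletion (maximalIdeal A) A) ^ n ↔
      AdicCompletion.evalₐ (maximalIdeal A) n z = 0 := by
  have h := AdicCompletion.pow_smul_top_eq_ker_eval (I := maximalIdeal A) (M := A) (n := n)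
    (Ideal.fg_of_isNoetherianRing _)
  rw [AdicCompletion.maximalIdeal_eq_map, ← Ideal.map_pow, ← Submodule.restrictScalars_mem A,
    ← Ideal.smul_top_eq_map, h]
  exact (map_eq_zero_iff (Ideal.quotientEquivAlgOfEq A
    (show (maximalIdeal A ^ n • ⊤ : Ideal A) = maximalIdeal A ^ n by simp))
    (AlgEquiv.injective _)).symm

/-- A local ring whose completion is `k⟦x, y⟧ / (x y)` has two branches. -/
def Branches.ofEquiv [IsNoetherianRing A]
    (e : AdicCompletion (maximalIdeal A) A ≃+* NodeRing k) : Branches A k :=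
  have : IsLocalRing (NodeRing k) := e.isLocalRing
  have hmap (n : ℕ) (z) : e z ∈ maximalIdeal (NodeRing k) ^ n ↔
      z ∈ maximalIdeal (AdicCompletion (maximalIdeal A) A) ^ n := by
    have h1 : (maximalIdeal (AdicCompletion (maximalIdeal A) A)).map e =
        maximalIdeal (NodeRing k) :=
      IsLocalRing.eq_maximalIdeal (Ideal.map_isMaximal_of_equiv e)
    rw [← h1, ← Ideal.map_pow, Ideal.apply_mem_of_equiv_iff]
  { α := ((NodeRing.branch k 0).comp e.toRingHom).comp (algebraMap A _)
    β := ((NodeRing.branch k 1).comp e.toRingHom).comp (algebraMap A _)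
    exists_approx f g h n := by
      obtain ⟨b, rfl, rfl⟩ := NodeRing.exists_branch_eq f g h
      obtain ⟨z, rfl⟩ := e.surjective b
      obtain ⟨a, ha⟩ := Ideal.Quotient.mk_surjective
        (AdicCompletion.evalₐ (maximalIdeal A) (n + 1) z)
      have h1 : e (algebraMap A _ a - z) ∈ maximalIdeal (NodeRing k) ^ (n + 1) := by
        rw [hmap, mem_maximalIdeal_pow_adicCompletion_iff, map_sub, AlgHom.commutes, ← ha,
          sub_eq_zero]
        rfl
      rw [NodeRing.mem_maximalIdeal_pow_iff (by simp), map_sub, map_sub, map_sub] at h1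
      exact ⟨a, (pow_dvd_pow _ n.le_succ).trans h1.1, (pow_dvd_pow _ n.le_succ).trans h1.2⟩
    mem_pow_iff n hn a := by
      refine Iff.trans ?_ (NodeRing.mem_maximalIdeal_pow_iff hn (e (algebraMap A _ a)))
      rw [hmap, mem_maximalIdeal_pow_adicCompletion_iff, AlgHom.commutes]
      exact (Ideal.Quotient.eq_zero_iff_mem).symm }

end Node

/-! ### The conductor of a node -/

lemma PowerSeries.not_isUnit_of_X_dvd {k : Type*} [Field k] {f : PowerSeries k}
    (h : PowerSeries.X ∣ f) : ¬ IsUnit f := fun hu ↦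
  PowerSeries.X_prime.not_isUnit (isUnit_of_dvd_unit h hu)

lemma PowerSeries.not_X_pow_three_dvd_X {k : Type*} [Field k] :
    ¬ (PowerSeries.X : PowerSeries k) ^ 3 ∣ PowerSeries.X := fun h ↦ by
  simpa using PowerSeries.X_pow_dvd_iff.1 h 1 (by simp)

/-- Since `k⟦X⟧` is integrally closed, a homomorphism to `k⟦X⟧` maps integral fractions to power
series. -/
lemma PowerSeries.dvd_of_isIntegral {A k : Type*} [CommRing A] [Field k] (γ : A →+* PowerSeries k)
    (hγ : ∀ s ∈ nonZeroDivisors A, γ s ≠ 0) {c s : A} (hs : s ∈ nonZeroDivisors A)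
    (h : IsIntegral A (IsLocalization.mk' (FractionRing A) c ⟨s, hs⟩)) : γ s ∣ γ c := by
  have hle : nonZeroDivisors A ≤ (nonZeroDivisors (PowerSeries k)).comap γ := fun s hs ↦
    mem_nonZeroDivisors_of_ne_zero (hγ s hs)
  have h1 := h.map_of_comp_eq γ (IsLocalization.map (FractionRing (PowerSeries k)) γ hle) (by
    ext x
    simp)
  obtain ⟨g, hg⟩ := IsIntegrallyClosed.isIntegral_iff.1 h1
  refine ⟨g, IsFractionRing.injective (PowerSeries k) (FractionRing (PowerSeries k)) ?_⟩
  rw [IsLocalization.map_mk', IsLocalization.eq_mk'_iff_mul_eq] at hg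
  rw [map_mul, ← hg, mul_comm]

namespace Branches

open IsLocalRing PowerSeries AlgebraicGeometry.Scheme

variable {A k : Type*} [CommRing A] [IsLocalRing A] [Field k] (B : Branches A k)
include B

lemma mem_maximalIdeal_iff (a : A) : a ∈ maximalIdeal A ↔ X ∣ B.α a ∧ X ∣ B.β a := by
  simpa using B.mem_pow_iff 1 one_ne_zero a

lemma mem_maximalIdeal_of_α {a : A} (h : X ∣ B.α a) : a ∈ maximalIdeal A := by
  rw [mem_maximalIdeal, mem_nonunits_iff]
  exact fun hu ↦ not_isUnit_of_X_dvd h (hu.map B.α)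

lemma mem_maximalIdeal_of_β {a : A} (h : X ∣ B.β a) : a ∈ maximalIdeal A := by
  rw [mem_maximalIdeal, mem_nonunits_iff]
  exact fun hu ↦ not_isUnit_of_X_dvd h (hu.map B.β)

/-- There are parameters `a` and `b` of the two branches: modulo `X ^ 3`, the element `a` restricts
to `(X, 0)` and `b` to `(0, X)`. -/
lemma exists_parameters : ∃ a b : A, (X ^ 3 ∣ B.α a - X ∧ X ^ 3 ∣ B.β a) ∧
    (X ^ 3 ∣ B.α b ∧ X ^ 3 ∣ B.β b - X) := by
  obtain ⟨a, ha, ha'⟩ := B.exists_approx X 0 (by simp) 3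
  obtain ⟨b, hb, hb'⟩ := B.exists_approx 0 X (by simp) 3
  exact ⟨a, b, ⟨ha, by simpa using ha'⟩, by simpa using hb, hb'⟩

lemma eq_zero_of_map_eq_zero [IsNoetherianRing A] {z : A} (h : B.α z = 0) (h' : B.β z = 0) :
    z = 0 := by
  have : z ∈ ⨅ n, maximalIdeal A ^ n := by
    rw [Submodule.mem_iInf]
    intro n
    rcases eq_or_ne n 0 with rfl | hn
    · simp
    · rw [B.mem_pow_iff n hn, h, h']
      simp
  rwa [Ideal.iInf_pow_eq_bot_of_isLocalRing _ (maximalIdeal.isMaximal A).ne_top] at this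

section Parameters

variable {B} {a b : A} (ha : X ^ 3 ∣ B.α a - X ∧ X ^ 3 ∣ B.β a)
  (hb : X ^ 3 ∣ B.α b ∧ X ^ 3 ∣ B.β b - X)
include ha hb

lemma mem_maximalIdeal_of_parameters : a ∈ maximalIdeal A ∧ b ∈ maximalIdeal A :=
  ⟨B.mem_maximalIdeal_of_β ((dvd_pow_self X three_ne_zero).trans ha.2),
    B.mem_maximalIdeal_of_α ((dvd_pow_self X three_ne_zero).trans hb.1)⟩

lemma mul_mem_of_parameters : a * b ∈ maximalIdeal A ^ 3 := by
  rw [B.mem_pow_iff 3 three_ne_zero, map_mul, map_mul]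
  exact ⟨hb.1.mul_left _, ha.2.mul_right _⟩

/-- The classes of `a` and `b` in `𝔪 / 𝔪²` are linearly independent over the residue field. -/
lemma independent_of_parameters {u v : A} (h : u * a + v * b ∈ maximalIdeal A ^ 2) :
    u ∈ maximalIdeal A ∧ v ∈ maximalIdeal A := by
  rw [B.mem_pow_iff 2 two_ne_zero, map_add, map_mul, map_mul, map_add, map_mul, map_mul] at h
  have h23 : (X : k⟦X⟧) ^ 2 ∣ X ^ 3 := pow_dvd_pow _ (by simp)
  have cancel {f : k⟦X⟧} (hf : X ^ 2 ∣ f * X) : X ∣ f := by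
    rw [pow_two] at hf
    exact (mul_dvd_mul_iff_right X_ne_zero).1 hf
  refine ⟨B.mem_maximalIdeal_of_α (cancel ?_), B.mem_maximalIdeal_of_β (cancel ?_)⟩
  · have e : B.α u * X = B.α u * B.α a + B.α v * B.α b - B.α u * (B.α a - X) - B.α v * B.α b := by
      ring
    rw [e]
    exact dvd_sub (dvd_sub h.1 ((h23.trans ha.1).mul_left _)) ((h23.trans hb.1).mul_left _)
  · have e : B.β v * X = B.β u * B.β a + B.β v * B.β b - B.β v * (B.β b - X) - B.β u * B.β a := by
      ring
    rw [e]
    exact dvd_sub (dvd_sub h.2 ((h23.trans hb.2).mul_left _)) ((h23.trans ha.2).mul_left _)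

variable [IsNoetherianRing A]

/-- The maximal ideal is generated by `a` and `b`: by Nakayama's lemma, it suffices to subtract from
an element of `𝔪` a combination with the same linear terms on both branches. -/
lemma maximalIdeal_le_of_parameters : maximalIdeal A ≤ Ideal.span {a, b} := by
  refine Submodule.le_of_le_smul_of_le_jacobson_bot (I := maximalIdeal A)
    (Ideal.fg_of_isNoetherianRing _) (maximalIdeal_le_jacobson _) fun c hc ↦ ?_
  obtain ⟨⟨f, hf⟩, ⟨g, hg⟩⟩ := (B.mem_maximalIdeal_iff c).1 hc
  obtain ⟨u, hu, -⟩ := B.exists_approx (C (constantCoeff f)) (C (constantCoeff f)) rfl 1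
  obtain ⟨v, -, hv⟩ := B.exists_approx (C (constantCoeff g)) (C (constantCoeff g)) rfl 1
  have h23 : (X : k⟦X⟧) ^ 2 ∣ X ^ 3 := pow_dvd_pow _ (by simp)
  have hs (f : k⟦X⟧) : X ∣ f - C (constantCoeff f) := by simp [X_dvd_iff]
  rw [pow_one] at hu hv
  rw [← sub_add_cancel c (u * a + v * b), add_comm (c - _)]
  refine Submodule.add_mem_sup (Ideal.add_mem _
    (Ideal.mul_mem_left _ _ (Ideal.subset_span (by simp)))
    (Ideal.mul_mem_left _ _ (Ideal.subset_span (by simp)))) ?_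
  rw [smul_eq_mul, ← pow_two, B.mem_pow_iff 2 two_ne_zero]
  constructor
  · have e : B.α (c - (u * a + v * b)) = X * ((f - C (constantCoeff f)) -
        (B.α u - C (constantCoeff f))) - B.α u * (B.α a - X) - B.α v * B.α b := by
      simp only [map_sub, map_add, map_mul, hf]
      ring
    rw [e]
    exact dvd_sub (dvd_sub (pow_two (X : k⟦X⟧) ▸ mul_dvd_mul_left X (dvd_sub (hs f) hu))
      ((h23.trans ha.1).mul_left _)) ((h23.trans hb.1).mul_left _)
  · have e : B.β (c - (u * a + v * b)) = X * ((g - C (constantCoeff g)) -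
        (B.β v - C (constantCoeff g))) - B.β v * (B.β b - X) - B.β u * B.β a := by
      simp only [map_sub, map_add, map_mul, hg]
      ring
    rw [e]
    exact dvd_sub (dvd_sub (pow_two (X : k⟦X⟧) ▸ mul_dvd_mul_left X (dvd_sub (hs g) hv))
      ((h23.trans hb.2).mul_left _)) ((h23.trans ha.2).mul_left _)

/-- On both branches, `(a + b) ^ 2` is the square of a uniformizer, and therefore divides the
elements of `𝔪 ^ 3` up to `𝔪 ^ 4`. -/
lemma maximalIdeal_pow_le_of_parameters :
    maximalIdeal A ^ 3 ≤ Ideal.span {(a + b) ^ 2} := by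
  refine Submodule.le_of_le_smul_of_le_jacobson_bot (I := maximalIdeal A)
    (Ideal.fg_of_isNoetherianRing _) (maximalIdeal_le_jacobson _) fun c hc ↦ ?_
  obtain ⟨⟨f, hf⟩, ⟨g, hg⟩⟩ := (B.mem_pow_iff 3 three_ne_zero c).1 hc
  -- On the branches, `c = X³ f` and `c = X³ g`, so that `d` approximates the quotient by `X²`.
  obtain ⟨d, hd, hd'⟩ := B.exists_approx (X * f) (X * g) (by simp) 4
  rw [← sub_add_cancel c (d * (a + b) ^ 2), add_comm (c - _)]
  refine Submodule.add_mem_sup (Ideal.mul_mem_left _ _ (Ideal.mem_span_singleton_self _)) ?_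
  rw [smul_eq_mul, ← pow_succ', B.mem_pow_iff _ (by simp)]
  constructor
  · obtain ⟨p, hp⟩ := ha.1
    obtain ⟨q, hq⟩ := hb.1
    obtain ⟨r, hr⟩ := hd
    rw [sub_eq_iff_eq_add] at hp hr
    refine ⟨-(r * (1 + X ^ 2 * (p + q)) ^ 2 * X ^ 2) -
      X * f * (2 * (p + q) + X ^ 2 * (p + q) ^ 2), ?_⟩
    simp only [map_sub, map_add, map_mul, map_pow, hf, hp, hq, hr]
    ring
  · obtain ⟨p, hp⟩ := ha.2
    obtain ⟨q, hq⟩ := hb.2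
    obtain ⟨r, hr⟩ := hd'
    rw [sub_eq_iff_eq_add] at hq hr
    refine ⟨-(r * (1 + X ^ 2 * (p + q)) ^ 2 * X ^ 2) -
      X * g * (2 * (p + q) + X ^ 2 * (p + q) ^ 2), ?_⟩
    simp only [map_sub, map_add, map_mul, map_pow, hg, hp, hq, hr]
    ring

omit [IsNoetherianRing A] in
lemma map_add_ne_zero_of_parameters : B.α (a + b) ≠ 0 ∧ B.β (a + b) ≠ 0 := by
  constructor <;> intro h <;> rw [map_add] at h <;> refine not_X_pow_three_dvd_X (k := k) ?_
  · have e : (X : k⟦X⟧) = -(B.α a - X) - B.α b := by linear_combination h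
    rw [e]
    exact dvd_sub (dvd_neg.2 (e ▸ ha.1)) (e ▸ hb.1)
  · have e : (X : k⟦X⟧) = -(B.β b - X) - B.β a := by linear_combination h
    rw [e]
    exact dvd_sub (dvd_neg.2 (e ▸ hb.2)) (e ▸ ha.2)

lemma add_mem_nonZeroDivisors_of_parameters : a + b ∈ nonZeroDivisors A :=
  mem_nonZeroDivisors_iff_right.2 fun z hz ↦ by
    have h := map_add_ne_zero_of_parameters ha hb
    refine B.eq_zero_of_map_eq_zero ?_ ?_
    · exact (mul_eq_zero.1 (by rw [← map_mul, hz, map_zero])).resolve_right h.1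
    · exact (mul_eq_zero.1 (by rw [← map_mul, hz, map_zero])).resolve_right h.2

end Parameters

variable [IsNoetherianRing A]

/-- The element `w = a / (a + b)` of the total ring of fractions is integral: if
`a b = c (a + b) ^ 2`, then `w ^ 2 - w + c = 0`. It does not belong to `A`, since
`(w - 1) a + w b = 0` would imply that both `w - 1` and `w` lie in `𝔪`. -/
lemma conductorOfIntegralClosure_ne_top : conductorOfIntegralClosure A ≠ ⊤ := fun h ↦ by
  obtain ⟨a, b, ha, hb⟩ := B.exists_parameters
  have hs := add_mem_nonZeroDivisors_of_parameters ha hb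
  obtain ⟨c, hc⟩ := Ideal.mem_span_singleton'.1
    (maximalIdeal_pow_le_of_parameters ha hb (mul_mem_of_parameters ha hb))
  rw [Ideal.eq_top_iff_one, mem_conductorOfIntegralClosure] at h
  let F := FractionRing A
  have hu : IsUnit (algebraMap A F (a + b)) := IsLocalization.map_units F ⟨a + b, hs⟩
  obtain ⟨i, hi⟩ := hu.exists_left_inv
  obtain ⟨e, he⟩ := h (algebraMap A F a * i) (by
    refine ⟨Polynomial.X ^ 2 - Polynomial.X + Polynomial.C c, by monicity!, ?_⟩
    have hc' : algebraMap A F c * algebraMap A F (a + b) ^ 2 =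
        algebraMap A F a * algebraMap A F b := by
      rw [← map_pow, ← map_mul, ← map_mul, hc]
    simp only [Polynomial.eval₂_add, Polynomial.eval₂_sub, Polynomial.eval₂_pow,
      Polynomial.eval₂_X, Polynomial.eval₂_C]
    rw [map_add] at hc' hi
    linear_combination i ^ 2 * hc' + (algebraMap A F a * i -
      algebraMap A F c * (i * (algebraMap A F a + algebraMap A F b) + 1)) * hi)
  rw [one_smul] at he
  have he' : e * (a + b) = a := by
    refine IsFractionRing.injective A F ?_
    rw [map_mul, he, mul_assoc, hi, mul_one]
  obtain ⟨h1, h2⟩ := independent_of_parameters ha hb (u := e - 1) (v := e) (by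
    rw [show (e - 1) * a + e * b = 0 by linear_combination he']
    exact zero_mem _)
  exact (Ideal.ne_top_iff_one _).1 (maximalIdeal.isMaximal A).ne_top (by simpa using sub_mem h2 h1)

/-- Nonzerodivisors do not vanish on any branch, since they divide a power of `a + b`. -/
lemma map_ne_zero_of_mem_nonZeroDivisors (hA : ringKrullDim A = 1) {s : A}
    (hs : s ∈ nonZeroDivisors A) : B.α s ≠ 0 ∧ B.β s ≠ 0 := by
  obtain ⟨a, b, ha, hb⟩ := B.exists_parameters
  obtain ⟨n, hn⟩ := exists_maximalIdeal_pow_le_span hA hs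
  have hm := mem_maximalIdeal_of_parameters ha hb
  obtain ⟨c, hc⟩ := Ideal.mem_span_singleton.1 (hn (Ideal.pow_mem_pow (add_mem hm.1 hm.2) n))
  have h := map_add_ne_zero_of_parameters ha hb
  constructor <;> intro h0
  · refine pow_ne_zero n h.1 ?_
    rw [← map_pow, hc, map_mul, h0, zero_mul]
  · refine pow_ne_zero n h.2 ?_
    rw [← map_pow, hc, map_mul, h0, zero_mul]

/-- An integral fraction `c / s` restricts to power series `f` and `g` on the branches. If `a ∈ 𝔪`,
then `a f` and `a g` have the same constant coefficient zero, and are approximated by an element `d`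
of `A`. As `s` divides a power of `𝔪`, it divides `a c - s d`, so that `a c / s ∈ A`. -/
lemma maximalIdeal_le_conductor (hA : ringKrullDim A = 1) :
    maximalIdeal A ≤ conductorOfIntegralClosure A := fun a ha ↦ by
  rw [mem_conductorOfIntegralClosure]
  intro w hw
  obtain ⟨c, ⟨s, hs⟩, rfl⟩ := IsLocalization.exists_mk'_eq (nonZeroDivisors A) w
  have h0 (s) (hs : s ∈ nonZeroDivisors A) := B.map_ne_zero_of_mem_nonZeroDivisors hA hs
  obtain ⟨f, hf⟩ := dvd_of_isIntegral B.α (fun s hs ↦ (h0 s hs).1) hs hw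
  obtain ⟨g, hg⟩ := dvd_of_isIntegral B.β (fun s hs ↦ (h0 s hs).2) hs hw
  obtain ⟨n, hn⟩ := exists_maximalIdeal_pow_le_span hA hs
  obtain ⟨ha1, ha2⟩ := (B.mem_maximalIdeal_iff a).1 ha
  obtain ⟨d, hd, hd'⟩ := B.exists_approx (B.α a * f) (B.β a * g) (by
    rw [X_dvd_iff] at ha1 ha2
    rw [map_mul, map_mul, ha1, ha2, zero_mul, zero_mul]) (n + 1)
  have h1 : a * c - s * d ∈ maximalIdeal A ^ (n + 1) := by
    rw [B.mem_pow_iff _ (by simp), ← dvd_neg, ← dvd_neg (b := B.β _)]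
    constructor
    · convert hd.mul_left (B.α s) using 1
      simp only [map_sub, map_mul, hf]
      ring
    · convert hd'.mul_left (B.β s) using 1
      simp only [map_sub, map_mul, hg]
      ring
  obtain ⟨r, hr⟩ := Ideal.mem_span_singleton.1 (hn (Ideal.pow_le_pow_right n.le_succ h1))
  refine ⟨d + r, ?_⟩
  have hu : IsUnit (algebraMap A (FractionRing A) s) := IsLocalization.map_units _ ⟨s, hs⟩
  rw [← hu.mul_left_inj, smul_mul_assoc, IsLocalization.mk'_spec, Algebra.smul_def, ← map_mul,
    ← map_mul]
  congr 1
  linear_combination -hr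

lemma conductor_eq (hA : ringKrullDim A = 1) : conductorOfIntegralClosure A = maximalIdeal A :=
  (le_maximalIdeal B.conductorOfIntegralClosure_ne_top).antisymm (B.maximalIdeal_le_conductor hA)

end Branches

/-! ### Nodes are not smooth -/

namespace Branches

open IsLocalRing

variable {A k : Type*} [CommRing A] [IsLocalRing A] [IsNoetherianRing A] [Field k]
  (B : Branches A k) {k₀ : Type*} [Field k₀] [Algebra k₀ A]
include B

/-- A node is not formally smooth over its residue field: a homomorphism to `k₀[ε] / (ε²)` that maps
the parameters `a, b` of both branches to `ε` does not lift to `k₀[ε] / (ε³)`, as `a b ∈ 𝔪³`. -/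
lemma not_formallySmooth (hres : ∀ x : A, ∃ c : k₀, x - algebraMap k₀ A c ∈ maximalIdeal A) :
    ¬ Algebra.FormallySmooth k₀ A := fun hA ↦ by
  obtain ⟨a, b, ha, hb⟩ := B.exists_parameters
  obtain ⟨ham, hbm⟩ := mem_maximalIdeal_of_parameters ha hb
  have hk {c : k₀} (hc : algebraMap k₀ A c ∈ maximalIdeal A) : c = 0 := by
    by_contra h
    exact ((mem_maximalIdeal _).1 hc) ((IsUnit.mk0 c h).map (algebraMap k₀ A))
  -- `g` is the small extension `k₀[ε] / (ε³) → k₀[ε] / (ε²)`, the target being identified with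
  -- `A / J` for `J = 𝔪² + (a - b)`.
  let J : Ideal A := maximalIdeal A ^ 2 ⊔ Ideal.span {a - b}
  have hJm : J ≤ maximalIdeal A := sup_le (Ideal.pow_le_self two_ne_zero)
    ((Ideal.span_singleton_le_iff_mem _).2 (sub_mem ham hbm))
  have hJ2 {z : A} (hz : z ∈ maximalIdeal A ^ 2) : z ∈ J := Ideal.mem_sup_left hz
  have hmm {y z : A} (hy : y ∈ maximalIdeal A) (hz : z ∈ maximalIdeal A) : y * z ∈ J :=
    hJ2 (pow_two (maximalIdeal A) ▸ Ideal.mul_mem_mul hy hz)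
  have hab : a - b ∈ J := Ideal.mem_sup_right (Ideal.mem_span_singleton_self _)
  let T := Polynomial k₀ ⧸ Ideal.span {(Polynomial.X ^ 3 : Polynomial k₀)}
  let g₀ : Polynomial k₀ →ₐ[k₀] A ⧸ J := Polynomial.aeval (Ideal.Quotient.mk J a)
  have hg₀ (p : Polynomial k₀) : g₀ p = Ideal.Quotient.mk J (Polynomial.aeval a p) :=
    (Polynomial.aeval_algHom_apply (Ideal.Quotient.mkₐ k₀ J) a p)
  let g : T →ₐ[k₀] A ⧸ J := Ideal.Quotient.liftₐ _ g₀ fun p hp ↦ by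
    obtain ⟨q, rfl⟩ := Ideal.mem_span_singleton.1 hp
    rw [hg₀, Ideal.Quotient.eq_zero_iff_mem, map_mul, map_pow, Polynomial.aeval_X]
    exact Ideal.mul_mem_right _ _ (hJ2 (Ideal.pow_le_pow_right (by simp) (Ideal.pow_mem_pow ham 3)))
  have hgs : Function.Surjective g := fun z ↦ by
    obtain ⟨z, rfl⟩ := Ideal.Quotient.mk_surjective z
    obtain ⟨c, hc⟩ := hres z
    obtain ⟨u, v, huv⟩ := Ideal.mem_span_pair.1 (maximalIdeal_le_of_parameters ha hb hc)
    obtain ⟨cu, hu⟩ := hres u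
    obtain ⟨cv, hv⟩ := hres v
    refine ⟨Ideal.Quotient.mk _ (Polynomial.C c + Polynomial.C (cu + cv) * Polynomial.X), ?_⟩
    change g₀ _ = _
    rw [hg₀, Ideal.Quotient.eq]
    have e : Polynomial.aeval a (Polynomial.C c + Polynomial.C (cu + cv) * Polynomial.X) - z =
        algebraMap k₀ A cv * (a - b) - (u - algebraMap k₀ A cu) * a -
          (v - algebraMap k₀ A cv) * b := by
      simp
      linear_combination huv
    rw [e]
    exact sub_mem (sub_mem (Ideal.mul_mem_left _ _ hab) (hmm hu ham)) (hmm hv hbm)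
  let ε : T := Ideal.Quotient.mk _ Polynomial.X
  have hε3 : ε ^ 3 = 0 := Ideal.Quotient.eq_zero_iff_mem.2 (Ideal.mem_span_singleton_self _)
  have hε2 : ε ^ 2 ≠ 0 := fun h ↦ by
    have h1 := Ideal.mem_span_singleton.1 (Ideal.Quotient.eq_zero_iff_mem.1 h)
    simpa using Polynomial.X_pow_dvd_iff.1 h1 2 (by simp)
  have hI (z : T) (hz : z ∈ RingHom.ker g) : ε ^ 2 ∣ z := by
    obtain ⟨p, rfl⟩ := Ideal.Quotient.mk_surjective z
    have h1 : g₀ p = 0 := hz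
    rw [hg₀, Ideal.Quotient.eq_zero_iff_mem] at h1
    have h2 : Polynomial.X ^ 2 ∣ p := by
      obtain ⟨r, u, c, rfl⟩ : ∃ r u c,
          p = (r * Polynomial.X + Polynomial.C u) * Polynomial.X + Polynomial.C c :=
        ⟨p.divX.divX, p.divX.coeff 0, p.coeff 0, by
          rw [Polynomial.divX_mul_X_add, Polynomial.divX_mul_X_add]⟩
      simp only [map_add, map_mul, Polynomial.aeval_X, Polynomial.aeval_C] at h1
      have hc : c = 0 := hk <| ((Ideal.add_mem_iff_right _
        (Ideal.mul_mem_left _ _ ham)).1 (hJm h1))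
      subst hc
      obtain ⟨y, hy, z, hz, hyz⟩ := Submodule.mem_sup.1 h1
      obtain ⟨w, rfl⟩ := Ideal.mem_span_singleton'.1 hz
      have h3 : (algebraMap k₀ A u - w) * a + w * b ∈ maximalIdeal A ^ 2 := by
        have e : (algebraMap k₀ A u - w) * a + w * b = y - Polynomial.aeval a r * (a * a) := by
          rw [map_zero] at hyz
          linear_combination -hyz
        rw [e]
        exact sub_mem hy (Ideal.mul_mem_left _ _ (pow_two (maximalIdeal A) ▸
          Ideal.mul_mem_mul ham ham))
      obtain ⟨h4, h5⟩ := independent_of_parameters ha hb h3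
      have hu : u = 0 := hk (by simpa using add_mem h4 h5)
      subst hu
      exact ⟨r, by simp; ring⟩
    obtain ⟨q, rfl⟩ := h2
    exact Dvd.intro (Ideal.Quotient.mk _ q) (by rw [map_mul, map_pow])
  have hnil : IsNilpotent (RingHom.ker g) := by
    refine ⟨2, le_bot_iff.1 ((Ideal.pow_right_mono
      (fun z hz ↦ Ideal.mem_span_singleton.2 (hI z hz)) 2).trans (le_of_eq ?_))⟩
    have e : (ε ^ 2) ^ 2 = 0 := by linear_combination ε * hε3
    rw [Ideal.span_singleton_pow, e]
    exact Ideal.span_singleton_eq_bot.2 rfl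
  -- A lift `l` would map `a` and `b` to `ε` modulo `ε²`, hence `a b` to `ε² ≠ 0`, contradicting
  -- `a b ∈ 𝔪³`.
  let s : A →ₐ[k₀] T ⧸ RingHom.ker g :=
    (Ideal.quotientKerAlgEquivOfSurjective hgs).symm.toAlgHom.comp (Ideal.Quotient.mkₐ k₀ J)
  obtain ⟨l, hl⟩ := Algebra.FormallySmooth.exists_lift (RingHom.ker g) hnil s
  have hlε (z : A) (hz : g ε = Ideal.Quotient.mk J z) : ∃ w, l z = ε + ε ^ 2 * w := by
    have h1 : Ideal.Quotient.mk (RingHom.ker g) (l z) = Ideal.Quotient.mk (RingHom.ker g) ε := by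
      refine (AlgHom.congr_fun hl z).trans
        ((AlgEquiv.symm_apply_eq (Ideal.quotientKerAlgEquivOfSurjective hgs)).2 hz.symm)
    obtain ⟨w, hw⟩ := hI _ (Ideal.Quotient.eq.1 h1)
    exact ⟨w, by rw [← hw]; ring⟩
  have hga : g ε = Ideal.Quotient.mk J a := (hg₀ _).trans (by simp)
  obtain ⟨w, hw⟩ := hlε a hga
  obtain ⟨w', hw'⟩ := hlε b (hga.trans (Ideal.Quotient.eq.2 hab))
  have hm : maximalIdeal A ≤ (Ideal.span {ε}).comap l := by
    refine (maximalIdeal_le_of_parameters ha hb).trans (Ideal.span_le.2 ?_)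
    rintro z (rfl | rfl) <;> refine Ideal.mem_span_singleton.2 ?_
    · rw [hw]
      exact dvd_add dvd_rfl ((dvd_pow_self _ two_ne_zero).mul_right _)
    · rw [hw']
      exact dvd_add dvd_rfl ((dvd_pow_self _ two_ne_zero).mul_right _)
  have hm3 : l (a * b) ∈ Ideal.span {ε} ^ 3 :=
    Ideal.le_comap_pow _ 3 (Ideal.pow_right_mono hm 3 (mul_mem_of_parameters ha hb))
  rw [Ideal.span_singleton_pow, hε3, Ideal.mem_span_singleton, zero_dvd_iff, map_mul, hw,
    hw'] at hm3
  exact hε2 (by linear_combination hm3 - (w + w' + ε * w * w') * hε3)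

end Branches

/-! ### Local structure of nodal projective curves -/

namespace AlgebraicGeometry

open IsLocalRing Scheme

section Projective

attribute [local instance] MvPolynomial.gradedAlgebra

lemma algebraMap_homogeneousSubmodule_zero_surjective (k : Type u) [Field k] (n : ℕ) :
    Function.Surjective
      (algebraMap k (MvPolynomial.homogeneousSubmodule (Fin (n + 1)) k 0)) := fun p ↦ by
  refine ⟨MvPolynomial.coeff 0 p.1, Subtype.ext ?_⟩
  have h := MvPolynomial.totalDegree_eq_zero_iff_eq_C.1
    (Nat.le_zero.1 (MvPolynomial.IsHomogeneous.totalDegree_le p.2))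
  exact h.symm

instance (k : Type u) [Field k] (n : ℕ) :
    Algebra.FiniteType (MvPolynomial.homogeneousSubmodule (Fin (n + 1)) k 0)
      (MvPolynomial (Fin (n + 1)) k) :=
  have : IsScalarTower k (MvPolynomial.homogeneousSubmodule (Fin (n + 1)) k 0)
    (MvPolynomial (Fin (n + 1)) k) :=
    IsScalarTower.of_algebraMap_eq (R := k)
      (S := MvPolynomial.homogeneousSubmodule (Fin (n + 1)) k 0)
      (A := MvPolynomial (Fin (n + 1)) k) fun _ ↦ rfl
  Algebra.FiniteType.of_restrictScalars_finiteType k _ _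

instance (k : Type u) [Field k] (n : ℕ) : LocallyOfFiniteType (projectiveSpaceToSpec k n) := by
  have : IsClosedImmersion (Spec.map (CommRingCat.ofHom
      (algebraMap k (MvPolynomial.homogeneousSubmodule (Fin (n + 1)) k 0)))) :=
    IsClosedImmersion.spec_of_surjective _ (algebraMap_homogeneousSubmodule_zero_surjective k n)
  unfold projectiveSpaceToSpec
  infer_instance

instance (k : Type u) [Field k] (n : ℕ) : QuasiCompact (projectiveSpaceToSpec k n) := by
  unfold projectiveSpaceToSpec
  infer_instance

end Projective

variable {k : Type u} [Field k] {X : Scheme.{u}} {f : X ⟶ Spec (.of k)}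

lemma IsProjectiveOver.locallyOfFiniteType (h : IsProjectiveOver f) : LocallyOfFiniteType f := by
  obtain ⟨n, i, hi, rfl⟩ := h
  infer_instance

lemma IsProjectiveOver.quasiCompact (h : IsProjectiveOver f) : QuasiCompact f := by
  obtain ⟨n, i, hi, rfl⟩ := h
  infer_instance

/-- The local ring at a proper generization of a point of codimension one is a reduced
zero-dimensional local ring. -/
lemma isField_stalk_of_specializes [IsReduced X] {x y : X} (h : y ⤳ x) (hne : y ≠ x)
    (hx : ringKrullDim (X.presheaf.stalk x) = 1) : IsField (X.presheaf.stalk y) := by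
  have hlt : x < y := lt_of_le_not_ge (le_iff_specializes.2 h) fun h' ↦
    hne (h.antisymm (le_iff_specializes.1 h')).eq
  rw [ringKrullDim_stalk_eq_coheight] at hx
  have h1 := Order.coheight_add_one_le hlt
  have : Ring.KrullDimLE 0 (X.presheaf.stalk y) := krullDimLE_of_coheight_le (by
    have : Order.coheight x = 1 := by exact_mod_cast hx
    rw [this, ← zero_add (1 : ℕ∞)] at h1
    exact (ENat.add_le_add_iff_right ENat.one_ne_top).1 h1)
  exact Ring.KrullDimLE.isField_of_isReduced


lemma nonempty_ringEquiv_stalk_Spec (k : Type u) [Field k] (y : Spec (.of k)) :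
    Nonempty (k ≃+* (Spec (.of k)).presheaf.stalk y) := by
  let : Algebra k ((Spec (.of k)).presheaf.stalk y) :=
    StructureSheaf.stalkAlgebra (CommRingCat.of k) y
  have hy : y.asIdeal.IsPrime := y.isPrime
  have : IsLocalization.AtPrime ((Spec (.of k)).presheaf.stalk y) y.asIdeal :=
    StructureSheaf.IsLocalization.to_stalk (CommRingCat.of k) y
  exact ⟨(IsLocalization.atUnits k y.asIdeal.primeCompl fun c hc ↦
    IsUnit.mk0 (c : k) fun h ↦ hc (h ▸ y.asIdeal.zero_mem)).toRingEquiv⟩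

lemma isField_stalk_Spec (y : Spec (.of k)) : IsField ((Spec (.of k)).presheaf.stalk y) := by
  obtain ⟨e⟩ := nonempty_ringEquiv_stalk_Spec k y
  exact e.symm.isField (Field.toIsField k)

section Smooth

variable [IsAlgClosed k] [LocallyOfFiniteType f]

/-- The residue field of a closed point is the base field. -/
lemma exists_sub_stalkMap_mem_maximalIdeal {x : X} (hx : IsClosed {x}) (a : X.presheaf.stalk x) :
    ∃ c, a - (f.stalkMap x).hom c ∈ maximalIdeal (X.presheaf.stalk x) := by
  have h : (residueFieldIsoBase f x hx).inv =
      ((ΓSpecIso (.of k)).inv ≫ (Spec (.of k)).presheaf.germ ⊤ (f x) trivial) ≫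
        f.stalkMap x ≫ X.residue x := by
    refine Spec.map_injective ?_
    rw [SpecMap_residueFieldIsoBase_inv, Spec.map_comp, ← Spec.fromSpecStalk_eq, Spec.map_comp,
      Category.assoc, SpecMap_stalkMap_fromSpecStalk]
    rfl
  have hs : Function.Surjective (residueFieldIsoBase f x hx).inv :=
    ((ConcreteCategory.isIso_iff_bijective _).1 inferInstance).2
  obtain ⟨c, hc⟩ := hs (residue _ a)
  rw [h] at hc
  refine ⟨((ΓSpecIso (.of k)).inv ≫ (Spec (.of k)).presheaf.germ ⊤ (f x) trivial).hom c, ?_⟩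
  rw [← residue_eq_zero_iff, map_sub, sub_eq_zero]
  exact hc.symm

/-- A node is not a smooth point. -/
lemma IsNode.notMem_smoothLocus {x : X} (hx : IsClosed {x}) (h : IsNode k x) :
    x ∉ f.smoothLocus := fun hs ↦ by
  have : IsLocallyNoetherian X := LocallyOfFiniteType.isLocallyNoetherian f
  let : Field ((Spec (.of k)).presheaf.stalk (f x)) := (isField_stalk_Spec (f x)).toField
  let := (f.stalkMap x).hom.toAlgebra
  obtain ⟨e⟩ := h
  refine (Branches.ofEquiv e).not_formallySmooth
    (exists_sub_stalkMap_mem_maximalIdeal (f := f) hx) ?_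
  exact Scheme.Hom.mem_smoothLocus.1 hs

/-- A point whose local ring is a field is smooth. -/
lemma mem_smoothLocus_of_isField {x : X} (h : IsField (X.presheaf.stalk x)) :
    x ∈ f.smoothLocus := by
  have := LocallyOfFiniteType.stalkMap f x
  rw [Scheme.Hom.mem_smoothLocus]
  let : Field ((Spec (.of k)).presheaf.stalk (f x)) := (isField_stalk_Spec (f x)).toField
  let : Field (X.presheaf.stalk x) := h.toField
  have : PerfectField ((Spec (.of k)).presheaf.stalk (f x)) :=
    PerfectField.of_ringEquiv (nonempty_ringEquiv_stalk_Spec k (f x)).some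
  algebraize [(f.stalkMap x).hom]
  exact Algebra.FormallySmooth.of_perfectField

end Smooth

namespace IsNodalProjectiveCurve

variable (hX : IsNodalProjectiveCurve f)
include hX

lemma isNoetherian : IsNoetherian X := by
  have := hX.isProjective.locallyOfFiniteType
  have := hX.isProjective.quasiCompact
  have := LocallyOfFiniteType.isLocallyNoetherian f
  have : CompactSpace X := QuasiCompact.compactSpace_of_compactSpace f
  exact {}

lemma jacobsonSpace : JacobsonSpace X :=
  have := hX.isProjective.locallyOfFiniteType
  LocallyOfFiniteType.jacobsonSpace f

lemma exists_specializes (y : X) : ∃ x : X, IsClosed {x} ∧ y ⤳ x := by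
  have := hX.jacobsonSpace
  obtain ⟨x, hx, hx'⟩ := nonempty_inter_closedPoints (Z := closure {y}) ⟨y, subset_closure rfl⟩
    isClosed_closure.isLocallyClosed
  exact ⟨x, hx', specializes_iff_mem_closure.2 hx⟩

lemma isField_stalk {y : X} (hy : ¬ IsClosed {y}) : IsField (X.presheaf.stalk y) := by
  have := hX.isReduced
  obtain ⟨x, hx, hyx⟩ := hX.exists_specializes y
  exact isField_stalk_of_specializes hyx (fun h ↦ hy (h ▸ hx)) (hX.dim_eq_one x hx)

/-- Each point of the curve which is not a node is normal, so that the conductor is trivial. -/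
lemma conductor_eq_top {y : X} (hy : ¬ (IsClosed {y} ∧ IsNode k y)) :
    conductorOfIntegralClosure (X.presheaf.stalk y) = ⊤ := by
  have := hX.isNoetherian
  by_cases h : IsClosed {y}
  · obtain ⟨_, _⟩ := exists_isDiscreteValuationRing (hX.dim_eq_one y h)
      ((hX.regular_or_node y h).resolve_right fun h' ↦ hy ⟨h, h'⟩)
    exact conductorOfIntegralClosure_eq_top
  · let := (hX.isField_stalk h).toField
    exact conductorOfIntegralClosure_eq_top

/-- The nodes are isolated: the singular locus of the structure morphism is closed, and consists of
closed points. -/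
lemma exists_opens_conductor_eq_top [IsAlgClosed k] (x : X) : ∃ U : X.Opens, x ∈ U ∧
    ∀ y ∈ U, y ≠ x → conductorOfIntegralClosure (X.presheaf.stalk y) = ⊤ := by
  have := hX.isProjective.locallyOfFiniteType
  have := hX.isNoetherian
  let Z : Set X := (f.smoothLocus : Set X)ᶜ
  have hZ : IsClosed Z := f.smoothLocus.isOpen.isClosed_compl
  have hZ' (y : X) (hy : y ∈ Z) : IsClosed {y} := by
    by_contra h
    exact hy (mem_smoothLocus_of_isField (hX.isField_stalk h))
  -- The generic points of the irreducible components of `Z` are closed, so `Z` is finite.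
  have hfin : Z.Finite := by
    obtain ⟨S, hS, hSc, hSi, hSZ⟩ :=
      TopologicalSpace.NoetherianSpace.exists_finite_set_isClosed_irreducible hZ
    rw [hSZ]
    refine hS.sUnion fun W hW ↦ ?_
    obtain ⟨y, hy⟩ := QuasiSober.sober (hSi W hW) (hSc W hW)
    have hyZ : y ∈ Z := hSZ ▸ Set.mem_sUnion_of_mem hy.mem hW
    rw [← hy.def, (hZ' y hyZ).closure_eq]
    exact Set.finite_singleton y
  refine ⟨⟨(Z \ {x})ᶜ, ?_⟩, fun h ↦ h.2 rfl, fun y hy hyx ↦ hX.conductor_eq_top fun h ↦ ?_⟩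
  · rw [isOpen_compl_iff, ← Set.biUnion_of_singleton (Z \ {x})]
    exact hfin.sdiff.isClosed_biUnion fun y hy ↦ hZ' y hy.1
  · exact hy ⟨h.2.notMem_smoothLocus h.1, hyx⟩

lemma conductor_eq_maximalIdeal {x : X} (hx : IsClosed {x}) (h : IsNode k x) :
    conductorOfIntegralClosure (X.presheaf.stalk x) = maximalIdeal (X.presheaf.stalk x) := by
  have := hX.isNoetherian
  obtain ⟨e⟩ := h
  exact (Branches.ofEquiv e).conductor_eq (hX.dim_eq_one x hx)

lemma hasDepthOne_stalk {x : X} (hx : IsClosed {x}) : HasDepthOne (X.presheaf.stalk x) := by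
  have := hX.isNoetherian
  have := hX.isReduced
  exact hasDepthOne_of_isReduced (hX.dim_eq_one x hx)

end IsNodalProjectiveCurve

end AlgebraicGeometry

/-! ### Sheaves of modules on a site -/

namespace PresheafOfModules

variable {C : Type u'} [Category.{v'} C] {R : Cᵒᵖ ⥤ RingCat.{u}} {M : PresheafOfModules.{v} R}

/-- Restriction of sections of a presheaf of modules on a category, as an additive map. -/
def restr {U V : C} (i : V ⟶ U) :
    M.obj (Opposite.op U) →+ M.obj (Opposite.op V) :=
  (M.map i.op).hom.toAddMonoidHom

lemma app_restr {N : PresheafOfModules.{v} R} (f : M ⟶ N) {U V : C} (i : V ⟶ U)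
    (m : M.obj (Opposite.op U)) :
    f.app (Opposite.op V) (restr i m) = restr i (f.app (Opposite.op U) m) :=
  naturality_apply f i.op m

end PresheafOfModules

namespace SheafOfModules

open PresheafOfModules (restr)

variable {C : Type u'} [Category.{v'} C] {J : GrothendieckTopology C} {R : Sheaf J RingCat.{u}}
  [HasSheafify J AddCommGrpCat.{u}] [J.WEqualsLocallyBijective AddCommGrpCat.{u}]

/-- The canonical morphism to the associated sheaf of modules. -/
def toSheafifyVal (P : PresheafOfModules.{u} R.obj) :
    P ⟶ ((PresheafOfModules.sheafification (𝟙 R.obj)).obj P).val :=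
  PresheafOfModules.homMk (CategoryTheory.toSheafify J P.presheaf) fun X r m ↦
    (((PresheafOfModules.sheafificationAdjunction (𝟙 R.obj)).unit.app P).app X).hom.map_smul r m

lemma toSheafifyVal_locally_eq {P : PresheafOfModules.{u} R.obj} {U : C}
    (m : P.obj (Opposite.op U)) (h : (toSheafifyVal P).app _ m = 0) :
    ∃ S ∈ J U, ∀ ⦃V : C⦄ (f : V ⟶ U), S f → restr f m = 0 := by
  have := ((J.W_iff_isLocallyBijective _).1 (J.W_toSheafify P.presheaf)).1
  refine ⟨_, Presheaf.equalizerSieve_mem J (CategoryTheory.toSheafify J P.presheaf) m 0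
    (h.trans (map_zero _).symm), fun V f hf ↦ ?_⟩
  exact hf.trans (map_zero _)

lemma toSheafifyVal_locally_exists {P : PresheafOfModules.{u} R.obj} {U : C}
    (m : ((PresheafOfModules.sheafification (𝟙 R.obj)).obj P).val.obj (Opposite.op U)) :
    ∃ S ∈ J U, ∀ ⦃V : C⦄ (f : V ⟶ U), S f → ∃ p, (toSheafifyVal P).app (Opposite.op V) p =
      restr f m := by
  have := ((J.W_iff_isLocallyBijective _).1 (J.W_toSheafify P.presheaf)).2
  exact ⟨_, Presheaf.imageSieve_mem J (CategoryTheory.toSheafify J P.presheaf) m,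
    fun V f hf ↦ by
      obtain ⟨p, hp⟩ := hf
      exact ⟨p, hp⟩⟩

/-- If a morphism from `M` to a sheaf of modules vanishes as soon as it vanishes on the subpresheaf
`N`, then each section of `M` belongs locally to `N`: consider the morphism from `M` to the sheaf
associated to `M / N`. -/
lemma locally_mem_submodule (M : SheafOfModules.{u} R) (N : M.val.Submodule)
    (h : ∀ (Q : SheafOfModules.{u} R) (q : M ⟶ Q),
      (∀ (U : Cᵒᵖ) (n : M.val.obj U), n ∈ N.obj U → q.val.app U n = 0) → q = 0)
    {U : C} (m : M.val.obj (Opposite.op U)) :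
    ∃ S ∈ J U, ∀ ⦃V : C⦄ (f : V ⟶ U), S f → restr f m ∈ N.obj (Opposite.op V) := by
  let P := Limits.cokernel N.ι
  let c : M.val ⟶ P := Limits.cokernel.π N.ι
  let q : M ⟶ (PresheafOfModules.sheafification (𝟙 R.obj)).obj P := ⟨c ≫ toSheafifyVal P⟩
  have hex : (ShortComplex.mk N.ι c (Limits.cokernel.condition _)).Exact :=
    ShortComplex.exact_cokernel _
  have hN (V : Cᵒᵖ) (n : M.val.obj V) : c.app V n = 0 ↔ n ∈ N.obj V := by
    have := (ShortComplex.ShortExact.moduleCat_exact_iff_function_exact _).1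
      (hex.map (PresheafOfModules.evaluation _ V)) n
    refine this.trans ⟨?_, fun hn ↦ ⟨⟨n, hn⟩, rfl⟩⟩
    rintro ⟨n', rfl⟩
    exact n'.2
  have hq : q = 0 := h _ q fun V n hn ↦ by
    change (toSheafifyVal P).app V (c.app V n) = 0
    rw [(hN V n).2 hn, map_zero]
  have hm : (toSheafifyVal P).app (Opposite.op U) (c.app _ m) = 0 := by
    change q.val.app (Opposite.op U) m = 0
    rw [hq]
    rfl
  obtain ⟨S, hS, hS'⟩ := toSheafifyVal_locally_eq _ hm
  refine ⟨S, hS, fun V f hf ↦ (hN _ _).1 ?_⟩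
  exact (PresheafOfModules.app_restr c f m).trans (hS' f hf)

end SheafOfModules

/-! ### Stalks of sheaves of modules on a scheme -/

namespace AlgebraicGeometry.Scheme

open TopologicalSpace Opposite PresheafOfModules

variable {X : Scheme.{u}}

/-- The presheaf of modules underlying a sheaf of modules, over the presheaf of commutative rings
`𝒪_X`. -/
abbrev Modules.pre (M : X.Modules) :
    _root_.PresheafOfModules.{u} (X.presheaf ⋙ forget₂ CommRingCat RingCat) := M.val

/-- The morphism of presheaves of modules underlying a morphism of sheaves of modules. -/
abbrev Modules.preHom {M N : X.Modules} (f : M ⟶ N) : M.pre ⟶ N.pre := f.val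

/-- The stalk of a sheaf of modules. -/
abbrev Modules.stalk (M : X.Modules) (x : X) : Type u := M.pre.Stalk x

lemma exists_opens_of_mem_grothendieckTopology {U : X.Opens} {S : Sieve U}
    (hS : S ∈ Opens.grothendieckTopology X U) {x : X} (hx : x ∈ U) :
    ∃ (V : X.Opens) (i : V ⟶ U), S i ∧ x ∈ V := hS x hx

variable (P : _root_.PresheafOfModules.{u} (X.presheaf ⋙ forget₂ CommRingCat RingCat))

/-- The canonical morphism to the associated sheaf of modules. -/
def toOfPresheaf : P ⟶ (Modules.ofPresheaf (X := X) P).pre :=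
  SheafOfModules.toSheafifyVal (R := X.ringCatSheaf) P

variable {P}

lemma germAt_eq_zero_of_toOfPresheaf {U : X.Opens} {x : X} (hx : x ∈ U) (m : P.obj (op U))
    (h : (toOfPresheaf P).app (op U) m = 0) : P.germAt x U hx m = 0 := by
  obtain ⟨S, hS, hS'⟩ := SheafOfModules.toSheafifyVal_locally_eq (R := X.ringCatSheaf) (P := P) m h
  obtain ⟨V, i, hi, hxV⟩ := exists_opens_of_mem_grothendieckTopology hS hx
  have h0 : res i m = 0 := hS' i hi
  rw [← germAt_res i hxV, h0, map_zero]

/-- Sheafification does not change the stalks. -/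
lemma stalkMap_toOfPresheaf_bijective (x : X) :
    Function.Bijective (stalkMap x (toOfPresheaf P)) := by
  constructor
  · refine (injective_iff_map_eq_zero _).2 fun s hs ↦ ?_
    obtain ⟨U, hU, m, rfl⟩ := exists_germAt_eq s
    rw [stalkMap_germAt] at hs
    obtain ⟨V, hV, i, hi⟩ := exists_map_eq_zero_of_germAt_eq_zero hU _ hs
    rw [← germAt_res i hV]
    refine germAt_eq_zero_of_toOfPresheaf hV _ ?_
    rw [app_res, hi]
  · intro s
    obtain ⟨U, hU, m, rfl⟩ := exists_germAt_eq s
    obtain ⟨S, hS, hS'⟩ := SheafOfModules.toSheafifyVal_locally_exists (R := X.ringCatSheaf)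
      (P := P) m
    obtain ⟨V, i, hi, hxV⟩ := exists_opens_of_mem_grothendieckTopology hS hU
    obtain ⟨p, hp⟩ := hS' i hi
    refine ⟨P.germAt x V hxV p, ?_⟩
    rw [stalkMap_germAt, ← germAt_res i hxV]
    exact congrArg _ hp

lemma Modules.eq_zero_of_germAt (M : X.Modules) {U : X.Opens} (m : M.pre.obj (op U))
    (h : ∀ (x : X) (hx : x ∈ U), M.pre.germAt x U hx m = 0) : m = 0 := by
  refine TopCat.Presheaf.section_ext (F := ⟨M.val.presheaf, M.isSheaf⟩) U m 0 fun x hx ↦ ?_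
  exact (h x hx).trans (map_zero _).symm

/-- The sheaf associated to a presheaf of modules vanishes if and only if all stalks do. -/
lemma isZero_ofPresheaf_iff :
    Limits.IsZero (Modules.ofPresheaf (X := X) P) ↔ ∀ x : X, Subsingleton (P.Stalk x) := by
  refine ⟨fun h x ↦ ?_, fun h ↦ ?_⟩
  · refine (Equiv.ofBijective _
      (stalkMap_toOfPresheaf_bijective (P := P) x)).subsingleton_congr.2 ?_
    refine subsingleton_of_forall_eq 0 fun s ↦ ?_
    obtain ⟨U, hU, m, rfl⟩ := exists_germAt_eq s
    have h0 : (𝟙 (Modules.ofPresheaf (X := X) P)) = 0 := (Limits.IsZero.iff_id_eq_zero _).1 h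
    have : m = 0 := congrArg (fun f : Modules.ofPresheaf (X := X) P ⟶ _ ↦ f.val.app (op U) m) h0
    rw [this, map_zero]
  · rw [Limits.IsZero.iff_id_eq_zero]
    apply SheafOfModules.hom_ext
    ext U m
    refine Modules.eq_zero_of_germAt _ m fun x hx ↦ ?_
    have := (Equiv.ofBijective _
      (stalkMap_toOfPresheaf_bijective (P := P) x)).subsingleton_congr.1 (h x)
    exact Subsingleton.elim _ _

end AlgebraicGeometry.Scheme

/-! ### The stalks of `𝒪 / 𝒥` -/

namespace AlgebraicGeometry.Scheme

open TopologicalSpace Opposite PresheafOfModules IsLocalRing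

variable {X : Scheme.{u}}

/-- Vanishing of the stalks may be tested at closed points. -/
lemma subsingleton_stalk_of_closed [JacobsonSpace X]
    (P : _root_.PresheafOfModules.{u} (X.presheaf ⋙ forget₂ CommRingCat RingCat))
    (h : ∀ x : X, IsClosed {x} → Subsingleton (P.Stalk x)) (y : X) : Subsingleton (P.Stalk y) := by
  refine subsingleton_of_forall_eq 0 fun s ↦ ?_
  obtain ⟨U, hU, m, rfl⟩ := exists_germAt_eq s
  obtain ⟨x, ⟨hx, hxU⟩, hx'⟩ := nonempty_inter_closedPoints (Z := closure {y} ∩ U)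
    ⟨y, subset_closure rfl, hU⟩ (isClosed_closure.isLocallyClosed.inter U.isOpen.isLocallyClosed)
  have := h x hx'
  obtain ⟨V, hxV, i, hi⟩ := exists_map_eq_zero_of_germAt_eq_zero hxU m (Subsingleton.elim _ _)
  have hyV : y ∈ V := (specializes_iff_mem_closure.2 hx).mem_open V.isOpen hxV
  rw [← germAt_res i hyV, hi, map_zero]

section Quotient

variable {M N P : _root_.PresheafOfModules.{u} (X.presheaf ⋙ forget₂ CommRingCat RingCat)}

lemma stalkMap_comp_apply (f : M ⟶ N) (g : N ⟶ P) (x : X) (s : M.Stalk x) :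
    stalkMap x (f ≫ g) s = stalkMap x g (stalkMap x f s) := by
  obtain ⟨U, hU, m, rfl⟩ := exists_germAt_eq s
  rw [stalkMap_germAt, stalkMap_germAt, stalkMap_germAt]
  rfl

variable (L : M.Submodule)

/-- The canonical morphism from a presheaf of modules `M` to the sheaf associated to the quotient
of `M` by a submodule `L`. -/
def toSheafQuotient : M ⟶ (Modules.ofPresheaf (X := X) (Limits.cokernel L.ι)).pre :=
  Limits.cokernel.π L.ι ≫ toOfPresheaf (X := X) (Limits.cokernel L.ι)

lemma stalkMap_toSheafQuotient_surjective (x : X) :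
    Function.Surjective (stalkMap x (toSheafQuotient L)) := by
  intro s
  obtain ⟨t, rfl⟩ := (stalkMap_toOfPresheaf_bijective x).2 s
  obtain ⟨r, rfl⟩ := stalkMap_surjective x (f := Limits.cokernel.π L.ι)
    (fun U ↦ PresheafOfModules.surjective_of_epi _ (op U)) t
  exact ⟨r, stalkMap_comp_apply _ _ x r⟩

lemma stalkMap_toSheafQuotient_eq_zero_iff {x : X} {U : X.Opens} (hx : x ∈ U) (m : M.obj (op U)) :
    stalkMap x (toSheafQuotient L) (M.germAt x U hx m) = 0 ↔
      ∃ (V : X.Opens) (_ : x ∈ V) (i : V ⟶ U), res i m ∈ L.obj (op V) := by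
  have hN (V : X.Opens) (b : M.obj (op V)) :
      (Limits.cokernel.π L.ι).app (op V) b = 0 ↔ b ∈ L.obj (op V) := by
    have hex : (ShortComplex.mk L.ι _ (Limits.cokernel.condition _)).Exact :=
      ShortComplex.exact_cokernel _
    refine (exact_app_of_exact hex V b).trans ⟨?_, fun hn ↦ ⟨⟨b, hn⟩, rfl⟩⟩
    rintro ⟨n', rfl⟩
    exact n'.2
  have hc : stalkMap x (toSheafQuotient L) (M.germAt x U hx m) =
      stalkMap x (toOfPresheaf (X := X) (Limits.cokernel L.ι))
        (germAt _ x U hx ((Limits.cokernel.π L.ι).app (op U) m)) :=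
    (stalkMap_comp_apply _ _ x _).trans (congrArg _ (stalkMap_germAt ..))
  refine (Eq.congr_left hc).trans
    ((map_eq_zero_iff _ (stalkMap_toOfPresheaf_bijective x).1).trans ?_)
  constructor
  · intro h
    obtain ⟨V, hV, i, hi⟩ := exists_map_eq_zero_of_germAt_eq_zero hx _ h
    exact ⟨V, hV, i, (hN V _).1 (by rw [app_res, hi])⟩
  · rintro ⟨V, hV, i, hi⟩
    rw [← germAt_res i hV, ← app_res, (hN V _).2 hi, map_zero]

end Quotient

variable (X) in
/-- The presheaf of modules `𝒪_X`. -/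
abbrev structurePresheaf :
    _root_.PresheafOfModules.{u} (X.presheaf ⋙ forget₂ CommRingCat RingCat) :=
  _root_.PresheafOfModules.unit X.ringCatSheaf.obj

/-- The germ at `x` of the unit section of `𝒪_X / 𝒥`. -/
def conductorUnitGerm (x : X) : X.structureSheafModConductor.stalk x :=
  stalkMap x (toSheafQuotient (M := structurePresheaf X) (conductorSheaf X))
    ((structurePresheaf X).germAt x ⊤ trivial (1 : Γ(X, ⊤)))

lemma smul_germAt_one {x : X} {U : X.Opens} (hx : x ∈ U) (a : Γ(X, U)) :
    X.presheaf.germ U x hx a • (structurePresheaf X).germAt x ⊤ trivial (1 : Γ(X, ⊤)) =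
      (structurePresheaf X).germAt x U hx a := by
  have h : (structurePresheaf X).germAt x ⊤ trivial (1 : Γ(X, ⊤)) =
      (structurePresheaf X).germAt x U hx (1 : Γ(X, U)) := by
    refine (germAt_res (M := structurePresheaf X) (homOfLE le_top : U ⟶ ⊤) hx _).symm.trans ?_
    exact congrArg _ (map_one (X.presheaf.map (homOfLE le_top : U ⟶ ⊤).op).hom)
  rw [h]
  refine (germAt_smul hx a _).symm.trans ?_
  exact congrArg _ (mul_one a)

/-- `𝒪_X / 𝒥` is generated by the unit section. -/
lemma exists_smul_conductorUnitGerm_eq {x : X} (s : X.structureSheafModConductor.stalk x) :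
    ∃ r : X.presheaf.stalk x, r • conductorUnitGerm x = s := by
  obtain ⟨t, rfl⟩ := stalkMap_toSheafQuotient_surjective (M := structurePresheaf X)
    (conductorSheaf X) x s
  obtain ⟨U, hU, m, rfl⟩ := exists_germAt_eq t
  refine ⟨X.presheaf.germ U x hU m, ?_⟩
  rw [← smul_germAt_one hU m]
  exact (map_smul _ _ _).symm

/-- The annihilator of the unit section of `𝒪_X / 𝒥` in the stalk at `x`. -/
lemma germ_smul_conductorUnitGerm_eq_zero_iff {x : X} {U : X.Opens} (hx : x ∈ U) (a : Γ(X, U)) :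
    X.presheaf.germ U x hx a • conductorUnitGerm x = 0 ↔
      ∃ (V : X.Opens) (_ : x ∈ V) (i : V ⟶ U), X.presheaf.map i.op a ∈ conductorIdeal X V := by
  refine Iff.trans ?_ (stalkMap_toSheafQuotient_eq_zero_iff (M := structurePresheaf X)
    (conductorSheaf X) hx a)
  rw [← smul_germAt_one hx a]
  exact Eq.congr_left (map_smul _ _ _).symm

end AlgebraicGeometry.Scheme

namespace AlgebraicGeometry.IsNodalProjectiveCurve

open Scheme IsLocalRing PresheafOfModules

variable {k : Type u} [Field k] [IsAlgClosed k] {X : Scheme.{u}} {f : X ⟶ Spec (.of k)}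
  (hX : IsNodalProjectiveCurve f)

include hX

/-- The stalk of `𝒪_X / 𝒥` at a node is the residue field. -/
lemma nonempty_stalk_structureSheafModConductor_equiv {x : X} (hx : IsClosed {x})
    (h : IsNode k x) : Nonempty (X.structureSheafModConductor.stalk x ≃ₗ[X.presheaf.stalk x]
      ResidueField (X.presheaf.stalk x)) := by
  let φ : X.presheaf.stalk x →ₗ[X.presheaf.stalk x] X.structureSheafModConductor.stalk x :=
    LinearMap.toSpanSingleton _ _ (conductorUnitGerm x)
  have hφ : Function.Surjective φ := exists_smul_conductorUnitGerm_eq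
  have hker : LinearMap.ker φ = maximalIdeal (X.presheaf.stalk x) := by
    rw [← hX.conductor_eq_maximalIdeal hx h]
    ext r
    obtain ⟨U, hxU, a, rfl⟩ := X.presheaf.exists_germ_eq r
    refine (germ_smul_conductorUnitGerm_eq_zero_iff hxU a).trans ⟨?_, fun ha ↦ ?_⟩
    · rintro ⟨V, hV, i, hi⟩
      have := mem_conductorIdeal.1 hi x hV
      rwa [TopCat.Presheaf.germ_res_apply] at this
    · obtain ⟨W, hxW, hW⟩ := hX.exists_opens_conductor_eq_top x
      refine ⟨U ⊓ W, ⟨hxU, hxW⟩, homOfLE inf_le_left, mem_conductorIdeal.2 fun y hy ↦ ?_⟩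
      by_cases hyx : y = x
      · subst hyx
        rwa [TopCat.Presheaf.germ_res_apply]
      · rw [hW y hy.2 hyx]
        trivial
  exact ⟨((Submodule.quotEquivOfEq _ _ hker).symm ≪≫ₗ φ.quotKerEquivOfSurjective hφ).symm⟩

end AlgebraicGeometry.IsNodalProjectiveCurve

/-! ### The vanishing of `𝒯or_i(F, 𝒪 / 𝒥)` -/

namespace SheafOfModules

open PresheafOfModules (restr)

variable {C : Type u'} [Category.{v'} C] {J : GrothendieckTopology C} {R : Sheaf J RingCat.{u}}
  [HasSheafify J AddCommGrpCat.{u}] [J.WEqualsLocallyBijective AddCommGrpCat.{u}]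

/-- The submodule of `M` spanned by a family of global sections. -/
def sectionsSpan {M : SheafOfModules.{u} R} {I : Type*} (s : I → M.sections) : M.val.Submodule where
  obj V := Submodule.span (R.obj.obj V) (Set.range fun i ↦ (s i).eval V)
  map {V W} f := by
    refine Submodule.span_le.2 ?_
    rintro _ ⟨i, rfl⟩
    refine Submodule.subset_span ⟨i, ?_⟩
    exact ((s i).2 f).symm

/-- The sections of a sheaf of modules are locally linear combinations of generating sections. -/
lemma GeneratingSections.locally_mem_span {M : SheafOfModules.{u} R} (σ : M.GeneratingSections)
    {U : C} (m : M.val.obj (Opposite.op U)) :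
    ∃ S ∈ J U, ∀ ⦃V : C⦄ (f : V ⟶ U), S f → restr f m ∈ Submodule.span (R.obj.obj (.op V))
      (Set.range fun i ↦ (σ.s i).eval (.op V)) := by
  refine locally_mem_submodule M (sectionsSpan σ.s) (fun Q q hq ↦ ?_) m
  rw [← cancel_epi σ.π, Limits.comp_zero]
  apply Q.freeHomEquiv.injective
  funext i
  rw [freeHomEquiv_comp_apply, Equiv.apply_symm_apply]
  apply PresheafOfModules.sections_ext
  intro V
  exact hq V _ (Submodule.subset_span ⟨i, rfl⟩)

end SheafOfModules

namespace AlgebraicGeometry.Scheme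

open TopologicalSpace Opposite PresheafOfModules IsLocalRing

variable {X : Scheme.{u}} {M : X.Modules} {U : X.Opens}

/-- The sections over `U` given by generating sections of the restriction of `M` to `U`. -/
def generator (σ : (SheafOfModules.over M U).GeneratingSections) (i : σ.I) : M.pre.obj (op U) :=
  (σ.s i).eval (op (Over.mk (𝟙 U)))

lemma eval_eq_res_generator (σ : (SheafOfModules.over M U).GeneratingSections) (i : σ.I)
    (V : Over U) : (σ.s i).eval (op V) = res (M := M.pre) V.hom (generator σ i) :=
  ((σ.s i).2 (Over.homMk V.hom : V ⟶ Over.mk (𝟙 U)).op).symm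

lemma germAt_mem_span {I : Type*} {x : X} {V : X.Opens} (hx : x ∈ V) (g : I → M.pre.obj (op V))
    {t : M.pre.obj (op V)} (h : t ∈ Submodule.span Γ(X, V) (Set.range g)) :
    M.pre.germAt x V hx t ∈ Submodule.span (X.presheaf.stalk x)
      (Set.range fun i ↦ M.pre.germAt x V hx (g i)) := by
  induction h using Submodule.span_induction with
  | mem t ht =>
    obtain ⟨j, rfl⟩ := ht
    exact Submodule.subset_span ⟨j, rfl⟩
  | zero => rw [map_zero]; exact zero_mem _
  | add a b _ _ ha hb => rw [map_add]; exact add_mem ha hb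
  | smul r a _ ha =>
    rw [germAt_smul]
    exact Submodule.smul_mem _ _ ha

lemma span_germAt_generator (σ : (SheafOfModules.over M U).GeneratingSections) {x : X}
    (hx : x ∈ U) : Submodule.span (X.presheaf.stalk x)
      (Set.range fun i ↦ M.pre.germAt x U hx (generator σ i)) = ⊤ := by
  refine Submodule.eq_top_iff'.2 fun s ↦ ?_
  obtain ⟨W, hW, m, rfl⟩ := exists_germAt_eq s
  let Y : Over U := Over.mk (homOfLE inf_le_left : U ⊓ W ⟶ U)
  let m' : (SheafOfModules.over M U).val.obj (op Y) :=
    (res (homOfLE inf_le_right : U ⊓ W ⟶ W) m : M.pre.obj (op (U ⊓ W)))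
  obtain ⟨S, hS, hS'⟩ := σ.locally_mem_span m'
  obtain ⟨V, i, hi, hxV⟩ := exists_opens_of_mem_grothendieckTopology
    ((GrothendieckTopology.mem_over_iff _ _).1 hS) (x := x) ⟨hx, hW⟩
  have h : res (M := M.pre) i (res (homOfLE inf_le_right : U ⊓ W ⟶ W) m) ∈
      Submodule.span Γ(X, V)
        (Set.range fun j ↦ res (M := M.pre) (i ≫ Y.hom) (generator σ j)) := by
    have := hS' _ ((Sieve.overEquiv_iff _ _).1 hi)
    simp only [eval_eq_res_generator] at this
    exact this
  have h2 := germAt_mem_span hxV _ h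
  have e : M.pre.germAt x V hxV (res i (res (homOfLE inf_le_right : U ⊓ W ⟶ W) m)) =
      M.pre.germAt x W hW m := (germAt_res i hxV _).trans (germAt_res _ _ m)
  have e' (j : σ.I) : M.pre.germAt x V hxV (res (i ≫ Y.hom) (generator σ j)) =
      M.pre.germAt x U hx (generator σ j) := germAt_res _ hxV _
  simp only [e'] at h2
  exact e ▸ h2

lemma exists_mem_of_coversTop {I : Type*} {Y : I → X.Opens}
    (h : (Opens.grothendieckTopology X).CoversTop Y) (x : X) : ∃ i, x ∈ Y i := by
  obtain ⟨V, f, ⟨i, ⟨g⟩⟩, hxV⟩ := exists_opens_of_mem_grothendieckTopology (h ⊤) (x := x) trivial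
  exact ⟨i, g.le hxV⟩

/-- The stalks of a sheaf of modules of finite type are finitely generated. -/
lemma Modules.finite_stalk (hM : SheafOfModules.IsFiniteType (R := X.ringCatSheaf) M) (x : X) :
    Module.Finite (X.presheaf.stalk x) (M.stalk x) := by
  obtain ⟨σ, hσ⟩ := hM.exists_localGeneratorsData
  obtain ⟨i, hi⟩ := exists_mem_of_coversTop σ.coversTop x
  have := (hσ.isFiniteType i).finite
  exact ⟨(Submodule.fg_def.2 ⟨_, Set.finite_range _, span_germAt_generator (σ.generators i) hi⟩)⟩

end AlgebraicGeometry.Scheme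

namespace AlgebraicGeometry.IsNodalProjectiveCurve

open Scheme IsLocalRing PresheafOfModules

variable {k : Type u} [Field k] [IsAlgClosed k] {X : Scheme.{u}} {f : X ⟶ Spec (.of k)}
  (hX : IsNodalProjectiveCurve f) (F : X.Modules)
  (hF : SheafOfModules.IsFiniteType (R := X.ringCatSheaf) F)

/-- A projective resolution of the presheaf `𝒪 / 𝒥`. -/
def conductorResolution (X : Scheme.{u}) : ProjectiveResolution X.structureSheafModConductor.pre :=
  projectiveResolution X.structureSheafModConductor.pre

include hX

omit [IsAlgClosed k] in
/-- The vanishing of `𝒯or` is tested on the stalks at the closed points. -/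
lemma isZero_tor_iff (n : ℕ) :
    Limits.IsZero (Modules.tor (n + 1) F X.structureSheafModConductor) ↔ ∀ x : X, IsClosed {x} →
      TorVanishes (F.stalk x) (P := fun i ↦ ((conductorResolution X).complex.X i).Stalk x)
        (fun i ↦ stalkMap x ((conductorResolution X).complex.d (i + 1) i)) n := by
  have := hX.jacobsonSpace
  refine isZero_ofPresheaf_iff.trans ⟨fun h x _ ↦ ?_, fun h ↦
    subsingleton_stalk_of_closed _ fun x hx ↦ ?_⟩
  · exact (subsingleton_stalk_tor_iff x F.pre _ (conductorResolution X) n).1 (h x)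
  · exact (subsingleton_stalk_tor_iff x F.pre _ (conductorResolution X) n).2 (h x hx)

include hF

/-- At a node, the vanishing of one `Tor_i` with `i ≥ 2` implies that of all; at a regular point,
all of them vanish anyway. -/
lemma isZero_tor_of_isZero_tor {n : ℕ}
    (h : Limits.IsZero (Modules.tor (n + 2) F X.structureSheafModConductor)) (m : ℕ) :
    Limits.IsZero (Modules.tor (m + 2) F X.structureSheafModConductor) := by
  have := hX.isNoetherian
  refine (hX.isZero_tor_iff F (m + 1)).2 fun x hx ↦ ?_
  have hn := (hX.isZero_tor_iff F (n + 1)).1 h x hx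
  have := Modules.finite_stalk hF x
  have (i : ℕ) : Module.Flat (X.presheaf.stalk x) (((conductorResolution X).complex.X i).Stalk x) :=
    flat_stalk_of_projective x
  have hd := stalkMap_projectiveResolution_exact (x := x) (conductorResolution X)
  rcases hX.regular_or_node x hx with hr | hnode
  · obtain ⟨_, _⟩ := exists_isDiscreteValuationRing (hX.dim_eq_one x hx) hr
    exact torVanishes_succ_of_free (fun n K ↦ inferInstance) hd m
  · obtain ⟨ε, hε, hdε⟩ := exists_stalkMap_projectiveResolution_augmentation (x := x)
      (conductorResolution X)
    obtain ⟨e⟩ := hX.nonempty_stalk_structureSheafModConductor_equiv hx hnode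
    exact TorVanishes.succ_of_succ (hX.hasDepthOne_stalk hx) hd hε hdε e hn m

/-- The dichotomy for the vanishing of `𝒯or_i(F, 𝒪 / 𝒥)`. -/
lemma isZero_tor_or : (∀ i : ℕ, 1 < i → Limits.IsZero
      (Modules.tor i F X.structureSheafModConductor)) ∨
    (∀ i : ℕ, 2 ≤ i → ¬ Limits.IsZero (Modules.tor i F X.structureSheafModConductor)) := by
  by_cases h : ∃ n, Limits.IsZero (Modules.tor (n + 2) F X.structureSheafModConductor)
  · obtain ⟨n, hn⟩ := h
    refine .inl fun i hi ↦ ?_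
    obtain ⟨m, rfl⟩ := Nat.exists_eq_add_of_le' (Nat.succ_le_of_lt hi)
    exact hX.isZero_tor_of_isZero_tor F hF hn m
  · refine .inr fun i hi h' ↦ h ?_
    obtain ⟨m, rfl⟩ := Nat.exists_eq_add_of_le' hi
    exact ⟨m, h'⟩

end AlgebraicGeometry.IsNodalProjectiveCurve

/-! ### Free sheaves of modules on a site -/

namespace PresheafOfModules

variable {C : Type u'} [Category.{v'} C] {R : Cᵒᵖ ⥤ RingCat.{u}} {M N : PresheafOfModules.{v} R}
  {I : Type*} [Fintype I]

lemma map_sum_smul {V W : Cᵒᵖ} (f : V ⟶ W) (a : I → R.obj V) (m : I → M.obj V) :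
    M.map f (∑ i, a i • m i) = ∑ i, R.map f (a i) • M.map f (m i) := by
  refine (map_sum (M.map f).hom _ _).trans (Finset.sum_congr rfl fun i _ ↦ ?_)
  exact M.map_smul f _ _

lemma app_sum_smul (q : M ⟶ N) {V : Cᵒᵖ} (a : I → R.obj V) (m : I → M.obj V) :
    q.app V (∑ i, a i • m i) = ∑ i, a i • q.app V (m i) := by
  refine (map_sum (q.app V).hom _ _).trans (Finset.sum_congr rfl fun i _ ↦ ?_)
  exact (q.app V).hom.map_smul _ _

end PresheafOfModules

namespace SheafOfModules

open PresheafOfModules (restr)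

variable {C : Type u'} [Category.{v'} C] {J : GrothendieckTopology C} {R : Sheaf J RingCat.{u}}
  [HasSheafify J AddCommGrpCat.{u}] [J.WEqualsLocallyBijective AddCommGrpCat.{u}]
  {M : SheafOfModules.{u} R}

/-- The coordinate forms of a free sheaf of modules. -/
lemma GeneratingSections.exists_dual (σ : M.GeneratingSections) [IsIso σ.π] (j : σ.I) :
    ∃ δ : M ⟶ unit R, (∀ V, δ.val.app V ((σ.s j).eval V) = (1 : R.obj.obj V)) ∧
      ∀ i ≠ j, ∀ V, δ.val.app V ((σ.s i).eval V) = 0 := by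
  classical
  let h : free σ.I ⟶ unit R :=
    (unit R).freeHomEquiv.symm fun i ↦ (unit R).unitHomEquiv (if i = j then 𝟙 _ else 0)
  have hs (i : σ.I) : sectionsMap (inv σ.π ≫ h) (σ.s i) =
      (unit R).unitHomEquiv (if i = j then 𝟙 _ else 0) := by
    have e : σ.s i = M.freeHomEquiv σ.π i := by rw [Equiv.apply_symm_apply]
    rw [e, ← freeHomEquiv_comp_apply, IsIso.hom_inv_id_assoc, Equiv.apply_symm_apply]
  refine ⟨inv σ.π ≫ h, fun V ↦ ?_, fun i hi V ↦ ?_⟩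
  · have := congrArg (fun s ↦ PresheafOfModules.sections.eval s V) (hs j)
    rw [if_pos rfl] at this
    exact this
  · have := congrArg (fun s ↦ PresheafOfModules.sections.eval s V) (hs i)
    rw [if_neg hi] at this
    exact this

lemma GeneratingSections.linearIndependent_eval (σ : M.GeneratingSections) [IsIso σ.π] (V : Cᵒᵖ) :
    LinearIndependent (R.obj.obj V) fun i ↦ (σ.s i).eval V := by
  refine linearIndependent_iff'.2 fun t g hg j hj ↦ ?_
  obtain ⟨δ, h1, h0⟩ := σ.exists_dual j
  have h := congrArg (δ.val.app V).hom hg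
  rw [map_zero, map_sum, Finset.sum_eq_single_of_mem j hj] at h
  · rw [map_smul] at h
    have e : (δ.val.app V).hom ((σ.s j).eval V) = (1 : R.obj.obj V) := h1 V
    rw [e] at h
    exact (mul_one (g j)).symm.trans h
  · intro i _ hi
    rw [map_smul]
    have e : (δ.val.app V).hom ((σ.s i).eval V) = 0 := h0 i hi V
    rw [e, smul_zero]

/-- A sheaf of modules is free on finitely many global sections if each section has unique
coordinates with respect to them. -/
lemma isIso_freeHomEquiv_symm {I : Type u} [Fintype I] (s : I → M.sections)
    (h : ∀ V (m : M.val.obj V), ∃! c : I → R.obj.obj V, ∑ i, c i • (s i).eval V = m) :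
    IsIso (M.freeHomEquiv.symm s) := by
  classical
  choose c hc hu using h
  have hu' {V} (a : I → R.obj.obj V) : c V (∑ i, a i • (s i).eval V) = a := (hu V _ a rfl).symm
  have hadd {V} (m n) : c V (m + n) = c V m + c V n := by
    rw [← hu' (c V m + c V n)]
    simp only [Pi.add_apply, add_smul, Finset.sum_add_distrib, hc]
  have hsmul {V} (r : R.obj.obj V) (m : M.val.obj V) : c V (r • m) = r • c V m := by
    rw [← hu' (r • c V m)]
    simp only [Pi.smul_apply, smul_assoc, ← Finset.smul_sum, hc]
  have hres {V W : Cᵒᵖ} (f : V ⟶ W) (m : M.val.obj V) :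
      c W (M.val.map f m) = fun i ↦ R.obj.map f (c V m i) := by
    rw [← hu' fun i ↦ R.obj.map f (c V m i)]
    congr 1
    conv_lhs => rw [← hc V m]
    rw [PresheafOfModules.map_sum_smul]
    exact Finset.sum_congr rfl fun i _ ↦ congrArg _ (PresheafOfModules.sections_property (s i) f)
  have hself {V : Cᵒᵖ} (i : I) : c V ((s i).eval V) = Pi.single i 1 := by
    rw [← hu' (V := V) (Pi.single i 1)]
    simp [Pi.single_apply, ite_smul]
  -- The inverse maps a section with coordinates `c` to the combination of the standard sections
  -- with coefficients `c`.
  let e (i : I) : (free (R := R) I).sections := freeSection i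
  let ρ : M ⟶ free I := ⟨PresheafOfModules.homMk
    { app := fun V ↦ AddCommGrpCat.ofHom (AddMonoidHom.mk'
        (fun m : M.val.obj V ↦ ∑ i, c V m i • (e i).eval V) fun m n ↦ by
          rw [hadd]
          simp only [Pi.add_apply, add_smul, Finset.sum_add_distrib])
      naturality := fun V W f ↦ by
        ext (m : M.val.obj V)
        change ∑ i, c W (M.val.map f m) i • (e i).eval W =
          (free I).val.map f (∑ i, c V m i • (e i).eval V)
        rw [PresheafOfModules.map_sum_smul, hres]
        exact Finset.sum_congr rfl fun i _ ↦
          congrArg _ (PresheafOfModules.sections_property (e i) f).symm } fun V r m ↦ by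
        change ∑ i, c V (r • m) i • (e i).eval V = r • ∑ i, c V m i • (e i).eval V
        simp only [hsmul, Pi.smul_apply, smul_assoc, Finset.smul_sum]⟩
  have hρ (V) (m : M.val.obj V) : ρ.val.app V m = ∑ i, c V m i • (e i).eval V := rfl
  refine ⟨ρ, ?_, ?_⟩
  · apply (free I).freeHomEquiv.injective
    funext i
    rw [freeHomEquiv_comp_apply, Equiv.apply_symm_apply]
    apply PresheafOfModules.sections_ext
    intro V
    refine (hρ V _).trans ?_
    rw [hself]
    simp [Pi.single_apply, ite_smul, e]
  · apply SheafOfModules.hom_ext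
    ext V m
    change (M.freeHomEquiv.symm s).val.app V (ρ.val.app V m) = m
    rw [hρ, PresheafOfModules.app_sum_smul]
    conv_rhs => rw [← hc V m]
    refine Finset.sum_congr rfl fun i _ ↦ congrArg _ ?_
    have := congrArg (fun t ↦ PresheafOfModules.sections.eval t V)
      (sectionsMap_freeHomEquiv_symm_freeSection s i)
    exact this

end SheafOfModules

/-! ### Frames of sheaves of modules -/

namespace AlgebraicGeometry.Scheme

open TopologicalSpace Opposite PresheafOfModules IsLocalRing

variable {X : Scheme.{u}} {M : X.Modules} {U V : X.Opens} {ι : Type*}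

/-- A family of sections of `M` over `U` is a frame if its germs form a basis of the stalk of `M`
at each point of `U`. -/
def IsFrame (s : ι → M.pre.obj (op U)) : Prop :=
  ∀ (x : X) (hx : x ∈ U), LinearIndependent (X.presheaf.stalk x)
      (fun i ↦ M.pre.germAt x U hx (s i)) ∧
    Submodule.span (X.presheaf.stalk x) (Set.range fun i ↦ M.pre.germAt x U hx (s i)) = ⊤

/-- The basis of a stalk given by a frame. -/
def IsFrame.basis {s : ι → M.pre.obj (op U)} (hs : IsFrame s) {x : X} (hx : x ∈ U) :
    Module.Basis ι (X.presheaf.stalk x) (M.stalk x) :=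
  .mk (hs x hx).1 (hs x hx).2.ge

lemma IsFrame.basis_apply {s : ι → M.pre.obj (op U)} (hs : IsFrame s) {x : X} (hx : x ∈ U) (i : ι) :
    hs.basis hx i = M.pre.germAt x U hx (s i) :=
  Module.Basis.mk_apply ..

lemma IsFrame.res {s : ι → M.pre.obj (op U)} (hs : IsFrame s) (i : V ⟶ U) :
    IsFrame fun j ↦ res (M := M.pre) i (s j) := fun x hx ↦ by
  have e (j) : M.pre.germAt x V hx (PresheafOfModules.res i (s j)) =
      M.pre.germAt x U (i.le hx) (s j) := germAt_res i hx _
  simp only [e]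
  exact hs x (i.le hx)

lemma germAt_sum_smul [Fintype ι] {x : X} (hx : x ∈ U) (a : ι → Γ(X, U))
    (s : ι → M.pre.obj (op U)) : M.pre.germAt x U hx (∑ i, a i • s i) =
      ∑ i, X.presheaf.germ U x hx (a i) • M.pre.germAt x U hx (s i) := by
  rw [map_sum]
  exact Finset.sum_congr rfl fun i _ ↦ germAt_smul hx _ _

lemma res_sum_smul [Fintype ι] (j : V ⟶ U) (a : ι → Γ(X, U))
    (s : ι → M.pre.obj (op U)) : res (M := M.pre) j (∑ i, a i • s i) =
      ∑ i, X.presheaf.map j.op (a i) • res (M := M.pre) j (s i) := by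
  rw [map_sum]
  exact Finset.sum_congr rfl fun i _ ↦ res_smul j _ _

lemma Modules.eq_of_germAt {m n : M.pre.obj (op U)}
    (h : ∀ (x : X) (hx : x ∈ U), M.pre.germAt x U hx m = M.pre.germAt x U hx n) : m = n :=
  sub_eq_zero.1 (M.eq_zero_of_germAt _ fun x hx ↦ by rw [map_sub, h, sub_self])

section Coordinates

variable [Fintype ι] {s : ι → M.pre.obj (op U)} (hs : IsFrame s)

include hs

lemma IsFrame.injective {a b : ι → Γ(X, U)} (h : ∑ i, a i • s i = ∑ i, b i • s i) : a = b := by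
  funext i
  refine TopCat.Presheaf.section_ext X.sheaf U _ _ fun x hx ↦ ?_
  have := congrArg (M.pre.germAt x U hx) h
  rw [germAt_sum_smul, germAt_sum_smul] at this
  exact congrFun ((hs x hx).1.fintypeLinearCombination_injective (by
    simpa [Fintype.linearCombination_apply] using this)) i

/-- Near each point, a section has coordinates with respect to a frame. -/
lemma IsFrame.exists_coord_near (m : M.pre.obj (op U)) {x : X} (hx : x ∈ U) :
    ∃ (V : X.Opens) (_ : x ∈ V) (j : V ⟶ U) (a : ι → Γ(X, V)),
      ∑ i, a i • PresheafOfModules.res (M := M.pre) j (s i) =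
        PresheafOfModules.res (M := M.pre) j m := by
  obtain ⟨W, hW, a, ha⟩ := exists_germ_eq_of_fintype (R := X.presheaf) x
    fun i ↦ (hs.basis hx).repr (M.pre.germAt x U hx m) i
  let j : U ⊓ W ⟶ U := homOfLE inf_le_left
  let j' : U ⊓ W ⟶ W := homOfLE inf_le_right
  have hx' : x ∈ U ⊓ W := ⟨hx, hW⟩
  let b (i) : Γ(X, U ⊓ W) := X.presheaf.map j'.op (a i)
  have hb (i) : X.presheaf.germ _ x hx' (b i) = (hs.basis hx).repr (M.pre.germAt x U hx m) i :=
    (TopCat.Presheaf.germ_res_apply X.presheaf j' x hx' (a i)).trans (ha i)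
  obtain ⟨V, hV, k, k', e⟩ := exists_map_eq_of_germAt_eq (M := M.pre) hx' hx'
      (∑ i, b i • PresheafOfModules.res (M := M.pre) j (s i))
      (PresheafOfModules.res (M := M.pre) j m) (by
    rw [germAt_sum_smul, germAt_res]
    simp only [hb]
    rw [← (hs.basis hx).sum_repr (M.pre.germAt x U hx m)]
    refine Finset.sum_congr rfl fun i _ ↦ ?_
    rw [hs.basis_apply, (hs.basis hx).sum_repr]
    congr 1
    exact germAt_res j hx' (s i))
  refine ⟨V, hV, k ≫ j, fun i ↦ X.presheaf.map k.op (b i), ?_⟩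
  rw [res_sum_smul, res_res] at e
  simp only [res_res] at e
  exact e

/-- The sections of `M` over `U` have unique coordinates with respect to a frame over `U`: these
exist locally, and are glued in `𝒪_X`. -/
lemma IsFrame.existsUnique_coord (m : M.pre.obj (op U)) :
    ∃! a : ι → Γ(X, U), ∑ i, a i • s i = m := by
  refine existsUnique_of_exists_of_unique ?_ fun a b ha hb ↦ hs.injective (ha.trans hb.symm)
  choose V hV j a ha using fun x : U ↦ hs.exists_coord_near m x.2
  have hcompat (i : ι) : TopCat.Presheaf.IsCompatible X.sheaf.1 V fun x ↦ a x i := fun x y ↦ by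
    let kx : V x ⊓ V y ⟶ V x := homOfLE inf_le_left
    let ky : V x ⊓ V y ⟶ V y := homOfLE inf_le_right
    refine congrFun ((hs.res (kx ≫ j x)).injective
      (a := fun i ↦ X.presheaf.map kx.op (a x i))
      (b := fun i ↦ X.presheaf.map ky.op (a y i)) ?_) i
    have hx := congrArg (PresheafOfModules.res (M := M.pre) kx) (ha x)
    have hy := congrArg (PresheafOfModules.res (M := M.pre) ky) (ha y)
    rw [res_sum_smul, res_res] at hx hy
    simp only [res_res] at hx hy
    exact hx.trans hy.symm
  have hex (i : ι) : ∃ c : Γ(X, U), ∀ x, X.presheaf.map (j x).op c = a x i :=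
    (TopCat.Sheaf.existsUnique_gluing' X.sheaf V U j
      (fun x hx ↦ Opens.mem_iSup.2 ⟨⟨x, hx⟩, hV _⟩) (fun x ↦ a x i) (hcompat i)).exists
  choose c hc using hex
  refine ⟨c, Modules.eq_of_germAt fun x hx ↦ ?_⟩
  have e := congrArg (M.pre.germAt x _ (hV ⟨x, hx⟩)) (ha ⟨x, hx⟩)
  rw [germAt_res] at e
  rw [← e, ← germAt_res (M := M.pre) (j ⟨x, hx⟩) (hV ⟨x, hx⟩), res_sum_smul]
  refine congrArg _ ?_
  exact Finset.sum_congr rfl fun i _ ↦ congrArg (· • _) (hc i ⟨x, hx⟩)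

end Coordinates

end AlgebraicGeometry.Scheme

/-! ### Vector bundles and frames -/

namespace AlgebraicGeometry.Scheme

open TopologicalSpace Opposite PresheafOfModules IsLocalRing

variable {X : Scheme.{u}} {M : X.Modules} {U V : X.Opens}

lemma linearIndependent_res_generator (σ : (SheafOfModules.over M U).GeneratingSections)
    [IsIso σ.π] (j : V ⟶ U) :
    LinearIndependent Γ(X, V) fun i ↦ res (M := M.pre) j (generator σ i) := by
  have h := σ.linearIndependent_eval (op (Over.mk j))
  simp only [eval_eq_res_generator] at h
  exact h

/-- A relation between the germs of the generators comes from a relation between their restrictions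
to a neighbourhood, hence is trivial. -/
lemma isFrame_generator (σ : (SheafOfModules.over M U).GeneratingSections)
    [IsIso σ.π] : IsFrame (generator σ) := fun x hx ↦ by
  refine ⟨linearIndependent_iff_finset_linearIndependent.2 fun t ↦
    Fintype.linearIndependent_iff.2 fun g hg i ↦ ?_, span_germAt_generator σ hx⟩
  obtain ⟨W, hW, a, ha⟩ := exists_germ_eq_of_fintype (R := X.presheaf) x g
  let j : U ⊓ W ⟶ U := homOfLE inf_le_left
  let j' : U ⊓ W ⟶ W := homOfLE inf_le_right
  have hx' : x ∈ U ⊓ W := ⟨hx, hW⟩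
  let b (i) : Γ(X, U ⊓ W) := X.presheaf.map j'.op (a i)
  have hb (i) : X.presheaf.germ _ x hx' (b i) = g i :=
    (TopCat.Presheaf.germ_res_apply X.presheaf j' x hx' (a i)).trans (ha i)
  obtain ⟨V, hV, k, e⟩ := exists_map_eq_zero_of_germAt_eq_zero (M := M.pre) hx'
      (∑ i, b i • res (M := M.pre) j (generator σ i.1)) (by
    rw [germAt_sum_smul]
    simp only [hb]
    refine Eq.trans (Finset.sum_congr rfl fun i _ ↦ congrArg _ ?_) hg
    exact germAt_res j hx' _)
  rw [res_sum_smul] at e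
  simp only [res_res] at e
  have := Fintype.linearIndependent_iff.1 ((linearIndependent_res_generator σ (k ≫ j)).comp
    (Subtype.val : t → σ.I) Subtype.val_injective) _ e i
  rw [← hb, ← TopCat.Presheaf.germ_res_apply X.presheaf k x hV, this, map_zero]

/-- A vector bundle has a finite frame near each point. -/
lemma Modules.IsVectorBundle.exists_isFrame (hM : M.IsVectorBundle) (x : X) :
    ∃ (U : X.Opens) (_ : x ∈ U) (ι : Type u) (_ : Finite ι) (s : ι → M.pre.obj (op U)),
      IsFrame s := by
  obtain ⟨⟨⟨σ, hσ⟩⟩, hfin⟩ := hM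
  obtain ⟨i, hi⟩ := exists_mem_of_coversTop σ.coversTop x
  have := hσ.isIso i
  have := Modules.finite_stalk hfin x
  have hs := isFrame_generator (σ.generators i)
  exact ⟨σ.X i, hi, _, Module.Finite.finite_basis (hs.basis hi), _, hs⟩

/-- A section of `M` over `U`, as a global section of the restriction of `M` to `U`. -/
def overSection (m : M.pre.obj (op U)) : (SheafOfModules.over M U).sections :=
  PresheafOfModules.sectionsMk (fun V ↦ (res (M := M.pre) V.unop.hom m : M.pre.obj _))
    fun V _ f ↦ (res_res (M := M.pre) V.unop.hom f.unop.left m).trans rfl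

lemma IsFrame.isIso {ι : Type u} [Finite ι] {s : ι → M.pre.obj (op U)} (hs : IsFrame s) :
    IsIso ((SheafOfModules.over M U).freeHomEquiv.symm fun i ↦ overSection (s i)) := by
  have := Fintype.ofFinite ι
  exact SheafOfModules.isIso_freeHomEquiv_symm _ fun V m ↦ (hs.res V.unop.hom).existsUnique_coord m

/-- The generating sections of the restriction of `M` to `U` given by a frame. -/
def IsFrame.generatingSections {ι : Type u} [Finite ι] {s : ι → M.pre.obj (op U)}
    (hs : IsFrame s) : (SheafOfModules.over M U).GeneratingSections where
  I := ι
  s i := overSection (s i)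
  epi := by
    have := hs.isIso
    infer_instance

/-- A sheaf of modules with a finite frame near each point is a vector bundle. -/
lemma Modules.isVectorBundle_of_exists_isFrame
    (h : ∀ x : X, ∃ (U : X.Opens) (_ : x ∈ U) (ι : Type u) (_ : Finite ι)
      (s : ι → M.pre.obj (op U)), IsFrame s) : M.IsVectorBundle := by
  choose U hU ι hι s hs using h
  let σ : SheafOfModules.LocalGeneratorsData.{u} (R := X.ringCatSheaf) M :=
    { I := X
      X := U
      coversTop := fun W x hx ↦
        ⟨U x ⊓ W, homOfLE inf_le_right, ⟨x, ⟨homOfLE inf_le_left⟩⟩, ⟨hU x, hx⟩⟩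
      generators := fun x ↦ (hs x).generatingSections }
  have h1 : σ.IsLocallyFreeData :=
    SheafOfModules.LocalGeneratorsData.IsLocallyFreeData.mk (R := X.ringCatSheaf) (q := σ)
      fun x ↦ (hs x).isIso
  have h2 : σ.IsFiniteType :=
    SheafOfModules.LocalGeneratorsData.IsFiniteType.mk (R := X.ringCatSheaf) (p := σ)
      fun x ↦ { finite := hι x }
  exact ⟨SheafOfModules.IsLocallyFree.mk (R := X.ringCatSheaf) ⟨σ, h1⟩,
    SheafOfModules.IsFiniteType.mk (R := X.ringCatSheaf) ⟨σ, h2⟩⟩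

end AlgebraicGeometry.Scheme

/-! ### Bases and exact sequences of modules -/

section Algebra

variable {A K L M ι κ : Type*} [CommRing A] [AddCommGroup K] [AddCommGroup L] [AddCommGroup M]
  [Module A K] [Module A L] [Module A M] {f : K →ₗ[A] L} {g : L →ₗ[A] M} {b : ι → K} {t : κ → L}

/-- A basis of the kernel, together with lifts of a basis of the quotient, is a basis. -/
lemma linearIndependent_sumElim_of_exact (hf : Function.Injective f) (hfg : Function.Exact f g)
    (hb : LinearIndependent A b) (ht : LinearIndependent A (g ∘ t)) :
    LinearIndependent A (Sum.elim (f ∘ b) t) := by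
  refine LinearIndependent.sum_type (hb.map' f (LinearMap.ker_eq_bot.2 hf)) ht.of_comp ?_
  rw [Submodule.disjoint_def]
  intro y hy hy'
  have h0 : g y = 0 := by
    have : Submodule.span A (Set.range (f ∘ b)) ≤ LinearMap.ker g := by
      rw [Submodule.span_le]
      rintro _ ⟨i, rfl⟩
      exact hfg.apply_apply_eq_zero _
    exact this hy
  obtain ⟨c, rfl⟩ := (Finsupp.mem_span_range_iff_exists_finsupp).1 hy'
  have : c = 0 := by
    refine linearIndependent_iff.1 ht c ?_
    rw [← h0, Finsupp.linearCombination_apply, map_finsuppSum]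
    simp
  simp [this]

lemma span_sumElim_eq_top_of_exact (hfg : Function.Exact f g)
    (hb : Submodule.span A (Set.range b) = ⊤) (ht : Submodule.span A (Set.range (g ∘ t)) = ⊤) :
    Submodule.span A (Set.range (Sum.elim (f ∘ b) t)) = ⊤ := by
  rw [Set.Sum.elim_range, Submodule.span_union, Set.range_comp, ← Submodule.map_span, hb,
    Submodule.map_top, ← hfg.linearMap_ker_eq]
  refine Submodule.eq_top_iff'.2 fun y ↦ ?_
  have hy : g y ∈ Submodule.map g (Submodule.span A (Set.range t)) := by
    rw [Submodule.map_span, ← Set.range_comp, ht]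
    trivial
  obtain ⟨z, hz, e⟩ := hy
  rw [← sub_add_cancel y z]
  exact Submodule.add_mem_sup (by rw [LinearMap.mem_ker, map_sub, e, sub_self]) hz

lemma linearIndependent_comp_of_exact (hfg : Function.Exact f g)
    (hb : Submodule.span A (Set.range b) = ⊤)
    (h : LinearIndependent A (Sum.elim (f ∘ b) t)) : LinearIndependent A (g ∘ t) := by
  refine (linearIndependent_sum.1 h).2.1.map ?_
  rw [hfg.linearMap_ker_eq, ← Submodule.map_top, ← hb, Submodule.map_span, ← Set.range_comp]
  exact (linearIndependent_sum.1 h).2.2.symm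

lemma span_comp_eq_top_of_exact (hfg : Function.Exact f g) (hg : Function.Surjective g)
    (h : Submodule.span A (Set.range (Sum.elim (f ∘ b) t)) = ⊤) :
    Submodule.span A (Set.range (g ∘ t)) = ⊤ := by
  rw [Set.range_comp, ← Submodule.map_span, eq_top_iff, ← LinearMap.range_eq_top.2 hg,
    ← Submodule.map_top, ← h, Submodule.map_span_le]
  rintro _ ⟨i | i, rfl⟩
  · rw [Sum.elim_inl, Function.comp_apply, hfg.apply_apply_eq_zero]
    exact zero_mem _
  · exact Submodule.mem_map_of_mem (Submodule.subset_span ⟨i, rfl⟩)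

end Algebra

/-! ### Exact sequences of sheaves of modules -/

namespace SheafOfModules

open PresheafOfModules (restr)

variable {C : Type u'} [Category.{v'} C] {J : GrothendieckTopology C} {R : Sheaf J RingCat.{u}}
  [HasSheafify J AddCommGrpCat.{u}] [J.WEqualsLocallyBijective AddCommGrpCat.{u}]
  {K L M : SheafOfModules.{u} R}

omit [HasSheafify J AddCommGrpCat.{u}] [J.WEqualsLocallyBijective AddCommGrpCat.{u}] in
lemma injective_app_of_mono (f : K ⟶ L) (hf : Mono f) (U : Cᵒᵖ) :
    Function.Injective (f.val.app U) := by
  have : Mono f.val := inferInstanceAs (Mono ((forget R).map f))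
  exact PresheafOfModules.injective_of_mono f.val U

lemma exact_val {f : K ⟶ L} {g : L ⟶ M} {w : f ≫ g = 0}
    (h : (ShortComplex.mk f g w).ShortExact) :
    (ShortComplex.mk f.val g.val (congrArg Hom.val w)).Exact :=
  h.exact.map_of_mono_of_preservesKernel (forget R) h.mono_f inferInstance

/-- Epimorphisms of sheaves of modules are locally surjective. -/
lemma locally_exists_of_epi (g : L ⟶ M) (hg : Epi g) {U : C} (m : M.val.obj (Opposite.op U)) :
    ∃ S ∈ J U, ∀ ⦃V : C⦄ (i : V ⟶ U), S i → ∃ l, g.val.app (Opposite.op V) l = restr i m :=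
  locally_mem_submodule M
    { obj := fun V ↦ LinearMap.range (g.val.app V).hom
      map := fun {V W} i ↦ by
        rintro _ ⟨l, rfl⟩
        exact ⟨L.val.map i l, PresheafOfModules.naturality_apply g.val i l⟩ }
    (fun Q q hq ↦ by
      rw [← cancel_epi g, Limits.comp_zero]
      apply SheafOfModules.hom_ext
      ext V l
      exact hq V _ ⟨l, rfl⟩) m

end SheafOfModules

namespace AlgebraicGeometry.Scheme

open TopologicalSpace Opposite PresheafOfModules IsLocalRing

variable {X : Scheme.{u}} {K L M : X.Modules} {U V : X.Opens}

/-- Sections which form a basis of the stalk at one point form a frame near this point, if there is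
some frame near this point: their determinant with respect to the latter is invertible there. -/
lemma IsFrame.exists_isFrame_res {ι κ : Type*} [Finite ι] [Finite κ] {s : ι → M.pre.obj (op U)}
    (hs : IsFrame s) {x : X} (hx : x ∈ U) (t : κ → M.pre.obj (op U))
    (h : LinearIndependent (X.presheaf.stalk x) (fun i ↦ M.pre.germAt x U hx (t i)))
    (h' : Submodule.span (X.presheaf.stalk x) (Set.range fun i ↦ M.pre.germAt x U hx (t i)) = ⊤) :
    ∃ (V : X.Opens) (_ : x ∈ V) (j : V ⟶ U),
      IsFrame fun i ↦ PresheafOfModules.res (M := M.pre) j (t i) := by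
  classical
  have := Fintype.ofFinite ι
  have := Fintype.ofFinite κ
  let e : ι ≃ κ := (hs.basis hx).indexEquiv (.mk h h'.ge)
  choose a ha _ using fun i ↦ hs.existsUnique_coord (t i)
  let B : Matrix ι ι Γ(X, U) := .of fun i j ↦ a (e j) i
  -- The points at which `t` is a basis are those at which the determinant is a unit.
  have key (y : X) (hy : y ∈ U) : (LinearIndependent (X.presheaf.stalk y)
        (fun i ↦ M.pre.germAt y U hy (t i)) ∧ Submodule.span (X.presheaf.stalk y)
        (Set.range fun i ↦ M.pre.germAt y U hy (t i)) = ⊤) ↔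
      IsUnit (X.presheaf.germ U y hy B.det) := by
    have h1 := Module.Basis.is_basis_iff_det (hs.basis hy)
      (v := fun i ↦ M.pre.germAt y U hy (t (e i)))
    have h2 : (hs.basis hy).det (fun i ↦ M.pre.germAt y U hy (t (e i))) =
        X.presheaf.germ U y hy B.det := by
      rw [Module.Basis.det_apply]
      refine Eq.trans ?_ (RingHom.map_det (X.presheaf.germ U y hy).hom B).symm
      congr 1
      ext i j
      have : M.pre.germAt y U hy (t (e j)) =
          ∑ l, X.presheaf.germ U y hy (a (e j) l) • hs.basis hy l := by
        rw [← ha (e j), germAt_sum_smul]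
        simp only [hs.basis_apply]
      rw [Module.Basis.toMatrix_apply, this, (hs.basis hy).repr_sum_self]
      rfl
    rw [h2] at h1
    rw [← h1]
    refine and_congr (linearIndependent_equiv e).symm ?_
    have : Set.range (fun i ↦ M.pre.germAt y U hy (t (e i))) =
        Set.range (fun i ↦ M.pre.germAt y U hy (t i)) :=
      e.surjective.range_comp fun i ↦ M.pre.germAt y U hy (t i)
    rw [this]
  refine ⟨X.basicOpen B.det, (X.mem_basicOpen _ x hx).2 ((key x hx).1 ⟨h, h'⟩),
    homOfLE (X.basicOpen_le _), fun y hy ↦ ?_⟩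
  have := (key y (X.basicOpen_le _ hy)).2 ((X.mem_basicOpen _ y _).1 hy)
  have e (i) : M.pre.germAt y _ hy (PresheafOfModules.res (homOfLE (X.basicOpen_le B.det)) (t i)) =
      M.pre.germAt y U (X.basicOpen_le _ hy) (t i) := germAt_res _ hy _
  simp only [e]
  exact this

section ShortExact

lemma stalkMap_injective (f : K ⟶ L) (hf : Mono f) (x : X) :
    Function.Injective (stalkMap x (Modules.preHom f)) := by
  refine (injective_iff_map_eq_zero _).2 fun s hs ↦ ?_
  obtain ⟨U, hU, m, rfl⟩ := exists_germAt_eq s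
  rw [stalkMap_germAt] at hs
  obtain ⟨V, hV, i, hi⟩ := exists_map_eq_zero_of_germAt_eq_zero hU _ hs
  rw [← app_res] at hi
  have h0 := SheafOfModules.injective_app_of_mono (R := X.ringCatSheaf) f hf _
    (hi.trans (map_zero _).symm)
  rw [← germAt_res i hV, h0, map_zero]

/-- Epimorphisms of sheaves of modules are surjective on stalks. -/
lemma stalkMap_surjective_of_epi (g : L ⟶ M) (hg : Epi g) (x : X) :
    Function.Surjective (stalkMap x (Modules.preHom g)) := by
  intro s
  obtain ⟨U, hU, m, rfl⟩ := exists_germAt_eq s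
  obtain ⟨S, hS, hS'⟩ := SheafOfModules.locally_exists_of_epi (R := X.ringCatSheaf) g hg m
  obtain ⟨V, i, hi, hxV⟩ := exists_opens_of_mem_grothendieckTopology hS hU
  obtain ⟨l, hl⟩ := hS' i hi
  refine ⟨L.pre.germAt x V hxV l, ?_⟩
  rw [stalkMap_germAt, ← germAt_res i hxV]
  exact congrArg _ hl

lemma stalkMap_exact_of_shortExact {f : K ⟶ L} {g : L ⟶ M} {w : f ≫ g = 0}
    (h : (ShortComplex.mk f g w).ShortExact) (x : X) :
    Function.Exact (stalkMap x (Modules.preHom f)) (stalkMap x (Modules.preHom g)) := by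
  exact stalkMap_exact x (exact_app_of_exact (SheafOfModules.exact_val (R := X.ringCatSheaf) h))

end ShortExact

end AlgebraicGeometry.Scheme

/-! ### Resolutions by vector bundles -/

namespace AlgebraicGeometry.Scheme

open TopologicalSpace Opposite PresheafOfModules IsLocalRing

variable {X : Scheme.{u}} {K L M : X.Modules} {U V : X.Opens}

lemma Modules.IsVectorBundle.free_stalk (hM : M.IsVectorBundle) (x : X) :
    Module.Free (X.presheaf.stalk x) (M.stalk x) := by
  obtain ⟨U, hx, ι, _, s, hs⟩ := hM.exists_isFrame x
  exact .of_basis (hs.basis hx)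

lemma Modules.IsVectorBundle.embedsInFree_stalk (hM : M.IsVectorBundle) (x : X) :
    EmbedsInFree (X.presheaf.stalk x) (M.stalk x) := by
  have := hM.free_stalk x
  have := Modules.finite_stalk hM.2 x
  exact ⟨_, (Module.finBasis (X.presheaf.stalk x) (M.stalk x)).equivFun.toLinearMap,
    (Module.finBasis (X.presheaf.stalk x) (M.stalk x)).equivFun.injective⟩

/-- Let `0 → K → L → M → 0` be exact with vector bundles `K` and `L`. If the stalk of `M` at `x` is
free, then `M` has a frame near `x`: a frame of `K` and lifts of a basis of the stalk of `M` form a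
frame of `L` near `x`. -/
lemma exists_isFrame_of_shortExact {f : K ⟶ L} {g : L ⟶ M} {w : f ≫ g = 0}
    (h : (ShortComplex.mk f g w).ShortExact) (hK : K.IsVectorBundle) (hL : L.IsVectorBundle)
    (x : X) [Module.Free (X.presheaf.stalk x) (M.stalk x)] :
    ∃ (U : X.Opens) (_ : x ∈ U) (ι : Type u) (_ : Finite ι) (s : ι → M.pre.obj (op U)),
      IsFrame s := by
  have hsurj (y : X) : Function.Surjective (stalkMap y (Modules.preHom g)) :=
    stalkMap_surjective_of_epi g h.epi_g y
  have hex (y : X) : Function.Exact (stalkMap y (Modules.preHom f))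
      (stalkMap y (Modules.preHom g)) := stalkMap_exact_of_shortExact h y
  have := Modules.finite_stalk hL.2 x
  have : Module.Finite (X.presheaf.stalk x) (M.stalk x) :=
    .of_surjective (stalkMap x (Modules.preHom g)) (hsurj x)
  obtain ⟨U₁, hx₁, ι, _, b, hb⟩ := hK.exists_isFrame x
  obtain ⟨U₂, hx₂, ι', _, s, hs⟩ := hL.exists_isFrame x
  let β := Module.Free.chooseBasis (X.presheaf.stalk x) (M.stalk x)
  choose l hl using fun i ↦ hsurj x (β i)
  obtain ⟨U₃, hx₃, t, ht⟩ := exists_germAt_eq_of_fintype (M := L.pre) x l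
  let W : X.Opens := U₁ ⊓ U₂ ⊓ U₃
  have hxW : x ∈ W := ⟨⟨hx₁, hx₂⟩, hx₃⟩
  let j₁ : W ⟶ U₁ := homOfLE (inf_le_left.trans inf_le_left)
  let j₂ : W ⟶ U₂ := homOfLE (inf_le_left.trans inf_le_right)
  let j₃ : W ⟶ U₃ := homOfLE inf_le_right
  let b' (i) : K.pre.obj (op W) := res (M := K.pre) j₁ (b i)
  have hb' : IsFrame b' := hb.res j₁
  let t' (i) : L.pre.obj (op W) := res (M := L.pre) j₃ (t i)
  have ht' (i) : L.pre.germAt x W hxW (t' i) = l i := (germAt_res j₃ hxW _).trans (ht i)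
  let r : ι ⊕ _ → L.pre.obj (op W) := Sum.elim (fun i ↦ (Modules.preHom f).app (op W) (b' i)) t'
  have hr (y : X) (hy : y ∈ W) : (fun i ↦ L.pre.germAt y W hy (r i)) =
      Sum.elim (stalkMap y (Modules.preHom f) ∘ fun i ↦ K.pre.germAt y W hy (b' i))
        (fun i ↦ L.pre.germAt y W hy (t' i)) := by
    funext i
    rcases i with i | i
    · exact (stalkMap_germAt y (Modules.preHom f) W hy (b' i)).symm
    · rfl
  have hgt : (stalkMap x (Modules.preHom g) ∘ fun i ↦ L.pre.germAt x W hxW (t' i)) = β := by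
    funext i
    simp only [Function.comp_apply, ht', hl]
  obtain ⟨V, hxV, j, hV⟩ := (hs.res j₂).exists_isFrame_res hxW r
    (by
      rw [hr]
      refine linearIndependent_sumElim_of_exact (stalkMap_injective f h.mono_f x) (hex x)
        (hb' x hxW).1 ?_
      rw [hgt]
      exact β.linearIndependent)
    (by
      rw [hr]
      refine span_sumElim_eq_top_of_exact (hex x) (hb' x hxW).2 ?_
      rw [hgt]
      exact β.span_eq)
  refine ⟨V, hxV, _, inferInstance, fun i ↦ (Modules.preHom g).app (op V) (res j (t' i)),
    fun y hy ↦ ?_⟩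
  have hyW : y ∈ W := j.le hy
  have e1 : (fun i ↦ L.pre.germAt y V hy (res j (r i))) =
      Sum.elim (stalkMap y (Modules.preHom f) ∘ fun i ↦ K.pre.germAt y W hyW (b' i))
        (fun i ↦ L.pre.germAt y W hyW (t' i)) := by
    rw [← hr y hyW]
    funext i
    exact germAt_res j hy _
  have e2 : (fun i ↦ M.pre.germAt y V hy ((Modules.preHom g).app (op V) (res j (t' i)))) =
      stalkMap y (Modules.preHom g) ∘ fun i ↦ L.pre.germAt y W hyW (t' i) := by
    funext i
    rw [Function.comp_apply, ← germAt_res j hy, stalkMap_germAt]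
  have hVy := hV y hy
  rw [e1] at hVy
  rw [e2]
  exact ⟨linearIndependent_comp_of_exact (hex y) (hb' y hyW).2 hVy.1,
    span_comp_eq_top_of_exact (hex y) (hsurj y) hVy.2⟩

end AlgebraicGeometry.Scheme

namespace AlgebraicGeometry.IsNodalProjectiveCurve

open Scheme

variable {k : Type u} [Field k] {X : Scheme.{u}} {f : X ⟶ Spec (.of k)}
  (hX : IsNodalProjectiveCurve f)

include hX

/-- A quotient of vector bundles which embeds in a vector bundle is a vector bundle, since its
stalks at the closed points are torsion-free of projective dimension at most one over local rings
of depth one. -/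
lemma isVectorBundle_of_shortExact {K L M N : X.Modules} {a : K ⟶ L} {b : L ⟶ M} {w : a ≫ b = 0}
    (h : (ShortComplex.mk a b w).ShortExact) (hK : K.IsVectorBundle) (hL : L.IsVectorBundle)
    (c : M ⟶ N) (hc : Mono c) (hN : N.IsVectorBundle) : M.IsVectorBundle := by
  have := hX.isNoetherian
  refine Modules.isVectorBundle_of_exists_isFrame fun y ↦ ?_
  obtain ⟨x, hx, hyx⟩ := hX.exists_specializes y
  have := hK.free_stalk x
  have := hL.free_stalk x
  have := Modules.finite_stalk hK.2 x
  have := Modules.finite_stalk hL.2 x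
  have : Module.Free (X.presheaf.stalk x) (M.stalk x) := by
    refine free_of_exact_of_regular_smul_injective (hX.hasDepthOne_stalk hx)
      (stalkMap_injective a h.mono_f x) (stalkMap_exact_of_shortExact h x)
      (stalkMap_surjective_of_epi b h.epi_g x) fun t ht m hm ↦ ?_
    refine stalkMap_injective c hc x ?_
    rw [map_zero]
    refine (hN.embedsInFree_stalk x).smul_eq_zero ht _ ?_
    rw [← map_smul, hm, map_zero]
  obtain ⟨U, hxU, ι, hι, s, hs⟩ := exists_isFrame_of_shortExact h hK hL x
  exact ⟨U, hyx.mem_open U.isOpen hxU, ι, hι, s, hs⟩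

/-- A subsheaf of a vector bundle which has a finite resolution by vector bundles is itself a vector
bundle. -/
lemma isVectorBundle_of_hasVectorBundleResolution (n : ℕ) {K E : X.Modules} (c : K ⟶ E)
    (hc : Mono c) (hE : E.IsVectorBundle) (hK : K.HasVectorBundleResolution n) :
    K.IsVectorBundle := by
  induction n generalizing K E with
  | zero => exact hK
  | succ n ih =>
    obtain ⟨K', E', a, b, w, h, hE', hK'⟩ := hK
    exact hX.isVectorBundle_of_shortExact h (ih a h.mono_f hE' hK') hE' c hc hE

/-- The kernel of a surjection from a vector bundle is a subsheaf of a vector bundle, so a finite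
resolution may be truncated to length at most one. -/
lemma hasVectorBundleResolution_zero_or_one {n : ℕ} {F : X.Modules}
    (hF : F.HasVectorBundleResolution n) :
    F.HasVectorBundleResolution 0 ∨ F.HasVectorBundleResolution 1 := by
  cases n with
  | zero => exact .inl hF
  | succ n =>
    obtain ⟨K, E, a, b, w, h, hE, hK⟩ := hF
    exact .inr ⟨K, E, a, b, w, h, hE,
      hX.isVectorBundle_of_hasVectorBundleResolution n a h.mono_f hE hK⟩

lemma homologicalDimension_eq (F : X.Modules) :
    F.homologicalDimension = 0 ∨ F.homologicalDimension = 1 ∨ F.homologicalDimension = ⊤ := by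
  by_cases h0 : F.HasVectorBundleResolution 0
  · exact .inl (nonpos_iff_eq_zero.1 (iInf₂_le_of_le 0 h0 le_rfl))
  by_cases h1 : F.HasVectorBundleResolution 1
  · refine .inr (.inl (le_antisymm (iInf₂_le_of_le 1 h1 le_rfl) (le_iInf₂ fun n hn ↦ ?_)))
    have hn0 : n ≠ 0 := fun h ↦ h0 (h ▸ hn)
    exact_mod_cast Nat.one_le_iff_ne_zero.2 hn0
  · refine .inr (.inr (iInf₂_eq_top.2 fun n hn ↦ ?_))
    exact ((hX.hasVectorBundleResolution_zero_or_one hn).elim h0 h1).elim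

end AlgebraicGeometry.IsNodalProjectiveCurve

end

theorem mainTheorem7 {k : Type u} [Field k] [IsAlgClosed k]
    {X : AlgebraicGeometry.Scheme.{u}}
    (f : X ⟶ AlgebraicGeometry.Spec (CommRingCat.of k))
    (hX : AlgebraicGeometry.IsNodalProjectiveCurve f)
    (F : X.Modules) (hF : F.IsCoherent) :
    ((∀ i : ℕ, 1 < i → CategoryTheory.Limits.IsZero
        (AlgebraicGeometry.Scheme.Modules.tor i F X.structureSheafModConductor)) ∨
      (∀ i : ℕ, 2 ≤ i → ¬ CategoryTheory.Limits.IsZero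
        (AlgebraicGeometry.Scheme.Modules.tor i F X.structureSheafModConductor))) ∧
    (F.homologicalDimension = 0 ∨ F.homologicalDimension = 1 ∨ F.homologicalDimension = ⊤) :=
  ⟨hX.isZero_tor_or F hF.2, hX.homologicalDimension_eq F⟩
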